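/- Let $\alpha,\beta:\mathbb R\to(0,\infty)$ have bounded variation, with $\inf_{\mathbb R}\alpha>0$, $\inf_{\mathbb R}\beta>0$, and suppose there is $R_0>0$ such that $\alpha(x)=\beta(x)=1$ for $|x|\ge R_0$. Let $\mathcal H=L^2(\mathbb R;\beta(x)\,dx)$ and let $H$ be the operator $Hu=-\beta^{-1}\partial_x(\alpha\,\partial_xu)$ on $\mathcal H$ with domain $$\mathcal D(H)=\{u\in L^2(\mathbb R): u,\partial_xu\in L^2(\mathbb R)\cap L^\infty(\mathbb R),\ \partial_x(\alpha\,\partial_xu)\in L^2(\mathbb R)\}$$ (derivatives in the sense of distributions), where $\mathcal D(H)$ carries the graph norm $u\mapsto(\|u\|_{\mathcal H}^2+\|Hu\|_{\mathcal H}^2)^{1/2}$. Let $\chi\in C_0^\infty(\mathbb R;[0,1])$ be identically one near $[-R_0,R_0]$. Then the cutoff resolvent $$\chi R(\lambda)\chi=\chi(H-\lambda^2)^{-1}\chi:\mathcal H\to\mathcal D(H),$$ defined for $\operatorname{Im}\lambda>0$, has a unique meromorphic continuation (still denoted $\chi R(\lambda)\chi$) to $\lambda\in\mathbb C$, and there exist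 constants $C,\lambda_0,\varepsilon_0>0$ such that this continuation has no poles in $\{|\operatorname{Re}\lambda|\ge\lambda_0,\ |\operatorname{Im}\lambda|\le\varepsilon_0\}$ and $$\|\chi R(\lambda)\chi\|_{\mathcal H\to\mathcal H}\le C\,|\operatorname{Re}\lambda|^{-1}\qquad\text{whenever } |\operatorname{Re}\lambda|\ge\lambda_0,\ |\operatorname{Im}\lambda|\le\varepsilon_0 .$$ -/

import Mathlib

open MeasureTheory Set Filter Topology
open scoped ENNReal ContDiff

noncomputable section

/-- `g'` is the derivative of `g` in the sense of distributions on `ℝ`, both being locally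
integrable functions. -/
structure HasWeakDeriv (g g' : ℝ → ℂ) : Prop where
  locallyIntegrable : LocallyIntegrable g volume
  locallyIntegrable' : LocallyIntegrable g' volume
  integral_eq : ∀ φ : ℝ → ℝ, ContDiff ℝ ∞ φ → HasCompactSupport φ →
    ∫ x, deriv φ x • g x = -∫ x, φ x • g' x

namespace HasWeakDeriv

theorem integrable_smul {g : ℝ → ℂ} (hg : LocallyIntegrable g volume) {φ : ℝ → ℝ}
    (hφ : Continuous φ) (hc : HasCompactSupport φ) : Integrable (fun x => φ x • g x) :=
  hg.integrable_smul_left_of_hasCompactSupport hφ hc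

theorem zero : HasWeakDeriv 0 0 :=
  ⟨locallyIntegrable_zero, locallyIntegrable_zero, by simp⟩

theorem add {g g' k k' : ℝ → ℂ} (h : HasWeakDeriv g g') (h' : HasWeakDeriv k k') :
    HasWeakDeriv (g + k) (g' + k') := by
  refine ⟨h.1.add h'.1, h.2.add h'.2, fun φ hφ hc => ?_⟩
  have hd : Continuous (deriv φ) := hφ.continuous_deriv (by simp)
  simp only [Pi.add_apply, smul_add]
  rw [integral_add (integrable_smul h.1 hd hc.deriv) (integrable_smul h'.1 hd hc.deriv),
    integral_add (integrable_smul h.2 hφ.continuous hc)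
      (integrable_smul h'.2 hφ.continuous hc), h.3 φ hφ hc, h'.3 φ hφ hc]
  ring

theorem const_smul {g g' : ℝ → ℂ} (h : HasWeakDeriv g g') (c : ℂ) :
    HasWeakDeriv (c • g) (c • g') := by
  refine ⟨h.1.smul c, h.2.smul c, fun φ hφ hc => ?_⟩
  simp only [Pi.smul_apply]
  simp_rw [smul_comm _ c]
  rw [integral_smul, integral_smul, h.3 φ hφ hc, smul_neg]

/-- The weak derivative of a function that vanishes almost everywhere vanishes almost
everywhere. -/
theorem ae_eq_zero {g g' : ℝ → ℂ} (h : HasWeakDeriv g g') (hg : g =ᵐ[volume] 0) :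
    g' =ᵐ[volume] 0 := by
  refine ae_eq_zero_of_integral_contDiff_smul_eq_zero h.2 fun φ hφ hc => ?_
  have h1 : ∫ x, deriv φ x • g x = 0 := by
    refine integral_eq_zero_of_ae ?_
    filter_upwards [hg] with x hx
    simp [hx]
  have h2 := h.3 φ hφ hc
  rw [h1] at h2
  exact neg_eq_zero.mp h2.symm

end HasWeakDeriv

/-- The measure `β(x) dx` on `ℝ`. -/
def weightMeasure (β : ℝ → ℝ) : Measure ℝ :=
  volume.withDensity fun x => ENNReal.ofReal (β x)

/-- The Hilbert space `ℋ = L²(ℝ; β(x) dx)`. -/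
abbrev WeightedL2 (β : ℝ → ℝ) : Type := Lp ℂ 2 (weightMeasure β)

/-- The graph of `u ↦ -β⁻¹ ∂ₓ(α ∂ₓ u)` in `ℋ × ℋ`: here `u`, `v = ∂ₓ u`, `w = ∂ₓ(α v)` are
functions representing the classes involved, with `u, v ∈ L² ∩ L^∞` and `w ∈ L²`. -/
def divFormGraph (α β : ℝ → ℝ) : Submodule ℂ (WeightedL2 β × WeightedL2 β) where
  carrier := {p | ∃ u v w : ℝ → ℂ,
    p.1 =ᵐ[weightMeasure β] u ∧
    p.2 =ᵐ[weightMeasure β] (fun x => -((β x : ℂ)⁻¹ * w x)) ∧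
    MemLp u 2 volume ∧ MemLp u ∞ volume ∧
    MemLp v 2 volume ∧ MemLp v ∞ volume ∧
    MemLp w 2 volume ∧
    HasWeakDeriv u v ∧ HasWeakDeriv (fun x => (α x : ℂ) * v x) w}
  zero_mem' := by
    refine ⟨0, 0, 0, Lp.coeFn_zero _ _ _, ?_, MemLp.zero, MemLp.zero, MemLp.zero, MemLp.zero,
      MemLp.zero, HasWeakDeriv.zero, ?_⟩
    · filter_upwards [Lp.coeFn_zero ℂ 2 (weightMeasure β)] with x hx
      simpa using hx
    · convert HasWeakDeriv.zero using 1
      ext x; simp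
  add_mem' := by
    rintro ⟨a, b⟩ ⟨a', b'⟩ ⟨u, v, w, h1, h2, h3, h4, h5, h6, h7, h8, h9⟩
      ⟨u', v', w', h1', h2', h3', h4', h5', h6', h7', h8', h9'⟩
    refine ⟨u + u', v + v', w + w', ?_, ?_, h3.add h3', h4.add h4', h5.add h5', h6.add h6',
      h7.add h7', h8.add h8', ?_⟩
    · filter_upwards [Lp.coeFn_add a a', h1, h1'] with x hx e1 e2
      simp only [Prod.mk_add_mk, hx, Pi.add_apply] at *
      rw [e1, e2]
    · filter_upwards [Lp.coeFn_add b b', h2, h2'] with x hx e1 e2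
      simp only [Prod.mk_add_mk, hx, Pi.add_apply] at *
      rw [e1, e2]; ring
    · convert h9.add h9' using 1
      ext x; simp [mul_add]
  smul_mem' := by
    rintro c ⟨a, b⟩ ⟨u, v, w, h1, h2, h3, h4, h5, h6, h7, h8, h9⟩
    refine ⟨c • u, c • v, c • w, ?_, ?_, h3.const_smul c, h4.const_smul c, h5.const_smul c,
      h6.const_smul c, h7.const_smul c, h8.const_smul c, ?_⟩
    · filter_upwards [Lp.coeFn_smul c a, h1] with x hx e1
      simp only [Prod.smul_mk, hx, Pi.smul_apply] at *
      rw [e1]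
    · filter_upwards [Lp.coeFn_smul c b, h2] with x hx e1
      simp only [Prod.smul_mk, hx, Pi.smul_apply, smul_eq_mul] at *
      rw [e1]; ring
    · convert h9.const_smul c using 1
      ext x; simp [mul_left_comm]

/-- The operator `H u = -β⁻¹ ∂ₓ(α ∂ₓ u)` on `ℋ`, with domain
`{u ∈ L² : u, ∂ₓ u ∈ L² ∩ L^∞, ∂ₓ(α ∂ₓ u) ∈ L²}`. -/
def divFormOp (α β : ℝ → ℝ) : WeightedL2 β →ₗ.[ℂ] WeightedL2 β :=
  (divFormGraph α β).toLinearPMap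

/-- A real function of bounded variation is measurable. -/
theorem BoundedVariationOn.measurable_of_univ {f : ℝ → ℝ} (hf : BoundedVariationOn f univ) :
    Measurable f := by
  obtain ⟨p, q, hp, hq, rfl⟩ :=
    hf.locallyBoundedVariationOn.exists_monotoneOn_sub_monotoneOn
  exact (monotoneOn_univ.mp hp).measurable.sub (monotoneOn_univ.mp hq).measurable

/-- For measurable `β > 0` the set `divFormGraph α β` is single-valued, so that it is the graph of
`divFormOp α β`. -/
theorem divFormOp_graph {α β : ℝ → ℝ} (hβ : ∀ x, 0 < β x) (hm : Measurable β) :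
    (divFormOp α β).graph = divFormGraph α β := by
  refine Submodule.toLinearPMap_graph_eq _ ?_
  rintro ⟨a, b⟩ ⟨u, v, w, h1, h2, -, -, -, -, -, h8, h9⟩ rfl
  have hac : volume ≪ weightMeasure β :=
    withDensity_absolutelyContinuous' hm.ennreal_ofReal.aemeasurable
      (Eventually.of_forall fun x => by simpa using hβ x)
  have hac' : weightMeasure β ≪ volume := withDensity_absolutelyContinuous _ _
  have hu : u =ᵐ[volume] 0 := by
    filter_upwards [hac.ae_le h1, hac.ae_le (Lp.coeFn_zero ℂ 2 (weightMeasure β))] with x e1 e2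
    rw [← e1, e2]
  have hv := h8.ae_eq_zero hu
  have hw := h9.ae_eq_zero (by filter_upwards [hv] with x hx; simp [hx])
  refine (Lp.eq_zero_iff_ae_eq_zero).2 ?_
  filter_upwards [h2, hac'.ae_le hw] with x e1 e2
  simpa [e2] using e1

section Abstract

variable {E : Type*} [NormedAddCommGroup E] [NormedSpace ℂ E]

/-- The domain of `A` with the graph norm `u ↦ (‖u‖² + ‖A u‖²)^{1/2}`, realised as the space of
pairs `(u, A u)` in the Hilbert sum of two copies of `E`. -/
abbrev GraphDomain (A : E →ₗ.[ℂ] E) : Submodule ℂ (WithLp 2 (E × E)) :=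
  A.graph.comap (WithLp.linearEquiv 2 ℂ (E × E)).toLinearMap

/-- The inclusion `u ↦ u` of the domain of `A`, with the graph norm, into `E`. -/
def graphDomainIncl (A : E →ₗ.[ℂ] E) : GraphDomain A →L[ℂ] E :=
  (WithLp.fstL 2 ℂ E E) ∘L (GraphDomain A).subtypeL

/-- The norm of `GraphDomain A` is the graph norm. -/
theorem graphDomain_norm (A : E →ₗ.[ℂ] E) (u : A.domain) :
    ‖(⟨WithLp.toLp 2 ((u : E), A u), A.mem_graph u⟩ : GraphDomain A)‖
      = (‖(u : E)‖ ^ 2 + ‖A u‖ ^ 2) ^ (1 / 2 : ℝ) := by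
  rw [Submodule.coe_norm, WithLp.prod_norm_eq_of_L2, Real.sqrt_eq_rpow]
  rfl

/-- `R = (A - z)⁻¹`, a bounded everywhere defined two-sided inverse of `A - z`. -/
structure IsResolventAt (A : E →ₗ.[ℂ] E) (z : ℂ) (R : E →L[ℂ] E) : Prop where
  mem_domain : ∀ f, R f ∈ A.domain
  right_inv : ∀ f, A ⟨R f, mem_domain f⟩ - z • R f = f
  left_inv : ∀ u : A.domain, R (A u - z • (u : E)) = u

/-- `T` is the meromorphic continuation to `ℂ` of `M (A - λ²)⁻¹ M : E → D(A)` from the half plane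
`Im λ > 0`, where `D(A)` carries the graph norm. Each value of `T` is the one prescribed by the
continuation, except that by convention `T` is zero at its poles. -/
structure IsContinuedCutoffResolvent (A : E →ₗ.[ℂ] E) (M : E →L[ℂ] E)
    (T : ℂ → (E →L[ℂ] GraphDomain A)) : Prop where
  meromorphic : MeromorphicNFOn T univ
  eq_of_im_pos : ∀ lam : ℂ, 0 < lam.im → ∃ R : E →L[ℂ] E, IsResolventAt A (lam ^ 2) R ∧
    ∀ f, graphDomainIncl A (T lam f) = M (R (M f))

end Abstract

theorem memLp_top_ofReal_of_hasCompactSupport (μ : Measure ℝ) {χ : ℝ → ℝ} (hχ : Continuous χ)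
    (hc : HasCompactSupport χ) : MemLp (fun x => (χ x : ℂ)) ∞ μ := by
  obtain ⟨C, hC⟩ := hχ.bounded_above_of_compact_support hc
  refine memLp_top_of_bound (Complex.continuous_ofReal.comp hχ).aestronglyMeasurable C
    (Eventually.of_forall fun x => ?_)
  simpa using hC x

/-- The operator of multiplication by the cutoff function `χ` on `L²(ℝ; μ)`. -/
def mulCutoff (μ : Measure ℝ) (χ : ℝ → ℝ) (hχ : Continuous χ) (hc : HasCompactSupport χ) :
    Lp ℂ 2 μ →L[ℂ] Lp ℂ 2 μ :=
  (ContinuousLinearMap.mul ℂ ℂ).holderL μ ∞ 2 2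
    (memLp_top_ofReal_of_hasCompactSupport μ hχ hc).toLp

theorem coeFn_mulCutoff (μ : Measure ℝ) (χ : ℝ → ℝ) (hχ : Continuous χ)
    (hc : HasCompactSupport χ) (f : Lp ℂ 2 μ) :
    mulCutoff μ χ hχ hc f =ᵐ[μ] fun x => (χ x : ℂ) * f x := by
  have h := (ContinuousLinearMap.mul ℂ ℂ).coeFn_holder (r := 2)
    (memLp_top_ofReal_of_hasCompactSupport μ hχ hc).toLp f
  refine EventuallyEq.trans (by exact h) ?_
  filter_upwards [(memLp_top_ofReal_of_hasCompactSupport μ hχ hc).coeFn_toLp] with x hx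
  simp [hx]

end

noncomputable section

/-! Write the equation $(H-\lambda^2)u=g$ as the first order system $u'=\alpha^{-1}v$,
$v'=-\beta(\lambda^2u+g)$. Both $u$ and the flux $v=\alpha u'$ are absolutely continuous even where
$\alpha,\beta$ jump, so no derivative of a coefficient ever occurs. Outside $[-L,L]$ the
coefficients are $1$ and the source vanishes; there the decaying solutions for
$\operatorname{Im}\lambda>0$ are multiples of $e^{\pm i\lambda x}$, which is the outgoing condition
$v(\pm L)=\pm i\lambda u(\pm L)$.

Continuation. The initial value problem on $[-L,L]$ is a Volterra equation
$(1+\lambda^2V_{1/\alpha}V_\beta)u=\dots$, whose operator is invertible for every $\lambda$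
(`isUnit_one_add_smul_volterra`), so its solution is entire in $\lambda$. The solution with zero
data at $-L$ is corrected by a multiple of the solution that equals $e^{-i\lambda x}$ on the left,
up to normalization, so as to become outgoing at $L$ too. This divides by the Wronskian
$W(\lambda)$, an entire function, and produces `resolventFormula`, meromorphic with poles only at
zeros of $W$. In the upper half plane $W\ne0$, and the outgoing solution, extended by exponentials,
is the $L^2$ solution. Hence the formula is the cutoff resolvent there (`exists_isResolventAt`), and
uniqueness is the identity theorem.

High energy bound. The energy $|v|^2+|\lambda|^2\alpha\beta|u|^2$ is propagated from $-L$ across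
$[-L,L]$ (`IsSolutionOn.energy_le`). With $\alpha\beta$ frozen on short intervals, the energy grows
at a rate governed by $|\operatorname{Im}\lambda|$, by the source, and by $|\lambda|$ times the
oscillation of $\alpha\beta$ on the interval; the last contribution disappears as the mesh tends to
$0$. Updating the frozen value costs in total the exponential of the variation of $\alpha\beta$. So
the growth factor does not depend on $\lambda$ in a strip. The energy at $-L$ is controlled by the
imaginary part of the flux identity (`IsOutgoing.flux`), up to a term proportional to
$|\operatorname{Im}\lambda|$ that a thin strip absorbs. This gives
$|\lambda|\sup|u|\lesssim\|g\|_{L^1}$ (`exists_strip_bound`). Taking $g=0$ shows $W\ne0$ in the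
strip; general $g$ gives the resolvent bound. -/

/-! ### Primitives of integrable complex functions and their product rule -/

/-- `F` is a primitive of the integrable function `f` on `[a, b]`. -/
structure IsPrimitiveOn (F f : ℝ → ℂ) (a b : ℝ) : Prop where
  intervalIntegrable : IntervalIntegrable f volume a b
  eq_add_integral : ∀ x ∈ Icc a b, F x = F a + ∫ t in a..x, f t

theorem absolutelyContinuousOnInterval_const {E : Type*} [PseudoMetricSpace E] (c : E) (a b : ℝ) :
    AbsolutelyContinuousOnInterval (fun _ => c) a b :=
  (LipschitzWith.const c).lipschitzOnWith.absolutelyContinuousOnInterval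

theorem AbsolutelyContinuousOnInterval.ofReal {f : ℝ → ℝ} {a b : ℝ}
    (hf : AbsolutelyContinuousOnInterval f a b) :
    AbsolutelyContinuousOnInterval (fun x => (f x : ℂ)) a b := by
  have := hf.fun_smul (absolutelyContinuousOnInterval_const (1 : ℂ) a b)
  simpa using this

/-- The real and imaginary parts are treated separately and recombined as re + im • I. The
recombination is only needed at points of $[a,b]$, where the partitions in the definition have their
end points. -/
theorem IntervalIntegrable.absolutelyContinuousOnInterval_complex {f : ℝ → ℂ} {a b : ℝ}
    (h : IntervalIntegrable f volume a b) :
    AbsolutelyContinuousOnInterval (fun x => ∫ t in a..x, f t) a b := by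
  have hre : IntervalIntegrable (fun x => (f x).re) volume a b :=
    ⟨h.1.re, h.2.re⟩
  have him : IntervalIntegrable (fun x => (f x).im) volume a b :=
    ⟨h.1.im, h.2.im⟩
  have h1 := (hre.absolutelyContinuousOnInterval_intervalIntegral left_mem_uIcc).ofReal
  have h2 := (him.absolutelyContinuousOnInterval_intervalIntegral left_mem_uIcc).ofReal
  have h3 := h1.fun_add (h2.fun_smul (absolutelyContinuousOnInterval_const Complex.I a b))
  unfold AbsolutelyContinuousOnInterval at h3 ⊢
  refine h3.congr' ?_
  filter_upwards [mem_inf_of_right (mem_principal_self _)] with E hE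
  have key : ∀ x ∈ uIcc a b, ((∫ t in a..x, (f t).re : ℝ) : ℂ)
      + ((∫ t in a..x, (f t).im : ℝ) : ℂ) • Complex.I = ∫ t in a..x, f t := by
    intro x hx
    have hs := uIcc_subset_uIcc (left_mem_uIcc) hx
    rw [← intervalIntegral.integral_ofReal, ← intervalIntegral.integral_ofReal,
      ← intervalIntegral.integral_smul_const, ← intervalIntegral.integral_add]
    · simp
    · exact ⟨(hre.mono_set hs).1.ofReal, (hre.mono_set hs).2.ofReal⟩
    · exact ⟨(him.mono_set hs).1.ofReal.smul_const _, (him.mono_set hs).2.ofReal.smul_const _⟩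
  refine Finset.sum_congr rfl fun i hi => ?_
  have := hE.1 i hi
  rw [key _ this.1, key _ this.2]

theorem eq_of_absolutelyContinuous_of_ae_hasDerivAt {F G f : ℝ → ℂ} {a b : ℝ} (hab : a ≤ b)
    (hF : AbsolutelyContinuousOnInterval F a b) (hG : AbsolutelyContinuousOnInterval G a b)
    (h : ∀ᵐ x, x ∈ uIcc a b → HasDerivAt F (f x) x ∧ HasDerivAt G (f x) x)
    {x : ℝ} (hx : x ∈ Icc a b) : F x - G x = F a - G a := by
  obtain ⟨C, hC⟩ := (hF.fun_sub hG).const_of_ae_hasDerivAt_zero (by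
    filter_upwards [h] with x hx hxI
    simpa using! (hx hxI).1.sub (hx hxI).2)
  rw [uIcc_of_le hab] at hC
  rw [hC x hx, hC a (left_mem_Icc.2 hab)]

namespace IsPrimitiveOn

variable {F G f g : ℝ → ℂ} {a b : ℝ}

theorem intervalIntegrable_sub (h : IsPrimitiveOn F f a b) {x y : ℝ} (hx : x ∈ Icc a b)
    (hy : y ∈ Icc a b) : IntervalIntegrable f volume x y :=
  h.intervalIntegrable.mono_set (uIcc_subset_uIcc (Icc_subset_uIcc hx) (Icc_subset_uIcc hy))

theorem sub_eq (h : IsPrimitiveOn F f a b) {x y : ℝ} (hx : x ∈ Icc a b) (hy : y ∈ Icc a b) :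
    F y - F x = ∫ t in x..y, f t := by
  have ha : a ∈ Icc a b := left_mem_Icc.2 (hx.1.trans hx.2)
  rw [h.eq_add_integral x hx, h.eq_add_integral y hy, add_sub_add_left_eq_sub,
    intervalIntegral.integral_interval_sub_left (h.intervalIntegrable_sub ha hy)
      (h.intervalIntegrable_sub ha hx)]

theorem mono (h : IsPrimitiveOn F f a b) {c d : ℝ} (hc : c ∈ Icc a b) (hd : d ∈ Icc a b) :
    IsPrimitiveOn F f c d where
  intervalIntegrable := h.intervalIntegrable_sub hc hd
  eq_add_integral x hx := by
    rw [← h.sub_eq hc ⟨hc.1.trans hx.1, hx.2.trans hd.2⟩]; ring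

theorem continuousOn (h : IsPrimitiveOn F f a b) : ContinuousOn F (Icc a b) := by
  rcases le_or_gt a b with hab | hab
  · have := intervalIntegral.continuousOn_primitive_interval'
      h.intervalIntegrable (left_mem_uIcc)
    rw [uIcc_of_le hab] at this
    exact (continuousOn_const.add this).congr h.eq_add_integral
  · simp [Icc_eq_empty_of_lt hab]

theorem congr_left (h : IsPrimitiveOn F f a b) (hG : ∀ x ∈ Icc a b, G x = F x) :
    IsPrimitiveOn G f a b where
  intervalIntegrable := h.intervalIntegrable
  eq_add_integral x hx := by
    rw [hG x hx, hG a (left_mem_Icc.2 (hx.1.trans hx.2)), h.eq_add_integral x hx]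

theorem congr_right (hab : a ≤ b) (h : IsPrimitiveOn F f a b)
    (hg : ∀ᵐ x, x ∈ Icc a b → f x = g x) : IsPrimitiveOn F g a b where
  intervalIntegrable := by
    refine h.intervalIntegrable.congr_ae ?_
    rw [uIoc_of_le hab]
    exact (ae_restrict_iff' measurableSet_Ioc).2 (hg.mono fun x hx hxI => hx ⟨hxI.1.le, hxI.2⟩)
  eq_add_integral x hx := by
    rw [h.eq_add_integral x hx]
    congr 1
    refine intervalIntegral.integral_congr_ae ?_
    filter_upwards [hg] with t ht htI
    rw [uIoc_of_le hx.1] at htI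
    exact ht ⟨htI.1.le, htI.2.trans hx.2⟩

theorem add (h : IsPrimitiveOn F f a b) (h' : IsPrimitiveOn G g a b) :
    IsPrimitiveOn (fun x => F x + G x) (fun x => f x + g x) a b where
  intervalIntegrable := h.intervalIntegrable.add h'.intervalIntegrable
  eq_add_integral x hx := by
    have ha : a ∈ Icc a b := left_mem_Icc.2 (hx.1.trans hx.2)
    rw [intervalIntegral.integral_add (h.intervalIntegrable_sub ha hx)
      (h'.intervalIntegrable_sub ha hx), h.eq_add_integral x hx, h'.eq_add_integral x hx]
    ring

theorem const_mul (h : IsPrimitiveOn F f a b) (c : ℂ) :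
    IsPrimitiveOn (fun x => c * F x) (fun x => c * f x) a b where
  intervalIntegrable := h.intervalIntegrable.const_mul c
  eq_add_integral x hx := by
    rw [intervalIntegral.integral_const_mul, h.eq_add_integral x hx]
    ring

theorem conj (h : IsPrimitiveOn F f a b) :
    IsPrimitiveOn (fun x => starRingEnd ℂ (F x)) (fun x => starRingEnd ℂ (f x)) a b where
  intervalIntegrable := by
    have h1 := h.intervalIntegrable
    exact ⟨(Complex.conjLIE.integrable_comp_iff (φ := f)).2 h1.1,
      (Complex.conjLIE.integrable_comp_iff (φ := f)).2 h1.2⟩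
  eq_add_integral x hx := by
    rw [h.eq_add_integral x hx, map_add, intervalIntegral.integral_of_le hx.1,
      intervalIntegral.integral_of_le hx.1]
    congr 1
    exact (integral_conj (f := f)).symm

/-- Both sides are absolutely continuous, and by Lebesgue differentiation they have the same
derivative almost everywhere. `P` and `Q` replace `F` and `G`, whose values outside $[a,b]$ are
arbitrary. -/
theorem mul (hab : a ≤ b) (h : IsPrimitiveOn F f a b) (h' : IsPrimitiveOn G g a b) :
    IsPrimitiveOn (fun x => F x * G x) (fun x => f x * G x + F x * g x) a b := by
  have hc : ContinuousOn F (uIcc a b) := by rw [uIcc_of_le hab]; exact h.continuousOn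
  have hc' : ContinuousOn G (uIcc a b) := by rw [uIcc_of_le hab]; exact h'.continuousOn
  have hint : IntervalIntegrable (fun x => f x * G x + F x * g x) volume a b :=
    (h.intervalIntegrable.mul_continuousOn hc').add (h'.intervalIntegrable.continuousOn_mul hc)
  refine ⟨hint, fun x hx => ?_⟩
  set P : ℝ → ℂ := fun x => F a + ∫ t in a..x, f t with hP
  set Q : ℝ → ℂ := fun x => G a + ∫ t in a..x, g t with hQ
  have acP : AbsolutelyContinuousOnInterval P a b :=
    (absolutelyContinuousOnInterval_const (F a) a b).fun_add
      h.intervalIntegrable.absolutelyContinuousOnInterval_complex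
  have acQ : AbsolutelyContinuousOnInterval Q a b :=
    (absolutelyContinuousOnInterval_const (G a) a b).fun_add
      h'.intervalIntegrable.absolutelyContinuousOnInterval_complex
  have key := eq_of_absolutelyContinuous_of_ae_hasDerivAt (f := fun x => f x * G x + F x * g x)
    hab (acP.fun_smul acQ) hint.absolutelyContinuousOnInterval_complex (by
      filter_upwards [h.intervalIntegrable.ae_hasDerivAt_integral,
        h'.intervalIntegrable.ae_hasDerivAt_integral, hint.ae_hasDerivAt_integral]
        with x h1 h2 h3 hx
      refine ⟨?_, h3 hx a left_mem_uIcc⟩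
      have d1 : HasDerivAt P (f x) x := (h1 hx a left_mem_uIcc).const_add (F a)
      have d2 : HasDerivAt Q (g x) x := (h2 hx a left_mem_uIcc).const_add (G a)
      have hx' : x ∈ Icc a b := by rwa [uIcc_of_le hab] at hx
      rw [h.eq_add_integral x hx', h'.eq_add_integral x hx']
      exact d1.mul d2) hx
  simp only [smul_eq_mul, hP, hQ, intervalIntegral.integral_same, add_zero, sub_zero,
    ← h.eq_add_integral x hx, ← h'.eq_add_integral x hx] at key
  linear_combination key

end IsPrimitiveOn

/-- `F` is a primitive of the locally integrable function `f` on all of `ℝ`. -/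
structure IsPrimitive (F f : ℝ → ℂ) : Prop where
  locallyIntegrable : LocallyIntegrable f volume
  eq_add_integral : ∀ x, F x = F 0 + ∫ t in (0 : ℝ)..x, f t

theorem MeasureTheory.LocallyIntegrable.intervalIntegrable' {f : ℝ → ℂ}
    (hf : LocallyIntegrable f volume) (a b : ℝ) : IntervalIntegrable f volume a b :=
  intervalIntegrable_iff.mpr
    ((hf.integrableOn_isCompact isCompact_uIcc).mono_set uIoc_subset_uIcc)

namespace IsPrimitive

variable {F G f g : ℝ → ℂ}

theorem sub_eq (h : IsPrimitive F f) (x y : ℝ) : F y - F x = ∫ t in x..y, f t := by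
  rw [h.eq_add_integral x, h.eq_add_integral y, add_sub_add_left_eq_sub,
    intervalIntegral.integral_interval_sub_left (h.locallyIntegrable.intervalIntegrable' _ _)
      (h.locallyIntegrable.intervalIntegrable' _ _)]

theorem isPrimitiveOn (h : IsPrimitive F f) (a b : ℝ) : IsPrimitiveOn F f a b where
  intervalIntegrable := h.locallyIntegrable.intervalIntegrable' a b
  eq_add_integral x _ := by rw [← h.sub_eq a x]; ring

theorem of_forall_eq (hf : LocallyIntegrable f volume) (a : ℝ)
    (h : ∀ x, F x = F a + ∫ t in a..x, f t) : IsPrimitive F f := by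
  refine ⟨hf, fun x => ?_⟩
  rw [h x, h 0, add_assoc, intervalIntegral.integral_add_adjacent_intervals
    (hf.intervalIntegrable' _ _) (hf.intervalIntegrable' _ _)]

theorem continuous (h : IsPrimitive F f) : Continuous F := by
  rw [show F = fun x => F 0 + ∫ t in (0 : ℝ)..x, f t from funext h.eq_add_integral]
  exact continuous_const.add
    (intervalIntegral.continuous_primitive (fun a b => h.locallyIntegrable.intervalIntegrable' a b) 0)

theorem mul (h : IsPrimitive F f) (h' : IsPrimitive G g) :
    IsPrimitive (fun x => F x * G x) (fun x => f x * G x + F x * g x) := by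
  have hloc : LocallyIntegrable (fun x => f x * G x + F x * g x) volume := by
    rw [← locallyIntegrableOn_univ]
    refine LocallyIntegrableOn.add ?_ ?_
    · exact (locallyIntegrableOn_univ.2 h.locallyIntegrable).mul_continuousOn
        h'.continuous.continuousOn isOpen_univ.isLocallyClosed
    · exact (locallyIntegrableOn_univ.2 h'.locallyIntegrable).continuousOn_mul
        h.continuous.continuousOn isOpen_univ.isLocallyClosed
  refine ⟨hloc, fun x => ?_⟩
  rcases le_total 0 x with hx | hx
  · exact ((h.isPrimitiveOn 0 x).mul hx (h'.isPrimitiveOn 0 x)).eq_add_integral x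
      (right_mem_Icc.2 hx)
  · have := ((h.isPrimitiveOn x 0).mul hx (h'.isPrimitiveOn x 0)).eq_add_integral 0
      (right_mem_Icc.2 hx)
    rw [intervalIntegral.integral_symm, this]
    ring

theorem conj (h : IsPrimitive F f) :
    IsPrimitive (fun x => starRingEnd ℂ (F x)) (fun x => starRingEnd ℂ (f x)) := by
  refine ⟨fun x => ?_, fun x => ?_⟩
  · obtain ⟨s, hs, hi⟩ := h.locallyIntegrable x
    exact ⟨s, hs, (Complex.conjLIE.integrable_comp_iff (φ := f)).2 hi⟩
  · rcases le_total 0 x with hx | hx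
    · exact (h.isPrimitiveOn 0 x).conj.eq_add_integral x (right_mem_Icc.2 hx)
    · have := (h.isPrimitiveOn x 0).conj.eq_add_integral 0 (right_mem_Icc.2 hx)
      rw [intervalIntegral.integral_symm, this]
      ring

end IsPrimitive

/-! ### Weak derivatives and absolutely continuous representatives -/

theorem ContDiff.isPrimitive {φ : ℝ → ℂ} (hφ : ContDiff ℝ 1 φ) : IsPrimitive φ (deriv φ) where
  locallyIntegrable := (hφ.continuous_deriv le_rfl).locallyIntegrable
  eq_add_integral x := by
    rw [intervalIntegral.integral_deriv_eq_sub (fun t _ => hφ.differentiable (by simp) t)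
      ((hφ.continuous_deriv le_rfl).intervalIntegrable _ _)]
    ring

theorem ContDiff.isPrimitive_ofReal {φ : ℝ → ℝ} (hφ : ContDiff ℝ 1 φ) :
    IsPrimitive (fun x => (φ x : ℂ)) (fun x => ((deriv φ x : ℝ) : ℂ)) := by
  have h : ContDiff ℝ 1 (fun x => (φ x : ℂ)) := Complex.ofRealCLM.contDiff.comp hφ
  convert h.isPrimitive using 1
  ext x
  exact ((hφ.differentiable (by simp) x).hasDerivAt.ofReal_comp.deriv).symm

theorem HasCompactSupport.exists_Icc {φ : ℝ → ℝ} (hc : HasCompactSupport φ) :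
    ∃ R : ℝ, 0 < R ∧ ∀ x, R ≤ |x| → φ x = 0 := by
  obtain ⟨R, hR, h⟩ := hc.isCompact.isBounded.subset_closedBall_lt 0 (0 : ℝ)
  refine ⟨R + 1, by linarith, fun x hx => image_eq_zero_of_notMem_tsupport fun hmem => ?_⟩
  have := h hmem
  rw [mem_closedBall_zero_iff, Real.norm_eq_abs] at this
  linarith

theorem integral_eq_intervalIntegral_of_eq_zero {f : ℝ → ℂ} {R : ℝ} (hR : 0 ≤ R)
    (hf : ∀ x, R ≤ |x| → f x = 0) : ∫ x, f x = ∫ x in (-R)..R, f x := by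
  rw [intervalIntegral.integral_of_le (by linarith)]
  refine (setIntegral_eq_integral_of_forall_compl_eq_zero fun x hx => hf x ?_).symm
  by_contra hlt
  rw [not_le, abs_lt] at hlt
  exact hx ⟨hlt.1, hlt.2.le⟩

/-- A primitive has its integrand as weak derivative. -/
theorem IsPrimitive.hasWeakDeriv {F f : ℝ → ℂ} (h : IsPrimitive F f) : HasWeakDeriv F f := by
  refine ⟨h.continuous.locallyIntegrable, h.locallyIntegrable, fun φ hφ hc => ?_⟩
  obtain ⟨R, hR, hz⟩ := hc.exists_Icc
  obtain ⟨R', hR', hz'⟩ := hc.deriv.exists_Icc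
  have hφ1 : ContDiff ℝ 1 φ := hφ.of_le (by simp)
  have hm := (hφ1.isPrimitive_ofReal.mul h).sub_eq (-(max R R')) (max R R')
  have hmax : 0 < max R R' := lt_max_of_lt_left hR
  rw [hz _ (by rw [abs_of_pos hmax]; exact le_max_left _ _),
    hz _ (by rw [abs_neg, abs_of_pos hmax]; exact le_max_left _ _)] at hm
  have hd : Continuous (deriv φ) := hφ.continuous_deriv (by simp)
  have i1 := HasWeakDeriv.integrable_smul h.continuous.locallyIntegrable hd hc.deriv
  have i2 := HasWeakDeriv.integrable_smul h.locallyIntegrable hφ.continuous hc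
  rw [eq_neg_iff_add_eq_zero, ← integral_add i1 i2,
    integral_eq_intervalIntegral_of_eq_zero hmax.le]
  · simpa using hm.symm
  · intro x hx
    rw [hz x ((le_max_left _ _).trans hx), hz' x ((le_max_right _ _).trans hx)]
    simp

theorem HasWeakDeriv.congr_ae {g g' k k' : ℝ → ℂ} (h : HasWeakDeriv g g') (hg : g =ᵐ[volume] k)
    (hg' : g' =ᵐ[volume] k') : HasWeakDeriv k k' := by
  refine ⟨h.1.congr hg, h.2.congr hg', fun φ hφ hc => ?_⟩
  rw [integral_congr_ae (g := fun x => deriv φ x • g x)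
      (by filter_upwards [hg] with x hx; rw [hx]),
    integral_congr_ae (f := fun x => φ x • k' x) (g := fun x => φ x • g' x)
      (by filter_upwards [hg'] with x hx; rw [hx]), h.3 φ hφ hc]

/-- A locally integrable function with vanishing weak derivative is constant. -/
theorem HasWeakDeriv.ae_eq_const {g : ℝ → ℂ} (h : HasWeakDeriv g 0) :
    ∃ c : ℂ, g =ᵐ[volume] fun _ => c := by
  let η : ContDiffBump (0 : ℝ) := default
  set e : ℝ → ℝ := η.normed volume with he
  have hes : ContDiff ℝ ∞ e := η.contDiff_normed
  have hec : HasCompactSupport e := η.hasCompactSupport_normed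
  have heint : ∫ x, e x = 1 := η.integral_normed
  set c : ℂ := ∫ x, e x • g x with hcdef
  refine ⟨c, ?_⟩
  have key : ∀ φ : ℝ → ℝ, ContDiff ℝ ∞ φ → HasCompactSupport φ → ∫ x, φ x • (g x - c) = 0 := by
    intro φ hφ hc
    set s : ℝ := ∫ x, φ x with hs
    -- Subtracting a multiple of the bump `e` makes the total integral zero, so that the primitive
    -- of `ψ` has compact support and is an admissible test function.
    set ψ : ℝ → ℝ := fun x => φ x - s * e x with hψ
    have hψs : ContDiff ℝ ∞ ψ := hφ.sub (contDiff_const.mul hes)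
    have hψc : HasCompactSupport ψ := hc.sub hec.mul_left
    have hφi : Integrable φ := hφ.continuous.integrable_of_hasCompactSupport hc
    have hei : Integrable e := hes.continuous.integrable_of_hasCompactSupport hec
    have hψi : ∫ x, ψ x = 0 := by
      simp only [hψ]
      rw [integral_sub hφi (hei.const_mul s), integral_const_mul, heint]
      simp [hs]
    obtain ⟨R, hR, hz⟩ := hψc.exists_Icc
    set Ψ : ℝ → ℝ := fun x => ∫ t in (-R)..x, ψ t with hΨ
    have hd : ∀ x, HasDerivAt Ψ (ψ x) x := fun x =>
      intervalIntegral.integral_hasDerivAt_right (hψs.continuous.intervalIntegrable _ _)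
        (hψs.continuous.stronglyMeasurableAtFilter _ _) hψs.continuous.continuousAt
    have hderiv : deriv Ψ = ψ := funext fun x => (hd x).deriv
    have hΨs : ContDiff ℝ ∞ Ψ := by
      rw [contDiff_infty_iff_deriv, hderiv]
      exact ⟨fun x => (hd x).differentiableAt, hψs⟩
    have htot : ∫ t in (-R)..R, ψ t = 0 := by
      rw [← hψi, intervalIntegral.integral_of_le (by linarith)]
      refine setIntegral_eq_integral_of_forall_compl_eq_zero fun x hx => hz x ?_
      by_contra hlt
      rw [not_le, abs_lt] at hlt
      exact hx ⟨hlt.1, hlt.2.le⟩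
    have hΨc : HasCompactSupport Ψ := by
      refine HasCompactSupport.intro (isCompact_Icc (a := -R) (b := R)) fun x hx => ?_
      rw [mem_Icc, not_and_or, not_le, not_le] at hx
      rcases hx with hx | hx
      · refine intervalIntegral.integral_zero_ae (Eventually.of_forall fun t ht => hz t ?_)
        rw [uIoc_of_ge hx.le] at ht
        rw [abs_of_nonpos (by linarith [ht.2])]
        linarith [ht.2]
      · have hi := fun a b => hψs.continuous.intervalIntegrable (μ := volume) a b
        rw [hΨ]
        simp only
        rw [← intervalIntegral.integral_add_adjacent_intervals (hi (-R) R) (hi R x), htot, zero_add]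
        refine intervalIntegral.integral_zero_ae (Eventually.of_forall fun t ht => hz t ?_)
        rw [uIoc_of_le hx.le] at ht
        rw [abs_of_nonneg (by linarith [ht.1])]
        exact ht.1.le
    have h3 := h.3 Ψ hΨs hΨc
    rw [hderiv] at h3
    have i1 := HasWeakDeriv.integrable_smul h.1 hφ.continuous hc
    have i2 := HasWeakDeriv.integrable_smul h.1 hes.continuous hec
    have e1 : ∫ x, ψ x • g x = (∫ x, φ x • g x) - s • c := by
      rw [hcdef, ← integral_smul]
      refine Eq.trans ?_ (integral_sub i1 (i2.smul s))
      refine integral_congr_ae (Eventually.of_forall fun x => ?_)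
      simp only [hψ, sub_smul, mul_smul]
    have e2 : ∫ x, φ x • (g x - c) = (∫ x, φ x • g x) - s • c := by
      simp only [smul_sub]
      rw [integral_sub i1 (hφi.smul_const c), integral_smul_const]
    rw [e2, ← e1, h3]
    simp
  have := ae_eq_zero_of_integral_contDiff_smul_eq_zero
    (h.1.sub (locallyIntegrable_const c)) key
  filter_upwards [this] with x hx
  exact sub_eq_zero.1 hx

/-- A function with a weak derivative has an absolutely continuous representative. -/
theorem HasWeakDeriv.exists_isPrimitive {g g' : ℝ → ℂ} (h : HasWeakDeriv g g') :
    ∃ F : ℝ → ℂ, g =ᵐ[volume] F ∧ IsPrimitive F g' := by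
  set P : ℝ → ℂ := fun x => ∫ t in (0 : ℝ)..x, g' t with hP
  have hPp : IsPrimitive P g' := ⟨h.2, fun x => by simp [hP]⟩
  have hw := h.add (hPp.hasWeakDeriv.const_smul (-1))
  have hw0 : HasWeakDeriv (g + (-1 : ℂ) • P) 0 := by
    convert hw using 1
    ext x; simp
  obtain ⟨c, hc⟩ := hw0.ae_eq_const
  refine ⟨fun x => c + P x, ?_, h.2, fun x => ?_⟩
  · filter_upwards [hc] with x hx
    simp only [Pi.add_apply, Pi.smul_apply] at hx
    rw [← hx]; simp
  · simp [hP]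

/-- Integrability of `f` gives `F` limits at $\pm\infty$. Since `F` is integrable and half lines
have infinite measure, both limits are zero; their difference is the integral of `f`. -/
theorem IsPrimitive.integral_eq_zero {F f : ℝ → ℂ} (h : IsPrimitive F f) (hF : Integrable F)
    (hf : Integrable f) : ∫ x, f x = 0 := by
  have htop : Tendsto F atTop (𝓝 (F 0 + ∫ t in Ioi (0 : ℝ), f t)) := by
    rw [show F = fun x => F 0 + ∫ t in (0 : ℝ)..x, f t from funext h.eq_add_integral]
    simp only [intervalIntegral.integral_same, add_zero]
    exact tendsto_const_nhds.add
      (intervalIntegral_tendsto_integral_Ioi 0 hf.integrableOn tendsto_id)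
  have hbot : Tendsto F atBot (𝓝 (F 0 - ∫ t in Iic (0 : ℝ), f t)) := by
    rw [show F = fun x => F 0 - ∫ t in x..(0 : ℝ), f t from funext fun x => by
      rw [h.eq_add_integral x, intervalIntegral.integral_symm]; ring]
    simp only [intervalIntegral.integral_same, sub_zero]
    exact tendsto_const_nhds.sub
      (intervalIntegral_tendsto_integral_Iic 0 hf.integrableOn tendsto_id)
  have z1 := (IntegrableAtFilter.eq_zero_of_tendsto (μ := volume)
    ⟨univ, univ_mem, hF.integrableOn⟩ (fun s hs => by
      obtain ⟨a, ha⟩ := mem_atTop_sets.1 hs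
      exact top_unique ((Real.volume_Ici (a := a)).ge.trans (measure_mono fun x hx => ha x hx)))
    htop)
  have z2 := (IntegrableAtFilter.eq_zero_of_tendsto (μ := volume)
    ⟨univ, univ_mem, hF.integrableOn⟩ (fun s hs => by
      obtain ⟨a, ha⟩ := mem_atBot_sets.1 hs
      exact top_unique ((Real.volume_Iic (a := a)).ge.trans (measure_mono fun x hx => ha x hx)))
    hbot)
  rw [← intervalIntegral.integral_Iic_add_Ioi hf.integrableOn hf.integrableOn (b := 0)]
  linear_combination z1 - z2

/-- Integration by parts for square integrable functions with square integrable weak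
derivatives. -/
theorem HasWeakDeriv.integral_mul_eq_neg {g g' k k' : ℝ → ℂ} (h : HasWeakDeriv g g')
    (h' : HasWeakDeriv k k') (hg : MemLp g 2) (hg' : MemLp g' 2) (hk : MemLp k 2)
    (hk' : MemLp k' 2) : ∫ x, g' x * k x = -∫ x, g x * k' x := by
  obtain ⟨F, hF, hFp⟩ := h.exists_isPrimitive
  obtain ⟨K, hK, hKp⟩ := h'.exists_isPrimitive
  have i1 : Integrable (fun x => g' x * k x) := hg'.integrable_mul hk
  have i2 : Integrable (fun x => g x * k' x) := hg.integrable_mul hk'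
  have i3 : Integrable (fun x => g x * k x) := hg.integrable_mul hk
  have e1 : (fun x => g' x * k x + g x * k' x) =ᵐ[volume] fun x => g' x * K x + F x * k' x := by
    filter_upwards [hF, hK] with x hx hx'
    rw [hx, hx']
  have := (hFp.mul hKp).integral_eq_zero
    (i3.congr (by filter_upwards [hF, hK] with x hx hx'; rw [hx, hx']))
    ((i1.add i2).congr e1)
  rw [← integral_congr_ae e1, integral_add i1 i2] at this
  exact eq_neg_of_add_eq_zero_left this

/-- A square integrable function with square integrable weak derivative is essentially bounded. -/
theorem HasWeakDeriv.memLp_top {g g' : ℝ → ℂ} (h : HasWeakDeriv g g') (hg : MemLp g 2)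
    (hg' : MemLp g' 2) : MemLp g ∞ := by
  obtain ⟨F, hF, hFp⟩ := h.exists_isPrimitive
  -- This is the derivative of $|F|^2$, integrable by Cauchy–Schwarz; hence $|F|^2$ is bounded by
  -- its value at $0$ plus $\|d\|_{L^1}$.
  set d : ℝ → ℂ := fun x => starRingEnd ℂ (g' x) * F x + starRingEnd ℂ (F x) * g' x with hd
  have hF2 : MemLp F 2 := hg.ae_eq hF
  have hint : Integrable d :=
    (hg'.star.integrable_mul hF2).add (hF2.star.integrable_mul hg')
  set C := ‖starRingEnd ℂ (F 0) * F 0‖ + ∫ x, ‖d x‖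
  have hb : ∀ x, ‖F x‖ ≤ √C := by
    intro x
    refine Real.le_sqrt_of_sq_le ?_
    have h1 := (hFp.conj.mul hFp).eq_add_integral x
    calc ‖F x‖ ^ 2 = ‖starRingEnd ℂ (F x) * F x‖ := by rw [norm_mul, RCLike.norm_conj, sq]
      _ ≤ _ := by
        rw [h1]
        refine (norm_add_le _ _).trans (add_le_add le_rfl ?_)
        refine (intervalIntegral.norm_integral_le_integral_norm_uIoc).trans ?_
        exact setIntegral_le_integral hint.norm (Eventually.of_forall fun _ => norm_nonneg _)
  refine (memLp_top_of_bound hFp.continuous.aestronglyMeasurable _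
    (Eventually.of_forall hb)).ae_eq hF.symm

/-! ### Energy estimate across the interval, uniform in $\lambda$ -/

/-- Measurable coefficients with values in `[m, M]`, `m > 0`. -/
structure AdmissibleCoeffs (α β : ℝ → ℝ) (m M : ℝ) : Prop where
  pos : 0 < m
  measurable_left : Measurable α
  measurable_right : Measurable β
  le_left : ∀ x, m ≤ α x
  left_le : ∀ x, α x ≤ M
  le_right : ∀ x, m ≤ β x
  right_le : ∀ x, β x ≤ M

/-- `(u, v)` solves `v = α u'`, `v' = -β (λ² u + g)` on `[-L, L]`. -/
structure IsSolutionOn (α β : ℝ → ℝ) (L : ℝ) (lam : ℂ) (g u v : ℝ → ℂ) : Prop where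
  left : IsPrimitiveOn u (fun x => (α x : ℂ)⁻¹ * v x) (-L) L
  right : IsPrimitiveOn v (fun x => -((β x : ℂ) * (lam ^ 2 * u x + g x))) (-L) L

/-- The solution `(u, v)` continues as a multiple of `e^{-iλx}` to the left of `-L` and of
`e^{iλx}` to the right of `L`. -/
structure IsOutgoing (α β : ℝ → ℝ) (L : ℝ) (lam : ℂ) (g u v : ℝ → ℂ) : Prop extends
    IsSolutionOn α β L lam g u v where
  at_left : v (-L) = -(Complex.I * lam * u (-L))
  at_right : v L = Complex.I * lam * u L

/-- The energy `|v|² + |λ|² r |u|²`. -/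
def energy (lam : ℂ) (r : ℝ) (u v : ℂ) : ℝ := ‖v‖ ^ 2 + ‖lam‖ ^ 2 * r * ‖u‖ ^ 2

/-- A discrete Gronwall inequality, with an error term that disappears as the mesh is refined. -/
theorem le_mul_exp_of_local {Φ θ V : ℝ → ℝ} {a b K δ : ℝ} (hK : 0 ≤ K) (hδ : 0 < δ)
    (hΦ : ∀ x ∈ Icc a b, 0 ≤ Φ x) (hV : MonotoneOn V (Icc a b))
    (h : ∀ x ∈ Icc a b, ∀ y ∈ Icc a b, x ≤ y → y - x ≤ δ →
      Φ y ≤ Φ x * Real.exp (θ y - θ x + K * (y - x) * (V y - V x)))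
    {y : ℝ} (hy : y ∈ Icc a b) : Φ y ≤ Φ a * Real.exp (θ y - θ a + 1) := by
  have ha : a ∈ Icc a b := left_mem_Icc.2 (hy.1.trans hy.2)
  have hVy : 0 ≤ V y - V a := sub_nonneg.2 (hV ha hy hy.1)
  -- With equal steps of length at most `η` the error exponents add up to at most
  -- $K\eta(V(y)-V(a))\le1$, which is the $+1$ of the conclusion. The $+1$ in the denominator covers
  -- the case where the product is zero.
  set η : ℝ := min δ (1 / (K * (V y - V a) + 1)) with hη
  have hKV : 0 ≤ K * (V y - V a) := mul_nonneg hK hVy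
  have hηpos : 0 < η := lt_min hδ (by positivity)
  obtain ⟨n, hn⟩ := exists_nat_gt ((y - a) / η)
  have hn0 : (0 : ℝ) < n := (div_nonneg (sub_nonneg.2 hy.1) hηpos.le).trans_lt hn
  set t : ℝ := (y - a) / n with ht
  have ht0 : 0 ≤ t := div_nonneg (sub_nonneg.2 hy.1) hn0.le
  have htη : t ≤ η := by
    rw [div_lt_iff₀ hηpos] at hn
    rw [ht, div_le_iff₀ hn0]; linarith
  have hnt : (n : ℝ) * t = y - a := by rw [ht]; field_simp
  have hmem : ∀ k : ℕ, k ≤ n → a + k * t ∈ Icc a b := by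
    intro k hk
    have : (k : ℝ) * t ≤ n * t := mul_le_mul_of_nonneg_right (by exact_mod_cast hk) ht0
    constructor
    · have : 0 ≤ (k : ℝ) * t := by positivity
      linarith
    · linarith [hy.2]
  have key : ∀ k : ℕ, k ≤ n → Φ (a + k * t) ≤
      Φ a * Real.exp (θ (a + k * t) - θ a + K * t * (V (a + k * t) - V a)) := by
    intro k
    induction k with
    | zero => intro _; simp
    | succ k ih =>
      intro hk
      have h1 := ih (by omega)
      have hm1 := hmem k (by omega)
      have hm2 := hmem (k + 1) hk
      have hstep : a + ((k + 1 : ℕ) : ℝ) * t - (a + k * t) = t := by push_cast; ring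
      have h2 := h _ hm1 _ hm2 (by linarith) (by rw [hstep]; exact htη.trans (min_le_left _ _))
      rw [hstep] at h2
      refine h2.trans ((mul_le_mul_of_nonneg_right h1 (Real.exp_pos _).le).trans (le_of_eq ?_))
      rw [mul_assoc, ← Real.exp_add]
      congr 2
      ring
  have := key n le_rfl
  rw [hnt, add_sub_cancel] at this
  refine this.trans (mul_le_mul_of_nonneg_left (Real.exp_le_exp.2 ?_) (hΦ a ha))
  have : K * t * (V y - V a) ≤ 1 := by
    have h1 : t ≤ 1 / (K * (V y - V a) + 1) := htη.trans (min_le_right _ _)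
    rw [le_div_iff₀ (by positivity)] at h1
    nlinarith
  linarith

/-- Gronwall's inequality with an integrable coefficient, on a short interval. -/
theorem le_mul_exp_of_le_add_integral {F k : ℝ → ℝ} {x y q : ℝ} (hxy : x ≤ y)
    (hF : ContinuousOn F (Icc x y)) (hF0 : ∀ t ∈ Icc x y, 0 ≤ F t)
    (hk : IntervalIntegrable k volume x y) (hk0 : ∀ t ∈ Icc x y, 0 ≤ k t)
    (hq : ∫ t in x..y, k t ≤ q) (hq2 : q ≤ 1 / 2)
    (h : ∀ t ∈ Icc x y, F t ≤ F x + ∫ r in x..t, k r * F r) :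
    F y ≤ F x * Real.exp (2 * q) := by
  obtain ⟨z, hz, hmax⟩ := isCompact_Icc.exists_isMaxOn (nonempty_Icc.2 hxy) hF
  have hmax' : ∀ t ∈ Icc x y, F t ≤ F z := fun t ht => hmax ht
  have hkz : IntervalIntegrable k volume x z :=
    hk.mono_set (by rw [uIcc_of_le hz.1, uIcc_of_le hxy]; exact Icc_subset_Icc_right hz.2)
  have h1 : ∫ r in x..z, k r * F r ≤ ∫ r in x..z, k r * F z := by
    refine intervalIntegral.integral_mono_on hz.1 ?_ (hkz.mul_const _) fun t ht => ?_
    · refine hkz.mul_continuousOn ?_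
      rw [uIcc_of_le hz.1]
      exact hF.mono (Icc_subset_Icc_right hz.2)
    · have htI : t ∈ Icc x y := ⟨ht.1, ht.2.trans hz.2⟩
      exact mul_le_mul_of_nonneg_left (hmax' t htI) (hk0 t htI)
  have h2 : ∫ r in x..z, k r ≤ q := by
    refine le_trans ?_ hq
    refine intervalIntegral.integral_mono_interval le_rfl hz.1 hz.2 ?_ hk
    refine (ae_restrict_iff' measurableSet_Ioc).2 (Eventually.of_forall fun t ht => ?_)
    exact hk0 t ⟨ht.1.le, ht.2⟩
  have hFz := hF0 z hz
  have h3 : F z ≤ F x + q * F z := by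
    rw [intervalIntegral.integral_mul_const] at h1
    linarith [h z hz, mul_le_mul_of_nonneg_right h2 hFz]
  have h4 : F z ≤ F x * (1 + 2 * q) := by
    have hq0 : 0 ≤ q := le_trans (intervalIntegral.integral_nonneg hxy hk0) hq
    -- From $(1-q)F(z)\le F(x)$ at the maximum point and $(1-q)(1+2q)\ge1$ for $0\le q\le1/2$.
    nlinarith [mul_nonneg hq0 hFz, mul_nonneg (mul_nonneg hq0 hFz) (by linarith : 0 ≤ 1 - 2 * q)]
  have hFx := hF0 x (left_mem_Icc.2 hxy)
  calc F y ≤ F z := hmax' y (right_mem_Icc.2 hxy)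
    _ ≤ F x * (1 + 2 * q) := h4
    _ ≤ F x * Real.exp (2 * q) :=
      mul_le_mul_of_nonneg_left (by linarith [Real.add_one_le_exp (2 * q)]) hFx

/-- Since $|\lambda|^2-\lambda^2=\lambda(\bar\lambda-\lambda)$. This is the error made by putting
$|\lambda|^2$ in the energy where the equation has $\lambda^2$; it is of lower order in $|\lambda|$
in a strip. -/
theorem norm_sq_norm_sub_sq_le (lam : ℂ) :
    ‖((‖lam‖ ^ 2 : ℝ) : ℂ) - lam ^ 2‖ ≤ 2 * ‖lam‖ * |lam.im| := by
  have h : ((‖lam‖ ^ 2 : ℝ) : ℂ) - lam ^ 2 = lam * (starRingEnd ℂ lam - lam) := by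
    have := Complex.mul_conj lam
    rw [Complex.normSq_eq_norm_sq] at this
    rw [← this]; ring
  have h2 : starRingEnd ℂ lam - lam = -(2 * lam.im : ℝ) * Complex.I := by
    apply Complex.ext <;> simp; ring
  rw [h, h2, norm_mul, norm_mul, norm_neg, Complex.norm_I, Complex.norm_real, Real.norm_eq_abs,
    abs_mul, abs_two]
  exact le_of_eq (by ring)

section Energy

variable {α β : ℝ → ℝ} {m M L : ℝ} {lam : ℂ} {g u v : ℝ → ℂ}

theorem AdmissibleCoeffs.upper_pos (hc : AdmissibleCoeffs α β m M) : 0 < M :=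
  hc.pos.trans_le ((hc.le_left 0).trans (hc.left_le 0))

theorem two_mul_norm_mul_le_energy {r : ℝ} (hr : m ^ 2 ≤ r) (a b : ℂ) :
    2 * m * (‖lam‖ * ‖a‖ * ‖b‖) ≤ energy lam r a b := by
  have h1 : ‖lam‖ ^ 2 * m ^ 2 * ‖a‖ ^ 2 ≤ ‖lam‖ ^ 2 * r * ‖a‖ ^ 2 := by gcongr
  unfold energy
  nlinarith [sq_nonneg (‖b‖ - m * ‖lam‖ * ‖a‖)]

/-- The pointwise bound for the derivative of the energy with frozen coefficient. -/
theorem norm_energy_deriv_le (hm : 0 < m) {A B r s : ℝ} (hA : m ≤ A) (hB0 : 0 ≤ B) (hB : B ≤ M)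
    (hr : m ^ 2 ≤ r) (hs : 0 < s) (a b c : ℂ) :
    ‖starRingEnd ℂ (-((B : ℂ) * (lam ^ 2 * a + c))) * b
        + starRingEnd ℂ b * (-((B : ℂ) * (lam ^ 2 * a + c)))
      + ((‖lam‖ ^ 2 * r : ℝ) : ℂ) * (starRingEnd ℂ ((A : ℂ)⁻¹ * b) * a
        + starRingEnd ℂ a * ((A : ℂ)⁻¹ * b))‖
      ≤ ((‖lam‖ * |r - A * B| / m + 2 * M * |lam.im|) / m + M / s * ‖c‖)
        * (energy lam r a b + s ^ 2) := by
  have hA0 : 0 < A := hm.trans_le hA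
  have hM : 0 ≤ M := hB0.trans hB
  -- `D` is the coefficient of the cross terms between $u$ and $v$. For $r=AB$ it reduces to
  -- $B(|\lambda|^2-\lambda^2)$, the principal terms cancelling; this is why the energy carries the
  -- weight $\alpha\beta$.
  set D : ℂ := ((‖lam‖ ^ 2 * r / A : ℝ) : ℂ) - (B : ℂ) * lam ^ 2 with hD
  have hAc : (A : ℂ) ≠ 0 := by exact_mod_cast hA0.ne'
  have e1 : starRingEnd ℂ (-((B : ℂ) * (lam ^ 2 * a + c))) * b
        + starRingEnd ℂ b * (-((B : ℂ) * (lam ^ 2 * a + c)))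
      + ((‖lam‖ ^ 2 * r : ℝ) : ℂ) * (starRingEnd ℂ ((A : ℂ)⁻¹ * b) * a
        + starRingEnd ℂ a * ((A : ℂ)⁻¹ * b))
      = (starRingEnd ℂ b * a * D + starRingEnd ℂ a * b * starRingEnd ℂ D)
        - (B : ℂ) * (starRingEnd ℂ c * b + starRingEnd ℂ b * c) := by
    simp only [hD, map_neg, map_mul, map_add, map_sub, map_pow, Complex.conj_ofReal, map_inv₀]
    push_cast
    field_simp
    ring
  have hDn : ‖D‖ ≤ ‖lam‖ * (‖lam‖ * |r - A * B| / m + 2 * M * |lam.im|) := by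
    have e2 : D = ((‖lam‖ ^ 2 * (r - A * B) / A : ℝ) : ℂ)
        + (B : ℂ) * (((‖lam‖ ^ 2 : ℝ) : ℂ) - lam ^ 2) := by
      rw [hD]; push_cast; field_simp; ring
    rw [e2]
    refine (norm_add_le _ _).trans ?_
    rw [norm_mul, Complex.norm_real, Complex.norm_real, Real.norm_eq_abs, Real.norm_eq_abs,
      abs_div, abs_mul, abs_of_pos hA0, abs_of_nonneg hB0, abs_of_nonneg (sq_nonneg ‖lam‖)]
    have h1 : ‖lam‖ ^ 2 * |r - A * B| / A ≤ ‖lam‖ ^ 2 * |r - A * B| / m := by gcongr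
    have h2 : B * ‖((‖lam‖ ^ 2 : ℝ) : ℂ) - lam ^ 2‖ ≤ M * (2 * ‖lam‖ * |lam.im|) := by
      gcongr; exact norm_sq_norm_sub_sq_le lam
    refine (add_le_add h1 h2).trans (le_of_eq (by ring))
  have hE := two_mul_norm_mul_le_energy (lam := lam) hr a b
  have hE0 : 0 ≤ energy lam r a b := by
    unfold energy
    have : 0 ≤ r := (sq_nonneg m).trans hr
    positivity
  set X := ‖lam‖ * |r - A * B| / m + 2 * M * |lam.im| with hX
  have hX0 : 0 ≤ X := by positivity
  have b1 : ‖starRingEnd ℂ b * a * D + starRingEnd ℂ a * b * starRingEnd ℂ D‖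
      ≤ X / m * energy lam r a b := by
    refine (norm_add_le _ _).trans ?_
    simp only [norm_mul, RCLike.norm_conj]
    have : ‖b‖ * ‖a‖ * ‖D‖ ≤ ‖b‖ * ‖a‖ * (‖lam‖ * X) := by gcongr
    have h3 : X / m * (2 * m * (‖lam‖ * ‖a‖ * ‖b‖)) ≤ X / m * energy lam r a b := by gcongr
    have h4 : X / m * (2 * m * (‖lam‖ * ‖a‖ * ‖b‖)) = 2 * (‖b‖ * ‖a‖ * (‖lam‖ * X)) := by
      field_simp
    nlinarith
  have b2 : ‖(B : ℂ) * (starRingEnd ℂ c * b + starRingEnd ℂ b * c)‖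
      ≤ M / s * ‖c‖ * (energy lam r a b + s ^ 2) := by
    rw [norm_mul, Complex.norm_real, Real.norm_eq_abs, abs_of_nonneg hB0]
    have h1 : ‖starRingEnd ℂ c * b + starRingEnd ℂ b * c‖ ≤ 2 * ‖b‖ * ‖c‖ := by
      refine (norm_add_le _ _).trans (le_of_eq ?_)
      simp only [norm_mul, RCLike.norm_conj]; ring
    -- The offset $s^2$ makes the source enter as a growth rate $M\|g\|/s$, whose integral is at
    -- most $M$ when $\int\|g\|\le s$.
    have h2 : 2 * ‖b‖ * s ≤ energy lam r a b + s ^ 2 := by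
      have : 0 ≤ ‖lam‖ ^ 2 * r * ‖a‖ ^ 2 := by
        have : 0 ≤ r := (sq_nonneg m).trans hr
        positivity
      unfold energy
      nlinarith [sq_nonneg (‖b‖ - s)]
    calc B * ‖starRingEnd ℂ c * b + starRingEnd ℂ b * c‖ ≤ M * (2 * ‖b‖ * ‖c‖) := by gcongr
      _ = M / s * ‖c‖ * (2 * ‖b‖ * s) := by field_simp
      _ ≤ _ := by gcongr
  rw [e1]
  refine (norm_sub_le _ _).trans ((add_le_add b1 b2).trans ?_)
  have : 0 ≤ X / m * s ^ 2 := by positivity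
  nlinarith

theorem ofReal_energy (r : ℝ) (a b : ℂ) : ((energy lam r a b : ℝ) : ℂ)
    = starRingEnd ℂ b * b + ((‖lam‖ ^ 2 * r : ℝ) : ℂ) * (starRingEnd ℂ a * a) := by
  rw [RCLike.conj_mul, RCLike.conj_mul]
  unfold energy
  push_cast
  rfl

theorem energy_nonneg {r : ℝ} (hr : 0 ≤ r) (a b : ℂ) : 0 ≤ energy lam r a b := by
  unfold energy; positivity

/-- The price of replacing the frozen coefficient $r$ by $r'$: as $r\ge m^2$, one has $r'\le
r(1+|r'-r|/m^2)$. Over a partition these factors multiply to the exponential of the variation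
divided by $m^2$. -/
theorem energy_le_mul_exp {r r' : ℝ} (hm : 0 < m) (hr : m ^ 2 ≤ r) (a b : ℂ) {s : ℝ} :
    energy lam r' a b + s ^ 2
      ≤ (energy lam r a b + s ^ 2) * Real.exp (|r' - r| / m ^ 2) := by
  have hr0 : 0 ≤ r := (sq_nonneg m).trans hr
  have h1 : r' ≤ r * (1 + |r' - r| / m ^ 2) := by
    have : |r' - r| ≤ r * (|r' - r| / m ^ 2) := by
      rw [← mul_div_assoc, le_div_iff₀ (by positivity), mul_comm]
      gcongr
    linarith [le_abs_self (r' - r)]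
  have h2 : energy lam r' a b + s ^ 2
      ≤ (energy lam r a b + s ^ 2) * (1 + |r' - r| / m ^ 2) := by
    have h3 : ‖lam‖ ^ 2 * r' * ‖a‖ ^ 2 ≤ ‖lam‖ ^ 2 * (r * (1 + |r' - r| / m ^ 2)) * ‖a‖ ^ 2 := by
      gcongr
    have h4 : 0 ≤ (‖b‖ ^ 2 + s ^ 2) * (|r' - r| / m ^ 2) := by positivity
    unfold energy
    nlinarith
  refine h2.trans (mul_le_mul_of_nonneg_left ?_ (by
    have := energy_nonneg (lam := lam) hr0 a b; positivity))
  linarith [Real.add_one_le_exp (|r' - r| / m ^ 2)]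

variable (hc : AdmissibleCoeffs α β m M)
include hc

theorem AdmissibleCoeffs.sq_le_mul (x : ℝ) : m ^ 2 ≤ α x * β x := by
  rw [sq]
  exact mul_le_mul (hc.le_left x) (hc.le_right x) hc.pos.le (hc.pos.le.trans (hc.le_left x))

/-- The coefficient is frozen at the left end point `x` throughout, so only $u$ and $v$ are
differentiated. `W` bounds the oscillation of $\alpha\beta$ on the interval, and the short-interval
Gronwall inequality applies to the pointwise bound `norm_energy_deriv_le`. -/
theorem IsSolutionOn.energy_local (h : IsSolutionOn α β L lam g u v)
    (hg : IntervalIntegrable g volume (-L) L) {s : ℝ} (hs : 0 < s)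
    {x y W q : ℝ} (hx : x ∈ Icc (-L) L) (hy : y ∈ Icc (-L) L) (hxy : x ≤ y)
    (hW : ∀ t ∈ Icc x y, |α x * β x - α t * β t| ≤ W)
    (hq : (‖lam‖ * W / m + 2 * M * |lam.im|) / m * (y - x) + M / s * ∫ t in x..y, ‖g t‖ ≤ q)
    (hq2 : q ≤ 1 / 2) :
    energy lam (α x * β x) (u y) (v y) + s ^ 2
      ≤ (energy lam (α x * β x) (u x) (v x) + s ^ 2) * Real.exp (2 * q) := by
  have hm := hc.pos
  have hM := hc.upper_pos
  have hr := hc.sq_le_mul x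
  have hr0 : 0 ≤ α x * β x := (sq_nonneg m).trans hr
  have hu := h.left.mono hx hy
  have hv := h.right.mono hx hy
  have hg' : IntervalIntegrable (fun t => ‖g t‖) volume x y :=
    (hg.mono_set (uIcc_subset_uIcc (Icc_subset_uIcc hx) (Icc_subset_uIcc hy))).norm
  have hW0 : 0 ≤ W := (abs_nonneg _).trans (hW x (left_mem_Icc.2 hxy))
  set c0 : ℝ := (‖lam‖ * W / m + 2 * M * |lam.im|) / m with hc0
  have hc00 : 0 ≤ c0 := by positivity
  have hP := (hv.conj.mul hxy hv).add ((hu.conj.mul hxy hu).const_mul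
    ((‖lam‖ ^ 2 * (α x * β x) : ℝ) : ℂ))
  simp only [← ofReal_energy] at hP
  have hkint : IntervalIntegrable (fun t => c0 + M / s * ‖g t‖) volume x y :=
    intervalIntegrable_const.add (hg'.const_mul _)
  refine le_mul_exp_of_le_add_integral
    (F := fun t => energy lam (α x * β x) (u t) (v t) + s ^ 2) (k := fun t => c0 + M / s * ‖g t‖)
    hxy ?_ ?_ hkint ?_ ?_ hq2 ?_
  · have h1 := hu.continuousOn
    have h2 := hv.continuousOn
    unfold energy
    fun_prop
  · intro t _
    have := energy_nonneg (lam := lam) hr0 (u t) (v t)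
    positivity
  · intro t _
    positivity
  · rw [intervalIntegral.integral_add intervalIntegrable_const (hg'.const_mul _),
      intervalIntegral.integral_const, intervalIntegral.integral_const_mul, smul_eq_mul]
    rw [mul_comm (y - x)]
    exact hq
  · intro t ht
    have h1 := hP.eq_add_integral t ht
    have hsub : uIcc x t ⊆ uIcc x y := by
      rw [uIcc_of_le ht.1, uIcc_of_le hxy]; exact Icc_subset_Icc_right ht.2
    have hPi := (hP.intervalIntegrable.mono_set hsub).norm
    have hFc : ContinuousOn (fun t => energy lam (α x * β x) (u t) (v t) + s ^ 2) (uIcc x t) := by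
      have h1 := hu.continuousOn
      have h2 := hv.continuousOn
      rw [uIcc_of_le ht.1]
      have h1' := h1.mono (Icc_subset_Icc_right ht.2)
      have h2' := h2.mono (Icc_subset_Icc_right ht.2)
      unfold energy
      fun_prop
    have h2 := intervalIntegral.norm_integral_le_integral_norm (μ := volume) ht.1 (f := fun r =>
      (starRingEnd ℂ (-((β r : ℂ) * (lam ^ 2 * u r + g r))) * v r
        + starRingEnd ℂ (v r) * (-((β r : ℂ) * (lam ^ 2 * u r + g r)))
      + ((‖lam‖ ^ 2 * (α x * β x) : ℝ) : ℂ) * (starRingEnd ℂ ((α r : ℂ)⁻¹ * v r) * u r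
        + starRingEnd ℂ (u r) * ((α r : ℂ)⁻¹ * v r))))
    have h3 := intervalIntegral.integral_mono_on ht.1 hPi
      ((hkint.mono_set hsub).mul_continuousOn hFc) (fun r hr' => ?_)
    · have h4 : energy lam (α x * β x) (u t) (v t) - energy lam (α x * β x) (u x) (v x)
          ≤ ‖((energy lam (α x * β x) (u t) (v t) : ℝ) : ℂ)
            - ((energy lam (α x * β x) (u x) (v x) : ℝ) : ℂ)‖ := by
        rw [← Complex.ofReal_sub, Complex.norm_real]
        exact Real.le_norm_self _
      rw [h1, add_sub_cancel_left] at h4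
      linarith [h4.trans (h2.trans h3)]
    · refine (norm_energy_deriv_le hm (hc.le_left r) (hm.le.trans (hc.le_right r))
        (hc.right_le r) hr hs (u r) (v r) (g r)).trans ?_
      have h5 := hW r ⟨hr'.1, hr'.2.trans ht.2⟩
      have := energy_nonneg (lam := lam) hr0 (u r) (v r)
      rw [hc0]
      gcongr

/-- The energy of a solution grows at most by a factor controlled by the variation of the
coefficients, uniformly in `λ` in a horizontal strip. -/
theorem IsSolutionOn.energy_le (h : IsSolutionOn α β L lam g u v)
    (hg : IntervalIntegrable g volume (-L) L) {s : ℝ} (hs : 0 < s)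
    (hgs : ∫ t in (-L)..L, ‖g t‖ ≤ s) {V : ℝ → ℝ} (hV : Monotone V)
    (hVρ : ∀ x y, x ≤ y → |α x * β x - α y * β y| ≤ V y - V x) (him : |lam.im| ≤ 1)
    {y : ℝ} (hy : y ∈ Icc (-L) L) :
    energy lam (α y * β y) (u y) (v y) + s ^ 2
      ≤ Real.exp (8 * M * L / m + 2 * M + (V L - V (-L)) / m ^ 2 + 1)
        * (energy lam (α (-L) * β (-L)) (u (-L)) (v (-L)) + s ^ 2) := by
  have hm := hc.pos
  have hM := hc.upper_pos
  have hLL : -L ≤ L := hy.1.trans hy.2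
  have hL : 0 ≤ L := by linarith
  have hmemL : -L ∈ Icc (-L) L := left_mem_Icc.2 hLL
  have hsubI : ∀ {x y}, x ∈ Icc (-L) L → y ∈ Icc (-L) L →
      IntervalIntegrable (fun t => ‖g t‖) volume x y := fun hx hy =>
    (hg.mono_set (uIcc_subset_uIcc (Icc_subset_uIcc hx) (Icc_subset_uIcc hy))).norm
  set G : ℝ → ℝ := fun x => ∫ t in (-L)..x, ‖g t‖ with hG
  -- The three contributions to the exponent that survive refinement: the mismatch between
  -- $\lambda^2$ and $|\lambda|^2$, the source, and the updates of the frozen coefficient. The first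
  -- two carry the factor $2$ of $\exp(2q)$.
  set θ : ℝ → ℝ := fun x => 4 * M / m * |lam.im| * x + 2 * (M / s) * G x + V x / m ^ 2 with hθ
  have hGc : ContinuousOn G (Icc (-L) L) := by
    have := intervalIntegral.continuousOn_primitive_interval' hg.norm left_mem_uIcc
    rwa [uIcc_of_le hLL] at this
  set K0 : ℝ := (‖lam‖ * (V L - V (-L)) / m + 2 * M * |lam.im|) / m with hK0
  have hVL : 0 ≤ V L - V (-L) := sub_nonneg.2 (hV hLL)
  have hK00 : 0 ≤ K0 := by positivity
  -- for short intervals the exponents are at most `1 / 2`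
  obtain ⟨δ, hδ, hδ2⟩ : ∃ δ > 0, ∀ x ∈ Icc (-L) L, ∀ y ∈ Icc (-L) L, x ≤ y → y - x ≤ δ →
      K0 * (y - x) + M / s * ∫ t in x..y, ‖g t‖ ≤ 1 / 2 := by
    have huc := isCompact_Icc.uniformContinuousOn_of_continuous
      (f := fun x => K0 * x + M / s * G x) (by fun_prop)
    rw [Metric.uniformContinuousOn_iff] at huc
    obtain ⟨δ, hδ, hd⟩ := huc (1 / 2) (by norm_num)
    refine ⟨δ / 2, by linarith, fun x hx y hy hxy hyx => ?_⟩
    have := hd y hy x hx (by rw [Real.dist_eq, abs_of_nonneg (by linarith)]; linarith)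
    rw [Real.dist_eq] at this
    have h2 : ∫ t in x..y, ‖g t‖ = G y - G x := by
      rw [hG]
      exact (intervalIntegral.integral_interval_sub_left (hsubI hmemL hy) (hsubI hmemL hx)).symm
    rw [h2]
    linarith [le_abs_self (K0 * y + M / s * G y - (K0 * x + M / s * G x))]
  have hr0 : ∀ x, 0 ≤ α x * β x := fun x => (sq_nonneg m).trans (hc.sq_le_mul x)
  -- The oscillation term $2|\lambda|m^{-2}(y-x)(V(y)-V(x))$ is the mesh error. Its constant depends
  -- on $\lambda$, but its contribution after refinement is at most $1$.
  have key := le_mul_exp_of_local (Φ := fun x => energy lam (α x * β x) (u x) (v x) + s ^ 2)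
    (θ := θ) (V := V) (a := -L) (b := L) (K := 2 * (‖lam‖ / m ^ 2)) (by positivity) hδ
    (fun x _ => by have := energy_nonneg (lam := lam) (hr0 x) (u x) (v x); positivity)
    (hV.monotoneOn _) (fun x hx y hy hxy hyx => ?_) hy
  · refine key.trans ?_
    rw [mul_comm]
    refine mul_le_mul_of_nonneg_right (Real.exp_le_exp.2 ?_) (by
      have := energy_nonneg (lam := lam) (hr0 (-L)) (u (-L)) (v (-L)); positivity)
    have h1 : G (-L) = 0 := by simp [hG]
    have h2 : G y ≤ s := by
      refine le_trans ?_ hgs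
      exact intervalIntegral.integral_mono_interval le_rfl hy.1 hy.2
        (Eventually.of_forall fun _ => norm_nonneg _) hg.norm
    have h3 : 2 * (M / s) * G y ≤ 2 * M := by
      calc 2 * (M / s) * G y ≤ 2 * (M / s) * s := by gcongr
        _ = 2 * M := by field_simp
    have h4 : 4 * M / m * |lam.im| * y - 4 * M / m * |lam.im| * (-L) ≤ 8 * M * L / m := by
      have : |lam.im| * (y + L) ≤ 1 * (2 * L) := by
        refine mul_le_mul him (by linarith [hy.2]) (by linarith [hy.1]) zero_le_one
      calc 4 * M / m * |lam.im| * y - 4 * M / m * |lam.im| * (-L)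
          = 4 * M / m * (|lam.im| * (y + L)) := by ring
        _ ≤ 4 * M / m * (1 * (2 * L)) := by gcongr
        _ = _ := by ring
    have h5 : V y / m ^ 2 - V (-L) / m ^ 2 ≤ (V L - V (-L)) / m ^ 2 := by
      rw [← sub_div]
      gcongr
      exact hV hy.2
    simp only [hθ, h1]
    linarith
  · have hVy : V y - V x ≤ V L - V (-L) := by linarith [hV hy.2, hV hx.1]
    have hVxy : 0 ≤ V y - V x := sub_nonneg.2 (hV hxy)
    have hyx0 : 0 ≤ y - x := sub_nonneg.2 hxy
    have hloc := h.energy_local hc hg hs hx hy hxy (W := V y - V x) (fun t ht =>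
      (hVρ x t ht.1).trans (by linarith [hV ht.2])) le_rfl (by
        refine le_trans ?_ (hδ2 x hx y hy hxy hyx)
        rw [hK0]
        gcongr)
    refine (energy_le_mul_exp (r := α x * β x) hm (hc.sq_le_mul x) (u y) (v y)).trans ?_
    refine (mul_le_mul_of_nonneg_right hloc (Real.exp_pos _).le).trans ?_
    rw [mul_assoc, ← Real.exp_add]
    refine mul_le_mul_of_nonneg_left (Real.exp_le_exp.2 ?_) (by
      have := energy_nonneg (lam := lam) (hr0 x) (u x) (v x); positivity)
    have h2 : ∫ t in x..y, ‖g t‖ = G y - G x := by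
      rw [hG]
      exact (intervalIntegral.integral_interval_sub_left (hsubI hmemL hy) (hsubI hmemL hx)).symm
    have h6 : |α y * β y - α x * β x| / m ^ 2 ≤ (V y - V x) / m ^ 2 := by
      rw [abs_sub_comm]
      gcongr
      exact hVρ x y hxy
    rw [h2]
    simp only [hθ]
    refine (add_le_add_right h6 _).trans (le_of_eq ?_)
    field_simp
    ring

end Energy

/-! ### Flux identity and the high energy bound for outgoing solutions -/

section Flux

variable {α β : ℝ → ℝ} {m M L : ℝ} {lam : ℂ} {g u v : ℝ → ℂ}

/-- The flux identity for outgoing solutions. -/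
theorem IsOutgoing.flux (h : IsOutgoing α β L lam g u v) (hc : AdmissibleCoeffs α β m M)
    (hL : 0 < L) (hg : IntervalIntegrable g volume (-L) L) :
    Complex.I * lam * ((‖u L‖ ^ 2 + ‖u (-L)‖ ^ 2 : ℝ) : ℂ)
      = ((∫ x in (-L)..L, (α x)⁻¹ * ‖v x‖ ^ 2 : ℝ) : ℂ)
        - lam ^ 2 * ((∫ x in (-L)..L, β x * ‖u x‖ ^ 2 : ℝ) : ℂ)
        - ∫ x in (-L)..L, (β x : ℂ) * (starRingEnd ℂ (u x) * g x) := by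
  have hLL : -L ≤ L := by linarith
  -- The fundamental theorem for $\bar u v$; the outgoing conditions turn the boundary terms into
  -- $i\lambda(|u(L)|^2+|u(-L)|^2)$.
  have h1 := (h.left.conj.mul hLL h.right).sub_eq (left_mem_Icc.2 hLL) (right_mem_Icc.2 hLL)
  have hbd : ∀ {f : ℝ → ℝ}, Measurable f → (∀ x, ‖f x‖ ≤ M) → ∀ {k : ℝ → ℝ},
      ContinuousOn k (Icc (-L) L) → IntervalIntegrable (fun x => f x * k x) volume (-L) L := by
    intro f hf hfM k hk
    refine IntervalIntegrable.mul_continuousOn ?_ (by rwa [uIcc_of_le hLL])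
    exact intervalIntegrable_const (c := M) |>.mono_fun hf.aestronglyMeasurable
      (Eventually.of_forall fun x => (hfM x).trans (Real.le_norm_self _))
  have hu := h.left.continuousOn
  have hv := h.right.continuousOn
  have iβ : IntervalIntegrable (fun x => β x * ‖u x‖ ^ 2) volume (-L) L :=
    hbd hc.measurable_right (fun x => by
      rw [Real.norm_eq_abs, abs_of_pos (hc.pos.trans_le (hc.le_right x))]; exact hc.right_le x)
      (by fun_prop)
  have iα : IntervalIntegrable (fun x => (α x)⁻¹ * ‖v x‖ ^ 2) volume (-L) L := by
    refine IntervalIntegrable.mul_continuousOn ?_ (by rw [uIcc_of_le hLL]; fun_prop)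
    refine intervalIntegrable_const (c := m⁻¹) |>.mono_fun
      hc.measurable_left.inv.aestronglyMeasurable (Eventually.of_forall fun x => ?_)
    have := hc.pos.trans_le (hc.le_left x)
    change ‖(α x)⁻¹‖ ≤ ‖m⁻¹‖
    rw [Real.norm_of_nonneg (by positivity), Real.norm_of_nonneg (inv_nonneg.2 hc.pos.le)]
    exact inv_anti₀ hc.pos (hc.le_left x)
  have ig : IntervalIntegrable (fun x => (β x : ℂ) * (starRingEnd ℂ (u x) * g x)) volume
      (-L) L := by
    have h2 : IntervalIntegrable (fun x => starRingEnd ℂ (u x) * g x) volume (-L) L :=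
      hg.continuousOn_mul (by rw [uIcc_of_le hLL]; exact Complex.continuous_conj.comp_continuousOn hu)
    refine (h2.norm.const_mul M).mono_fun ?_ (Eventually.of_forall fun x => ?_)
    · exact (Complex.measurable_ofReal.comp hc.measurable_right).aestronglyMeasurable.mul
        h2.aestronglyMeasurable_restrict_uIoc
    · simp only [norm_mul, Complex.norm_real, norm_norm]
      rw [Real.norm_of_nonneg hc.upper_pos.le,
        Real.norm_of_nonneg (hc.pos.le.trans (hc.le_right x))]
      gcongr
      exact hc.right_le x
  have e : ∀ x, starRingEnd ℂ ((α x : ℂ)⁻¹ * v x) * v x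
      + starRingEnd ℂ (u x) * -((β x : ℂ) * (lam ^ 2 * u x + g x))
      = (((α x)⁻¹ * ‖v x‖ ^ 2 : ℝ) : ℂ) - lam ^ 2 * ((β x * ‖u x‖ ^ 2 : ℝ) : ℂ)
        - (β x : ℂ) * (starRingEnd ℂ (u x) * g x) := by
    intro x
    have e1 : ((‖v x‖ ^ 2 : ℝ) : ℂ) = starRingEnd ℂ (v x) * v x := by
      rw [RCLike.conj_mul]; simp
    have e2 : ((‖u x‖ ^ 2 : ℝ) : ℂ) = starRingEnd ℂ (u x) * u x := by
      rw [RCLike.conj_mul]; simp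
    rw [Complex.ofReal_mul, Complex.ofReal_mul, e1, e2]
    simp only [map_mul, map_inv₀, Complex.conj_ofReal, Complex.ofReal_inv]
    ring
  simp only [e] at h1
  have iα' : IntervalIntegrable (fun x => (((α x)⁻¹ * ‖v x‖ ^ 2 : ℝ) : ℂ)) volume (-L) L :=
    ⟨iα.1.ofReal, iα.2.ofReal⟩
  have iβ' : IntervalIntegrable (fun x => lam ^ 2 * ((β x * ‖u x‖ ^ 2 : ℝ) : ℂ)) volume (-L) L :=
    IntervalIntegrable.const_mul ⟨iβ.1.ofReal, iβ.2.ofReal⟩ _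
  rw [intervalIntegral.integral_sub (iα'.sub iβ') ig, intervalIntegral.integral_sub iα' iβ',
    intervalIntegral.integral_const_mul, intervalIntegral.integral_ofReal,
    intervalIntegral.integral_ofReal] at h1
  rw [← h1, h.at_left, h.at_right]
  have e1 := RCLike.conj_mul (u L)
  have e2 := RCLike.conj_mul (u (-L))
  push_cast
  simp only [RCLike.ofReal_eq_complex_ofReal] at e1 e2
  linear_combination (-Complex.I * lam) * e1 - Complex.I * lam * e2

/-- For `Im λ > 0` a homogeneous outgoing solution vanishes at the end points. -/
theorem IsOutgoing.eq_zero_of_im_pos (h : IsOutgoing α β L lam 0 u v)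
    (hc : AdmissibleCoeffs α β m M) (hL : 0 < L) (hlam : 0 < lam.im) : u (-L) = 0 := by
  have hf := h.flux hc hL (intervalIntegrable_const (c := (0 : ℂ)))
  have hLL : -L ≤ L := by linarith
  set A := ‖u L‖ ^ 2 + ‖u (-L)‖ ^ 2
  set C := ∫ x in (-L)..L, (α x)⁻¹ * ‖v x‖ ^ 2
  set B := ∫ x in (-L)..L, β x * ‖u x‖ ^ 2
  have hC : 0 ≤ C := intervalIntegral.integral_nonneg hLL fun x _ => by
    have := hc.pos.trans_le (hc.le_left x); positivity
  have hB : 0 ≤ B := intervalIntegral.integral_nonneg hLL fun x _ => by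
    have := hc.pos.trans_le (hc.le_right x); positivity
  have h2 : Complex.I * lam * (A : ℂ) + lam ^ 2 * (B : ℂ) = (C : ℂ) := by
    rw [hf]; simp
  -- Imaginary part of the identity multiplied by $\bar\lambda$. Since $A,B,C\ge0$ and
  -- $\operatorname{Im}\lambda>0$, the two sides have opposite signs, so $A=0$.
  have h3 : Complex.normSq lam * (A + lam.im * B) = - (C * lam.im) := by
    have h4 := congrArg (fun z => (starRingEnd ℂ lam * z).im) h2
    have h5 : starRingEnd ℂ lam * (Complex.I * lam * (A : ℂ) + lam ^ 2 * (B : ℂ))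
        = (Complex.normSq lam : ℂ) * (Complex.I * A + lam * B) := by
      rw [Complex.normSq_eq_conj_mul_self]; ring
    simp only [h5] at h4
    simp at h4
    linarith
  have hn : 0 < Complex.normSq lam := Complex.normSq_pos.2 (by rintro rfl; simp at hlam)
  have hA : A ≤ 0 := by
    by_contra hA
    rw [not_le] at hA
    have := mul_pos hn (add_pos_of_pos_of_nonneg hA (mul_nonneg hlam.le hB))
    nlinarith [mul_nonneg hC hlam.le]
  have : ‖u (-L)‖ ^ 2 ≤ 0 := le_trans (le_add_of_nonneg_left (sq_nonneg _)) hA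
  exact norm_eq_zero.1 (pow_eq_zero_iff two_ne_zero |>.1 (le_antisymm this (sq_nonneg _)))

/-- High energy bound for outgoing solutions in a strip around the real axis. -/
theorem exists_strip_bound (hc : AdmissibleCoeffs α β m M) (hL : 0 < L)
    (hαL : α (-L) = 1) (hβL : β (-L) = 1) {V : ℝ → ℝ} (hV : Monotone V)
    (hVρ : ∀ x y, x ≤ y → |α x * β x - α y * β y| ≤ V y - V x) :
    ∃ C ε : ℝ, 0 < C ∧ 0 < ε ∧ ∀ (lam : ℂ) (g u v : ℝ → ℂ) (s : ℝ), 1 ≤ |lam.re| →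
      |lam.im| ≤ ε → IntervalIntegrable g volume (-L) L → 0 < s → ∫ t in (-L)..L, ‖g t‖ ≤ s →
      IsOutgoing α β L lam g u v → ∀ x ∈ Icc (-L) L, ‖lam‖ * ‖u x‖ ≤ C * s := by
  have hm := hc.pos
  have hM := hc.upper_pos
  set C₁ := Real.exp (8 * M * L / m + 2 * M + (V L - V (-L)) / m ^ 2 + 1) with hC₁
  have hC₁0 : 0 < C₁ := Real.exp_pos _
  set K := 2 * (4 * C₁ * M + C₁) / m ^ 2 with hK
  have hK0 : 0 < K := by positivity
  -- Chosen so that the flux term proportional to $|\operatorname{Im}\lambda|$, multiplied by the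
  -- energy constant `C₁`, is at most $m^2/8$ times $P^2$ and can be absorbed on the left.
  set ε := min 1 (m ^ 2 / (64 * C₁ * M * L)) with hε
  have hε0 : 0 < ε := by positivity
  refine ⟨K + 1, ε, by linarith, hε0, fun lam g u v s hre him hg hs hgs h x hx => ?_⟩
  have hLL : -L ≤ L := by linarith
  have him1 : |lam.im| ≤ 1 := him.trans (min_le_left _ _)
  have hre0 : 0 < |lam.re| := by linarith
  have hlam2 : ‖lam‖ ≤ 2 * |lam.re| :=
    (Complex.norm_le_abs_re_add_abs_im lam).trans (by linarith)
  have hrelam : |lam.re| ≤ ‖lam‖ := Complex.abs_re_le_norm lam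
  obtain ⟨z, hz, hzmax⟩ := isCompact_Icc.exists_isMaxOn (nonempty_Icc.2 hLL)
    h.left.continuousOn.norm
  set U := ‖u z‖ with hU
  have hUmax : ∀ t ∈ Icc (-L) L, ‖u t‖ ≤ U := fun t ht => hzmax ht
  have hU0 : 0 ≤ U := norm_nonneg _
  set A := ‖u L‖ ^ 2 + ‖u (-L)‖ ^ 2 with hA
  -- the energy bound at the maximum
  have hen := h.toIsSolutionOn.energy_le hc hg hs hgs hV hVρ him1 hz
  have h1 : m ^ 2 * (‖lam‖ * U) ^ 2 ≤ energy lam (α z * β z) (u z) (v z) := by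
    have : m ^ 2 * (‖lam‖ ^ 2 * U ^ 2) ≤ α z * β z * (‖lam‖ ^ 2 * U ^ 2) := by
      gcongr; exact hc.sq_le_mul z
    unfold energy
    nlinarith [sq_nonneg ‖v z‖]
  have h2 : energy lam (α (-L) * β (-L)) (u (-L)) (v (-L)) ≤ 2 * ‖lam‖ ^ 2 * A := by
    unfold energy
    rw [h.at_left, hαL, hβL, norm_neg, norm_mul, norm_mul, Complex.norm_I, hA]
    nlinarith [mul_nonneg (sq_nonneg ‖lam‖) (sq_nonneg ‖u L‖)]
  -- the flux identity
  have hfl := congrArg Complex.im (h.flux hc hL hg)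
  set B := ∫ t in (-L)..L, β t * ‖u t‖ ^ 2
  set J := ∫ t in (-L)..L, (β t : ℂ) * (starRingEnd ℂ (u t) * g t)
  -- In the imaginary part the integral of $\alpha^{-1}|v|^2$ drops out and the integral of
  -- $\beta|u|^2$ is multiplied by
  -- $\operatorname{Im}(\lambda^2)=2\operatorname{Re}\lambda\operatorname{Im}\lambda$, so dividing
  -- by $\operatorname{Re}\lambda$ leaves a factor $\operatorname{Im}\lambda$.
  have hfl2 : lam.re * A = -(2 * lam.re * lam.im * B) - J.im := by
    simp [pow_two] at hfl
    simp only [hA, pow_two]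
    linarith
  have hJ : ‖J‖ ≤ M * U * s := by
    have hint : IntervalIntegrable (fun t => M * U * ‖g t‖) volume (-L) L := hg.norm.const_mul _
    refine (intervalIntegral.norm_integral_le_of_norm_le hLL
      (Eventually.of_forall fun t ht => ?_) hint).trans ?_
    · have htI : t ∈ Icc (-L) L := ⟨ht.1.le, ht.2⟩
      rw [norm_mul, norm_mul, RCLike.norm_conj, Complex.norm_real,
        Real.norm_of_nonneg (hm.le.trans (hc.le_right t)), ← mul_assoc]
      have := hUmax t htI
      have := hc.right_le t
      gcongr
    · rw [intervalIntegral.integral_const_mul]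
      gcongr
  have hB0 : 0 ≤ B := intervalIntegral.integral_nonneg hLL fun t _ => by
    have := hm.trans_le (hc.le_right t); positivity
  have hB : B ≤ M * U ^ 2 * (2 * L) := by
    have := intervalIntegral.norm_integral_le_of_norm_le_const (a := -L) (b := L)
      (f := fun t => β t * ‖u t‖ ^ 2) (C := M * U ^ 2) (fun t ht => by
        rw [uIoc_of_le hLL] at ht
        rw [norm_mul, Real.norm_of_nonneg (hm.le.trans (hc.le_right t)),
          Real.norm_of_nonneg (sq_nonneg _)]
        have := hUmax t ⟨ht.1.le, ht.2⟩
        have := hc.right_le t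
        gcongr)
    rw [sub_neg_eq_add, ← two_mul, abs_of_pos (by linarith : (0 : ℝ) < 2 * L)] at this
    exact (Real.le_norm_self _).trans this
  have hA0 : 0 ≤ A := by positivity
  have h3 : |lam.re| * A ≤ |lam.re| * (2 * ε * (M * U ^ 2 * (2 * L))) + M * U * s := by
    have h4 : |lam.re * A| ≤ |2 * lam.re * lam.im * B| + |J.im| := by
      rw [hfl2]
      refine (abs_sub _ _).trans (by rw [abs_neg])
    rw [abs_mul, abs_of_nonneg hA0, abs_mul, abs_mul, abs_mul, abs_two, abs_of_nonneg hB0] at h4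
    have h5 : 2 * |lam.re| * |lam.im| * B ≤ 2 * |lam.re| * ε * (M * U ^ 2 * (2 * L)) := by gcongr
    linarith [Complex.abs_im_le_norm J]
  set P := ‖lam‖ * U with hP
  have hP0 : 0 ≤ P := by positivity
  have h4 : ‖lam‖ ^ 2 * A ≤ 4 * ε * M * L * P ^ 2 + 2 * M * s * P := by
    have h7 : ‖lam‖ ^ 2 * (M * U * s) ≤ |lam.re| * (2 * M * s * P) := by
      calc ‖lam‖ ^ 2 * (M * U * s) = ‖lam‖ * (‖lam‖ * (M * U * s)) := by ring
        _ ≤ 2 * |lam.re| * (‖lam‖ * (M * U * s)) := by gcongr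
        _ = |lam.re| * (2 * M * s * P) := by rw [hP]; ring
    have h5 : |lam.re| * (‖lam‖ ^ 2 * A) ≤ |lam.re| * (4 * ε * M * L * P ^ 2 + 2 * M * s * P) := by
      calc |lam.re| * (‖lam‖ ^ 2 * A) = ‖lam‖ ^ 2 * (|lam.re| * A) := by ring
        _ ≤ ‖lam‖ ^ 2 * (|lam.re| * (2 * ε * (M * U ^ 2 * (2 * L))) + M * U * s) := by gcongr
        _ = |lam.re| * (4 * ε * M * L * P ^ 2) + ‖lam‖ ^ 2 * (M * U * s) := by rw [hP]; ring
        _ ≤ |lam.re| * (4 * ε * M * L * P ^ 2) + |lam.re| * (2 * M * s * P) := by gcongr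
        _ = _ := by ring
    exact le_of_mul_le_mul_left h5 hre0
  have hεC : 8 * C₁ * ε * M * L ≤ m ^ 2 / 8 := by
    have : ε ≤ m ^ 2 / (64 * C₁ * M * L) := min_le_right _ _
    rw [le_div_iff₀ (by positivity)] at this
    linarith
  have h6 : m ^ 2 * P ^ 2 ≤ C₁ * (2 * (4 * ε * M * L * P ^ 2 + 2 * M * s * P) + s ^ 2) := by
    calc m ^ 2 * P ^ 2 ≤ energy lam (α z * β z) (u z) (v z) + s ^ 2 := by
          linarith [sq_nonneg s]
      _ ≤ C₁ * (energy lam (α (-L) * β (-L)) (u (-L)) (v (-L)) + s ^ 2) := hen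
      _ ≤ _ := by
        gcongr
        linarith
  have h7 : m ^ 2 / 2 * P ^ 2 ≤ (4 * C₁ * M + C₁) * (s * P + s ^ 2) := by
    have e1 : 8 * C₁ * ε * M * L * P ^ 2 ≤ m ^ 2 / 8 * P ^ 2 := by gcongr
    have e2 : 0 ≤ C₁ * (s * P) := by positivity
    have e3 : 0 ≤ C₁ * M * s ^ 2 := by positivity
    have e4 : 0 ≤ m ^ 2 * P ^ 2 := by positivity
    linarith
  have h8 : P ^ 2 ≤ K * (s * P + s ^ 2) := by
    rw [hK, div_mul_eq_mul_div, le_div_iff₀ (by positivity)]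
    linarith
  -- If $P>(K+1)s$, then $Ks^2\le sP$ and the quadratic inequality gives $P^2\le(K+1)sP<P^2$.
  have h9 : P ≤ (K + 1) * s := by
    by_contra hlt
    rw [not_le] at hlt
    have h10 : 0 < P := lt_trans (by positivity) hlt
    have h11 : (K + 1) * s * P < P * P := by gcongr
    have h12 : K * s ^ 2 ≤ s * P := by
      calc K * s ^ 2 ≤ (K + 1) * s * s := by linarith [sq_nonneg s, sq s]
        _ ≤ P * s := by gcongr
        _ = s * P := mul_comm _ _
    linarith [sq P]
  exact (mul_le_mul_of_nonneg_left (hUmax x hx) (norm_nonneg _)).trans h9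

end Flux

/-! ### Volterra operators on continuous functions -/

section Volterra

variable {a b : ℝ} (hab : a ≤ b)

/-- The continuous extension of a continuous function on `[a, b]` to `ℝ` by constants. -/
def extendIcc (p : C(Icc a b, ℂ)) : ℝ → ℂ := IccExtend hab p

theorem continuous_extendIcc (p : C(Icc a b, ℂ)) : Continuous (extendIcc hab p) :=
  p.continuous.Icc_extend' (h := hab)

theorem extendIcc_of_mem (p : C(Icc a b, ℂ)) {x : ℝ} (hx : x ∈ Icc a b) :
    extendIcc hab p x = p ⟨x, hx⟩ := IccExtend_of_mem hab p hx

theorem norm_extendIcc_le (p : C(Icc a b, ℂ)) (x : ℝ) : ‖extendIcc hab p x‖ ≤ ‖p‖ :=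
  p.norm_coe_le_norm _

/-- The primitive `x ↦ ∫ₐˣ f` as a continuous function on `[a, b]`. -/
def primitiveIcc {f : ℝ → ℂ} (hf : IntervalIntegrable f volume a b) : C(Icc a b, ℂ) where
  toFun x := ∫ t in a..x, f t
  continuous_toFun := by
    have := intervalIntegral.continuousOn_primitive_interval' hf left_mem_uIcc
    rw [uIcc_of_le hab] at this
    exact continuousOn_iff_continuous_domRestrict.1 this

theorem primitiveIcc_apply {f : ℝ → ℂ} (hf : IntervalIntegrable f volume a b) (x : Icc a b) :
    primitiveIcc hab hf x = ∫ t in a..x, f t := rfl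

theorem intervalIntegrable_mul_extendIcc {w : ℝ → ℂ} (hw : IntervalIntegrable w volume a b)
    (p : C(Icc a b, ℂ)) : IntervalIntegrable (fun t => w t * extendIcc hab p t) volume a b :=
  hw.mul_continuousOn (continuous_extendIcc hab p).continuousOn

theorem IntervalIntegrable.mono_Icc {f : ℝ → ℂ} (hf : IntervalIntegrable f volume a b)
    (x : Icc a b) : IntervalIntegrable f volume a x :=
  hf.mono_set (uIcc_subset_uIcc left_mem_uIcc (Icc_subset_uIcc x.2))

/-- The Volterra operator `p ↦ ∫ₐˣ w p` on continuous functions. -/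
def volterra {w : ℝ → ℂ} (hw : IntervalIntegrable w volume a b) :
    C(Icc a b, ℂ) →L[ℂ] C(Icc a b, ℂ) :=
  LinearMap.mkContinuous
    { toFun := fun p => primitiveIcc hab (intervalIntegrable_mul_extendIcc hab hw p)
      map_add' := fun p q => by
        ext x
        simp only [ContinuousMap.add_apply, primitiveIcc_apply]
        rw [← intervalIntegral.integral_add
          ((intervalIntegrable_mul_extendIcc hab hw p).mono_Icc x)
          ((intervalIntegrable_mul_extendIcc hab hw q).mono_Icc x)]
        refine intervalIntegral.integral_congr fun t _ => ?_
        simp only [extendIcc, IccExtend, Function.comp, ContinuousMap.add_apply]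
        ring
      map_smul' := fun c p => by
        ext x
        simp only [ContinuousMap.smul_apply, primitiveIcc_apply, RingHom.id_apply, smul_eq_mul]
        rw [← intervalIntegral.integral_const_mul]
        refine intervalIntegral.integral_congr fun t _ => ?_
        simp only [extendIcc, IccExtend, Function.comp, ContinuousMap.smul_apply, smul_eq_mul]
        ring }
    (∫ t in a..b, ‖w t‖) (fun p => by
      have h0 : 0 ≤ ∫ t in a..b, ‖w t‖ :=
        intervalIntegral.integral_nonneg hab fun _ _ => norm_nonneg _
      refine (ContinuousMap.norm_le _ (by positivity)).2 fun x => ?_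
      have hx := x.2
      change ‖∫ t in a..x, w t * extendIcc hab p t‖ ≤ _
      have h1 : IntervalIntegrable (fun t => ‖w t‖ * ‖p‖) volume a x :=
        (hw.mono_Icc x).norm.mul_const _
      refine (intervalIntegral.norm_integral_le_of_norm_le hx.1
        (Eventually.of_forall fun t _ => ?_) h1).trans ?_
      · rw [norm_mul]
        gcongr
        exact norm_extendIcc_le hab p t
      · rw [intervalIntegral.integral_mul_const]
        gcongr
        exact intervalIntegral.integral_mono_interval le_rfl hx.1 hx.2
          (Eventually.of_forall fun _ => norm_nonneg _) hw.norm)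

theorem volterra_apply {w : ℝ → ℂ} (hw : IntervalIntegrable w volume a b) (p : C(Icc a b, ℂ))
    (x : Icc a b) : volterra hab hw p x = ∫ t in a..x, w t * extendIcc hab p t := rfl

/-- The function `x ↦ e^{kx}` on `[a, b]`. -/
def expIcc (a b k : ℝ) : C(Icc a b, ℂ) := ⟨fun x => (Real.exp (k * x) : ℂ), by fun_prop⟩

theorem expIcc_mul_expIcc_neg (k : ℝ) : expIcc a b k * expIcc a b (-k) = 1 := by
  ext x
  simp only [expIcc, ContinuousMap.mul_apply, ContinuousMap.coe_mk, ContinuousMap.one_apply]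
  rw [← Complex.ofReal_mul, ← Real.exp_add]
  simp

/-- Conjugation of a Volterra operator by an exponential weight makes its norm small. -/
theorem norm_conj_volterra_le {w : ℝ → ℂ} (hw : IntervalIntegrable w volume a b) {C : ℝ}
    (hC : ∀ t, ‖w t‖ ≤ C) {k : ℝ} (hk : 0 < k) :
    ‖(ContinuousLinearMap.mul ℂ _ (expIcc a b (-k))) * volterra hab hw
      * (ContinuousLinearMap.mul ℂ _ (expIcc a b k))‖ ≤ C / k := by
  have hC0 : 0 ≤ C := (norm_nonneg _).trans (hC 0)
  refine ContinuousLinearMap.opNorm_le_bound _ (by positivity) fun p => ?_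
  refine (ContinuousMap.norm_le _ (by positivity)).2 fun x => ?_
  have hx := x.2
  change ‖(Real.exp (-k * x) : ℂ) * volterra hab hw (expIcc a b k * p) x‖ ≤ _
  rw [volterra_apply, norm_mul, Complex.norm_real, Real.norm_of_nonneg (Real.exp_pos _).le]
  have hint : IntervalIntegrable (fun t => C * ‖p‖ * Real.exp (k * t)) volume a x :=
    (by fun_prop : Continuous fun t => C * ‖p‖ * Real.exp (k * t)).intervalIntegrable _ _
  have h1 : ‖∫ t in a..x, w t * extendIcc hab (expIcc a b k * p) t‖
      ≤ ∫ t in a..x, C * ‖p‖ * Real.exp (k * t) := by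
    refine intervalIntegral.norm_integral_le_of_norm_le hx.1
      (Eventually.of_forall fun t ht => ?_) hint
    have htI : t ∈ Icc a b := ⟨ht.1.le, ht.2.trans hx.2⟩
    rw [norm_mul, extendIcc_of_mem hab _ htI, ContinuousMap.mul_apply, norm_mul]
    have h2 : ‖expIcc a b k ⟨t, htI⟩‖ = Real.exp (k * t) := by
      change ‖(Real.exp (k * t) : ℂ)‖ = _
      rw [Complex.norm_real, Real.norm_of_nonneg (Real.exp_pos _).le]
    rw [h2]
    have h3 := p.norm_coe_le_norm ⟨t, htI⟩
    have h4 := hC t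
    calc ‖w t‖ * (Real.exp (k * t) * ‖p ⟨t, htI⟩‖) ≤ C * (Real.exp (k * t) * ‖p‖) := by gcongr
      _ = _ := by ring
  have h5 : ∫ t in a..x, C * ‖p‖ * Real.exp (k * t) ≤ C * ‖p‖ * (Real.exp (k * x) / k) := by
    rw [intervalIntegral.integral_const_mul]
    gcongr
    have h6 : ∀ t ∈ uIcc a (x : ℝ), HasDerivAt (fun t => Real.exp (k * t) / k)
        (Real.exp (k * t)) t := by
      intro t _
      have := (((hasDerivAt_id t).const_mul k).exp).div_const k
      exact this.congr_deriv (by simp only [id]; field_simp)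
    rw [intervalIntegral.integral_eq_sub_of_hasDerivAt h6
      ((by fun_prop : Continuous fun t => Real.exp (k * t)).intervalIntegrable _ _)]
    have : 0 ≤ Real.exp (k * a) / k := by positivity
    linarith
  calc Real.exp (-k * x) * ‖∫ t in a..x, w t * extendIcc hab (expIcc a b k * p) t‖
      ≤ Real.exp (-k * x) * (C * ‖p‖ * (Real.exp (k * x) / k)) := by
        gcongr; exact h1.trans h5
    _ = (Real.exp (-k * x) * Real.exp (k * x)) * (C / k * ‖p‖) := by ring
    _ = C / k * ‖p‖ := by rw [← Real.exp_add]; simp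

/-- Products of Volterra operators are quasinilpotent: `1 + z V V'` is invertible. -/
theorem isUnit_one_add_smul_volterra {w w' : ℝ → ℂ} (hw : IntervalIntegrable w volume a b)
    (hw' : IntervalIntegrable w' volume a b) {C : ℝ} (hC : ∀ t, ‖w t‖ ≤ C)
    (hC' : ∀ t, ‖w' t‖ ≤ C) (z : ℂ) :
    IsUnit (1 + z • (volterra hab hw * volterra hab hw')) := by
  have hC0 : 0 ≤ C := (norm_nonneg _).trans (hC 0)
  -- Makes $C/k\le1/(\|z\|+1)\le1$, hence $\|z\|(C/k)^2<1$: after conjugation by $e^{kx}$ the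
  -- perturbation of the identity is a strict contraction and the Neumann series applies.
  set k : ℝ := (‖z‖ + 1) * (C + 1) with hk
  have hk0 : 0 < k := by positivity
  set P := ContinuousLinearMap.mul ℂ C(Icc a b, ℂ) (expIcc a b k) with hP
  set Q := ContinuousLinearMap.mul ℂ C(Icc a b, ℂ) (expIcc a b (-k)) with hQ
  have hPQ : P * Q = 1 := by
    refine ContinuousLinearMap.ext fun p => ?_
    change expIcc a b k * (expIcc a b (-k) * p) = p
    rw [← mul_assoc, expIcc_mul_expIcc_neg, one_mul]
  have hQP : Q * P = 1 := by
    refine ContinuousLinearMap.ext fun p => ?_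
    change expIcc a b (-k) * (expIcc a b k * p) = p
    rw [← mul_assoc, mul_comm (expIcc a b (-k)), expIcc_mul_expIcc_neg, one_mul]
  set U : (C(Icc a b, ℂ) →L[ℂ] C(Icc a b, ℂ))ˣ := ⟨P, Q, hPQ, hQP⟩
  set A := Q * volterra hab hw * P
  set B := Q * volterra hab hw' * P
  have hA : ‖A‖ ≤ C / k := norm_conj_volterra_le hab hw hC hk0
  have hB : ‖B‖ ≤ C / k := norm_conj_volterra_le hab hw' hC' hk0
  have hlt : ‖-(z • (A * B))‖ < 1 := by
    rw [norm_neg, norm_smul]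
    have h1 : ‖A * B‖ ≤ C / k * (C / k) :=
      (norm_mul_le _ _).trans (mul_le_mul hA hB (norm_nonneg _) (by positivity))
    have h2 : C / k ≤ 1 / (‖z‖ + 1) := by
      rw [hk, div_le_div_iff₀ (by positivity) (by positivity)]
      nlinarith [norm_nonneg z]
    have h3 : C / k * (C / k) ≤ 1 / (‖z‖ + 1) * 1 := by
      refine mul_le_mul h2 (h2.trans ?_) (by positivity) (by positivity)
      rw [div_le_one (by positivity)]
      linarith [norm_nonneg z]
    calc ‖z‖ * ‖A * B‖ ≤ ‖z‖ * (1 / (‖z‖ + 1) * 1) := by gcongr; exact h1.trans h3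
      _ = ‖z‖ / (‖z‖ + 1) := by ring
      _ < 1 := by rw [div_lt_one (by positivity)]; linarith
  have hunit : IsUnit (1 + z • (A * B)) := by
    have := isUnit_one_sub_of_norm_lt_one (R := C(Icc a b, ℂ) →L[ℂ] C(Icc a b, ℂ)) hlt
    rwa [show 1 + z • (A * B) = 1 - -(z • (A * B)) from (sub_neg_eq_add _ _).symm]
  have hAB : A * B = Q * (volterra hab hw * volterra hab hw') * P := by
    calc A * B = Q * volterra hab hw * (P * Q) * volterra hab hw' * P := by
          simp only [A, B, mul_assoc]
      _ = _ := by rw [hPQ, mul_one]; simp only [mul_assoc]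
  have hconj : 1 + z • (volterra hab hw * volterra hab hw') = U * (1 + z • (A * B)) * ↑U⁻¹ := by
    change _ = P * (1 + z • (A * B)) * Q
    rw [hAB, mul_add, add_mul, mul_one, hPQ, mul_smul_comm, smul_mul_assoc]
    congr 2
    calc volterra hab hw * volterra hab hw'
        = (P * Q) * (volterra hab hw * volterra hab hw') * (P * Q) := by rw [hPQ]; simp
      _ = _ := by simp only [mul_assoc]
  rw [hconj]
  exact (U.isUnit.mul hunit).mul U⁻¹.isUnit

end Volterra

/-! ### The weighted space and its maps to and from continuous functions -/

theorem weightMeasure_absolutelyContinuous (β : ℝ → ℝ) : weightMeasure β ≪ volume :=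
  withDensity_absolutelyContinuous _ _

section Weight

variable {α β : ℝ → ℝ} {m M : ℝ} (hc : AdmissibleCoeffs α β m M)
include hc

namespace AdmissibleCoeffs

theorem absolutelyContinuous_weightMeasure : volume ≪ weightMeasure β :=
  withDensity_absolutelyContinuous' hc.measurable_right.ennreal_ofReal.aemeasurable
    (Eventually.of_forall fun x => by simpa using hc.pos.trans_le (hc.le_right x))

theorem ae_weight_iff {p : ℝ → Prop} : (∀ᵐ x ∂weightMeasure β, p x) ↔ ∀ᵐ x, p x :=
  ⟨fun h => hc.absolutelyContinuous_weightMeasure.ae_le h,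
    fun h => (weightMeasure_absolutelyContinuous β).ae_le h⟩

theorem weightMeasure_le : weightMeasure β ≤ ENNReal.ofReal M • volume := by
  rw [← withDensity_const]
  exact withDensity_mono (Eventually.of_forall fun x => ENNReal.ofReal_le_ofReal (hc.right_le x))

theorem volume_le : volume ≤ ENNReal.ofReal m⁻¹ • weightMeasure β := by
  have h : ENNReal.ofReal m • (volume : Measure ℝ) ≤ weightMeasure β := by
    rw [← withDensity_const]
    exact withDensity_mono
      (Eventually.of_forall fun x => ENNReal.ofReal_le_ofReal (hc.le_right x))
  calc (volume : Measure ℝ) = ENNReal.ofReal m⁻¹ • ENNReal.ofReal m • (volume : Measure ℝ) := by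
        rw [smul_smul, ← ENNReal.ofReal_mul (inv_nonneg.2 hc.pos.le), inv_mul_cancel₀ hc.pos.ne']
        simp
    _ ≤ _ := by gcongr

/-- The measure $\beta\,dx$ lies between $m\,dx$ and $M\,dx$, so the two measures have the same
integrable functions with equivalent norms. -/
theorem memLp_weight_iff {f : ℝ → ℂ} {p : ℝ≥0∞} :
    MemLp f p (weightMeasure β) ↔ MemLp f p volume :=
  ⟨fun h => h.of_measure_le_smul ENNReal.ofReal_ne_top hc.volume_le,
    fun h => h.of_measure_le_smul ENNReal.ofReal_ne_top hc.weightMeasure_le⟩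

theorem memLp_coeFn (h : WeightedL2 β) : MemLp h 2 volume := hc.memLp_weight_iff.1 (Lp.memLp h)

theorem isFiniteMeasureOnCompacts : IsFiniteMeasureOnCompacts (weightMeasure β) where
  lt_top_of_isCompact K hK := by
    refine (hc.weightMeasure_le K).trans_lt ?_
    rw [Measure.smul_apply, smul_eq_mul]
    exact ENNReal.mul_lt_top ENNReal.ofReal_lt_top hK.measure_lt_top

theorem integral_weight {F : Type*} [NormedAddCommGroup F] [NormedSpace ℝ F] (f : ℝ → F)
    (s : Set ℝ) (hs : MeasurableSet s) :
    ∫ x in s, f x ∂weightMeasure β = ∫ x in s, β x • f x := by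
  unfold weightMeasure
  rw [restrict_withDensity hs, integral_withDensity_eq_integral_toReal_smul
    hc.measurable_right.ennreal_ofReal (Eventually.of_forall fun _ => ENNReal.ofReal_lt_top)]
  refine integral_congr_ae (Eventually.of_forall fun x => ?_)
  simp only
  rw [ENNReal.toReal_ofReal (hc.pos.le.trans (hc.le_right x))]

theorem locallyIntegrable_coeFn (h : WeightedL2 β) : LocallyIntegrable h volume :=
  (hc.memLp_coeFn h).locallyIntegrable (by norm_num)

theorem locallyIntegrable_weight_mul {f : ℝ → ℂ} (hf : LocallyIntegrable f volume) :
    LocallyIntegrable (fun x => (β x : ℂ) * f x) volume := by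
  have := hc.upper_pos
  refine (hf.smul (M : ℂ)).mono ?_ (Eventually.of_forall fun x => ?_)
  · exact (Complex.measurable_ofReal.comp hc.measurable_right).aestronglyMeasurable.mul
      hf.aestronglyMeasurable
  · simp only [norm_mul, Complex.norm_real, Pi.smul_apply, smul_eq_mul]
    rw [Real.norm_of_nonneg (hc.pos.le.trans (hc.le_right x)), Real.norm_of_nonneg this.le]
    gcongr
    exact hc.right_le x

theorem locallyIntegrable_inv_mul {f : ℝ → ℂ} (hf : LocallyIntegrable f volume) :
    LocallyIntegrable (fun x => (α x : ℂ)⁻¹ * f x) volume := by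
  have := hc.pos
  refine (hf.smul (m⁻¹ : ℂ)).mono ?_ (Eventually.of_forall fun x => ?_)
  · exact (Complex.measurable_ofReal.comp hc.measurable_left).inv.aestronglyMeasurable.mul
      hf.aestronglyMeasurable
  · simp only [norm_mul, norm_inv, Complex.norm_real, Pi.smul_apply, smul_eq_mul]
    rw [Real.norm_of_nonneg (hc.pos.le.trans (hc.le_left x)), Real.norm_of_nonneg this.le]
    gcongr
    exact hc.le_left x

/-- Cauchy–Schwarz on a set of finite measure. It makes the primitive of $\beta h$ bounded from
$\mathcal H$ to continuous functions, and bounds the $L^1$ norm of a source in the final estimate.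
-/
theorem exists_integral_norm_le (a b : ℝ) :
    ∃ K : ℝ, 0 < K ∧ ∀ h : WeightedL2 β, ∫ x in Ioc a b, β x * ‖h x‖ ≤ K * ‖h‖ := by
  have := hc.isFiniteMeasureOnCompacts
  set ν := (weightMeasure β).restrict (Ioc a b) with hν
  have hfin : IsFiniteMeasure ν := ⟨by
    rw [hν, Measure.restrict_apply_univ]
    exact (measure_mono Ioc_subset_Icc_self).trans_lt isCompact_Icc.measure_lt_top⟩
  refine ⟨(ν univ ^ (1 / 2 : ℝ)).toReal + 1, by positivity, fun h => ?_⟩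
  have h1 : ∫ x in Ioc a b, β x * ‖h x‖ = ∫ x, ‖h x‖ ∂ν := by
    rw [hν, hc.integral_weight _ _ measurableSet_Ioc]; rfl
  have hm : AEStronglyMeasurable h ν := (Lp.aestronglyMeasurable h).restrict
  have h2 := eLpNorm_le_eLpNorm_mul_rpow_measure_univ (p := 1) (q := 2) (by norm_num) hm
  have h3 : eLpNorm h 2 ν ≤ eLpNorm h 2 (weightMeasure β) := eLpNorm_restrict_le _ _ _ _
  rw [h1, integral_norm_eq_lintegral_enorm hm, ← eLpNorm_one_eq_lintegral_enorm, Lp.norm_def]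
  have htop : eLpNorm h 2 (weightMeasure β) ≠ ⊤ := Lp.eLpNorm_ne_top h
  have hνtop : ν univ ^ (1 / 2 : ℝ) ≠ ⊤ := by
    refine ENNReal.rpow_ne_top_of_nonneg (by norm_num) (measure_ne_top _ _)
  have h4 : eLpNorm h 1 ν ≤ eLpNorm h 2 (weightMeasure β) * ν univ ^ (1 / 2 : ℝ) := by
    refine h2.trans ?_
    norm_num
    gcongr
  refine (ENNReal.toReal_mono (ENNReal.mul_ne_top htop hνtop) h4).trans ?_
  rw [ENNReal.toReal_mul, mul_comm]
  gcongr
  linarith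

theorem intervalIntegrable_weight_mul (h : WeightedL2 β) (a b : ℝ) :
    IntervalIntegrable (fun x => (β x : ℂ) * h x) volume a b :=
  (hc.locallyIntegrable_weight_mul (hc.locallyIntegrable_coeFn h)).intervalIntegrable' a b

end AdmissibleCoeffs

variable {a b : ℝ} (hab : a ≤ b)

/-- The operator `h ↦ ∫ₐˣ β h` from `ℋ` to continuous functions on `[a, b]`. -/
def weightedPrimitive : WeightedL2 β →L[ℂ] C(Icc a b, ℂ) :=
  LinearMap.mkContinuousOfExistsBound
    { toFun := fun h => primitiveIcc hab (hc.intervalIntegrable_weight_mul h a b)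
      map_add' := fun h k => by
        ext x
        simp only [ContinuousMap.add_apply, primitiveIcc_apply]
        rw [← intervalIntegral.integral_add
          ((hc.intervalIntegrable_weight_mul h a b).mono_Icc x)
          ((hc.intervalIntegrable_weight_mul k a b).mono_Icc x)]
        refine intervalIntegral.integral_congr_ae ?_
        filter_upwards [hc.ae_weight_iff.1 (Lp.coeFn_add h k)] with t ht _
        rw [ht, Pi.add_apply]; ring
      map_smul' := fun c h => by
        ext x
        simp only [ContinuousMap.smul_apply, primitiveIcc_apply, RingHom.id_apply, smul_eq_mul]
        rw [← intervalIntegral.integral_const_mul]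
        refine intervalIntegral.integral_congr_ae ?_
        filter_upwards [hc.ae_weight_iff.1 (Lp.coeFn_smul c h)] with t ht _
        rw [ht, Pi.smul_apply, smul_eq_mul]; ring }
    (by
      obtain ⟨K, hK, h⟩ := hc.exists_integral_norm_le a b
      refine ⟨K, fun k => (ContinuousMap.norm_le _ (by positivity)).2 fun x => ?_⟩
      have hx := x.2
      have hi := (hc.intervalIntegrable_weight_mul k a b).norm
      refine (intervalIntegral.norm_integral_le_integral_norm hx.1).trans ?_
      refine (intervalIntegral.integral_mono_interval le_rfl hx.1 hx.2
        (Eventually.of_forall fun _ => norm_nonneg _) hi).trans ?_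
      refine le_trans (le_of_eq ?_) (h k)
      rw [intervalIntegral.integral_of_le hab]
      refine integral_congr_ae (Eventually.of_forall fun t => ?_)
      simp only [norm_mul, Complex.norm_real]
      rw [Real.norm_of_nonneg (hc.pos.le.trans (hc.le_right t))])

theorem AdmissibleCoeffs.memLp_indicator (p : C(Icc a b, ℂ)) :
    MemLp ((Icc a b).indicator (extendIcc hab p)) 2 (weightMeasure β) := by
  have := hc.isFiniteMeasureOnCompacts
  rw [memLp_indicator_iff_restrict measurableSet_Icc]
  have : IsFiniteMeasure ((weightMeasure β).restrict (Icc a b)) := ⟨by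
    rw [Measure.restrict_apply_univ]; exact isCompact_Icc.measure_lt_top⟩
  exact MemLp.of_bound (continuous_extendIcc hab p).aestronglyMeasurable ‖p‖
    (Eventually.of_forall (norm_extendIcc_le hab p))

/-- Extension by zero, from continuous functions on `[a, b]` to `ℋ`. -/
def extendZero : C(Icc a b, ℂ) →L[ℂ] WeightedL2 β :=
  LinearMap.mkContinuousOfExistsBound
    { toFun := fun p => (hc.memLp_indicator hab p).toLp
      map_add' := fun p q => by
        rw [← MemLp.toLp_add]
        refine MemLp.toLp_congr _ _ (Eventually.of_forall fun t => ?_)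
        simp only [indicator, Pi.add_apply]
        split_ifs
        · rfl
        · simp
      map_smul' := fun c p => by
        rw [RingHom.id_apply, ← MemLp.toLp_const_smul]
        refine MemLp.toLp_congr _ _ (Eventually.of_forall fun t => ?_)
        simp only [indicator, Pi.smul_apply]
        split_ifs
        · rfl
        · simp }
    (by
      have := hc.isFiniteMeasureOnCompacts
      have hfin : weightMeasure β (Icc a b) ^ (1 / 2 : ℝ) ≠ ⊤ :=
        ENNReal.rpow_ne_top_of_nonneg (by norm_num) isCompact_Icc.measure_lt_top.ne
      refine ⟨(weightMeasure β (Icc a b) ^ (1 / 2 : ℝ)).toReal, fun p => ?_⟩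
      change ‖(hc.memLp_indicator hab p).toLp‖ ≤ _
      rw [Lp.norm_toLp, eLpNorm_indicator_eq_eLpNorm_restrict measurableSet_Icc]
      have h1 := eLpNorm_le_of_ae_bound (μ := (weightMeasure β).restrict (Icc a b)) (p := 2)
        (Eventually.of_forall (norm_extendIcc_le hab p))
      rw [Measure.restrict_apply_univ] at h1
      refine (ENNReal.toReal_mono (ENNReal.mul_ne_top ?_ ENNReal.ofReal_ne_top) h1).trans ?_
      · simpa using hfin
      · rw [ENNReal.toReal_mul, ENNReal.toReal_ofReal (norm_nonneg _)]
        simp)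

theorem coeFn_extendZero (p : C(Icc a b, ℂ)) :
    extendZero hc hab p =ᵐ[volume] (Icc a b).indicator (extendIcc hab p) :=
  hc.ae_weight_iff.1 (MemLp.coeFn_toLp (hc.memLp_indicator hab p))

theorem AdmissibleCoeffs.intervalIntegrable_inv :
    IntervalIntegrable (fun x => (α x : ℂ)⁻¹) volume a b := by
  have := hc.locallyIntegrable_inv_mul (locallyIntegrable_const (1 : ℂ))
  simpa using this.intervalIntegrable' a b

theorem AdmissibleCoeffs.intervalIntegrable_weight :
    IntervalIntegrable (fun x => (β x : ℂ)) volume a b := by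
  have := hc.locallyIntegrable_weight_mul (locallyIntegrable_const (1 : ℂ))
  simpa using this.intervalIntegrable' a b

/-- Allows the term $\lambda^2u$ to be treated either as part of an $L^2$ source or inside a
Volterra operator on continuous functions. -/
theorem weightedPrimitive_comp_extendZero :
    weightedPrimitive hc hab ∘L extendZero hc hab
      = volterra hab hc.intervalIntegrable_weight := by
  ext p x
  change ∫ t in a..x, (β t : ℂ) * extendZero hc hab p t = ∫ t in a..x, (β t : ℂ) * extendIcc hab p t
  refine intervalIntegral.integral_congr_ae ?_
  filter_upwards [coeFn_extendZero hc hab p] with t ht htx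
  rw [uIoc_of_le x.2.1] at htx
  rw [ht, indicator_of_mem (show t ∈ Icc a b from ⟨htx.1.le, htx.2.trans x.2.2⟩)]

theorem AdmissibleCoeffs.isUnit_one_add (z : ℂ) :
    IsUnit (1 + z • (volterra hab hc.intervalIntegrable_inv
      * volterra hab hc.intervalIntegrable_weight)) := by
  have hm := hc.pos
  refine isUnit_one_add_smul_volterra hab _ _ (C := max m⁻¹ M) (fun t => ?_) (fun t => ?_) z
  · rw [norm_inv, Complex.norm_real, Real.norm_of_nonneg (hm.le.trans (hc.le_left t))]
    exact (inv_anti₀ hm (hc.le_left t)).trans (le_max_left _ _)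
  · rw [Complex.norm_real, Real.norm_of_nonneg (hm.le.trans (hc.le_right t))]
    exact (hc.right_le t).trans (le_max_right _ _)

end Weight

/-! ### Cut off solutions as elements of the domain of $H$ -/

theorem IsPrimitive.add {F G f g : ℝ → ℂ} (h : IsPrimitive F f) (h' : IsPrimitive G g) :
    IsPrimitive (fun x => F x + G x) (fun x => f x + g x) := by
  refine ⟨h.locallyIntegrable.add h'.locallyIntegrable, fun x => ?_⟩
  rw [intervalIntegral.integral_add (h.locallyIntegrable.intervalIntegrable' _ _)
    (h'.locallyIntegrable.intervalIntegrable' _ _), h.eq_add_integral x, h'.eq_add_integral x]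
  ring

theorem le_abs_of_notMem_Icc {L x : ℝ} (hx : x ∉ Icc (-L) L) : L ≤ |x| := by
  by_contra h
  rw [not_le, abs_lt] at h
  exact hx ⟨h.1.le, h.2.le⟩

theorem memLp_of_continuous_of_eq_zero {L : ℝ} {f : ℝ → ℂ} (hf : Continuous f) (h0 : ∀ x ∉ Icc (-L) L, f x = 0)
    (p : ℝ≥0∞) : MemLp f p volume :=
  hf.memLp_of_hasCompactSupport (HasCompactSupport.intro isCompact_Icc h0)

/-- Coefficients equal to one for `|x| ≥ R₀`, and a cutoff function which is one near `[-R₀, R₀]`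
and supported in `(-L, L)`. -/
structure ScatteringSetting (α β χ : ℝ → ℝ) (m M R₀ L : ℝ) : Prop
    extends AdmissibleCoeffs α β m M where
  radius_pos : 0 < R₀
  radius_le : R₀ ≤ L
  left_eq_one : ∀ x, R₀ ≤ |x| → α x = 1
  right_eq_one : ∀ x, R₀ ≤ |x| → β x = 1
  contDiff : ContDiff ℝ ∞ χ
  hasCompactSupport : HasCompactSupport χ
  eventually_one : ∀ x, |x| ≤ R₀ → χ =ᶠ[𝓝 x] fun _ => 1
  eventually_zero : ∀ x, L ≤ |x| → χ =ᶠ[𝓝 x] fun _ => 0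

namespace ScatteringSetting

variable {α β χ : ℝ → ℝ} {m M R₀ L : ℝ} (S : ScatteringSetting α β χ m M R₀ L)
include S

theorem length_pos : 0 < L := S.radius_pos.trans_le S.radius_le

theorem neg_le_self : -L ≤ L := by linarith [S.length_pos]

/-- The derivatives of $\chi$ live where the coefficients are $1$. Hence $\alpha\chi'=\chi'$, and
the flux $\chi'u+\chi v$ of $\chi u$ can be differentiated without touching $\alpha$. -/
theorem deriv_eq_zero_or (x : ℝ) :
    (deriv χ x = 0 ∧ deriv (deriv χ) x = 0) ∨ (α x = 1 ∧ β x = 1) := by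
  rcases le_total |x| R₀ with hx | hx
  · left
    have h := (S.eventually_one x hx).deriv
    constructor
    · simpa using h.self_of_nhds
    · simpa using h.deriv.self_of_nhds
  · exact Or.inr ⟨S.left_eq_one x hx, S.right_eq_one x hx⟩

theorem eq_zero_of_notMem {x : ℝ} (hx : x ∉ Icc (-L) L) : χ x = 0 :=
  (S.eventually_zero x (le_abs_of_notMem_Icc hx)).self_of_nhds

theorem deriv_eq_zero_of_notMem {x : ℝ} (hx : x ∉ Icc (-L) L) : deriv χ x = 0 := by
  simpa using (S.eventually_zero x (le_abs_of_notMem_Icc hx)).deriv.self_of_nhds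

theorem deriv_deriv_eq_zero_of_notMem {x : ℝ} (hx : x ∉ Icc (-L) L) : deriv (deriv χ) x = 0 := by
  simpa using (S.eventually_zero x (le_abs_of_notMem_Icc hx)).deriv.deriv.self_of_nhds

theorem continuous : Continuous χ := S.contDiff.continuous

theorem contDiff_deriv : ContDiff ℝ ∞ (deriv χ) := (contDiff_infty_iff_deriv.1 S.contDiff).2

theorem continuous_deriv_deriv : Continuous (deriv (deriv χ)) :=
  S.contDiff_deriv.continuous_deriv (by simp)

/-- Multiplication by a function `θ`, from continuous functions on `[-L, L]` to `ℋ`. -/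
def mulExtend (θ : ℝ → ℝ) (hθ : Continuous θ) : C(Icc (-L) L, ℂ) →L[ℂ] WeightedL2 β :=
  extendZero S.toAdmissibleCoeffs S.neg_le_self ∘L
    ContinuousLinearMap.mul ℂ C(Icc (-L) L, ℂ) ⟨fun x => (θ x : ℂ), by fun_prop⟩

theorem coeFn_mulExtend {θ : ℝ → ℝ} (hθ : Continuous θ) (h0 : ∀ x ∉ Icc (-L) L, θ x = 0)
    (p : C(Icc (-L) L, ℂ)) : S.mulExtend θ hθ p =ᵐ[volume]
      fun x => (θ x : ℂ) * extendIcc S.neg_le_self p x := by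
  filter_upwards [coeFn_extendZero S.toAdmissibleCoeffs S.neg_le_self
    (ContinuousLinearMap.mul ℂ C(Icc (-L) L, ℂ) ⟨fun x => (θ x : ℂ), by fun_prop⟩ p)] with x hx
  refine hx.trans ?_
  by_cases hxI : x ∈ Icc (-L) L
  · rw [indicator_of_mem hxI, extendIcc_of_mem _ _ hxI, extendIcc_of_mem _ _ hxI]
    rfl
  · rw [indicator_of_notMem hxI, h0 x hxI]
    simp

/-- The function `x ↦ v₀ - ∫_{-L}^x β h` on `[-L, L]`. -/
def fluxMap : ℂ × ℂ × WeightedL2 β →L[ℂ] C(Icc (-L) L, ℂ) :=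
  (ContinuousLinearMap.fst ℂ ℂ (WeightedL2 β) ∘L ContinuousLinearMap.snd ℂ ℂ _).smulRight 1
    - weightedPrimitive S.toAdmissibleCoeffs S.neg_le_self ∘L
      ContinuousLinearMap.snd ℂ ℂ (WeightedL2 β) ∘L ContinuousLinearMap.snd ℂ ℂ _

/-- The function `x ↦ u₀ + ∫_{-L}^x α⁻¹ (v₀ - ∫_{-L}^t β h)` on `[-L, L]`. -/
def positionMap : ℂ × ℂ × WeightedL2 β →L[ℂ] C(Icc (-L) L, ℂ) :=
  (ContinuousLinearMap.fst ℂ ℂ (ℂ × WeightedL2 β)).smulRight 1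
    + volterra S.neg_le_self S.intervalIntegrable_inv ∘L S.fluxMap

/-- Global version of `fluxMap`. -/
theorem exists_global (z : ℂ × ℂ × WeightedL2 β) : ∃ U V : ℝ → ℂ,
    IsPrimitive V (fun x => -((β x : ℂ) * z.2.2 x)) ∧ IsPrimitive U (fun x => (α x : ℂ)⁻¹ * V x) ∧
    U (-L) = z.1 ∧ V (-L) = z.2.1 ∧
    (∀ x (hx : x ∈ Icc (-L) L), S.positionMap z ⟨x, hx⟩ = U x) ∧
    (∀ x (hx : x ∈ Icc (-L) L), S.fluxMap z ⟨x, hx⟩ = V x) := by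
  have hloc := S.locallyIntegrable_weight_mul (S.locallyIntegrable_coeFn z.2.2)
  set V : ℝ → ℂ := fun x => z.2.1 + ∫ t in (-L)..x, -((β t : ℂ) * z.2.2 t) with hV
  have hVp : IsPrimitive V (fun x => -((β x : ℂ) * z.2.2 x)) :=
    IsPrimitive.of_forall_eq hloc.neg (-L) (fun x => by simp [hV])
  set U : ℝ → ℂ := fun x => z.1 + ∫ t in (-L)..x, (α t : ℂ)⁻¹ * V t with hU
  have hUp : IsPrimitive U (fun x => (α x : ℂ)⁻¹ * V x) :=
    IsPrimitive.of_forall_eq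
      (S.locallyIntegrable_inv_mul hVp.continuous.locallyIntegrable) (-L) (fun x => by simp [hU])
  have hVI : ∀ x (hx : x ∈ Icc (-L) L), S.fluxMap z ⟨x, hx⟩ = V x := by
    intro x hx
    simp only [hV, intervalIntegral.integral_neg, ← sub_eq_add_neg]
    change z.2.1 • (1 : ℂ) - _ = _
    rw [smul_eq_mul, mul_one]
    rfl
  refine ⟨U, V, hVp, hUp, by simp [hU], by simp [hV], fun x hx => ?_, hVI⟩
  change z.1 • (1 : ℂ) + ∫ t in (-L)..x, (α t : ℂ)⁻¹ * extendIcc S.neg_le_self (S.fluxMap z) t = _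
  rw [smul_eq_mul, mul_one, hU]
  congr 1
  refine intervalIntegral.integral_congr fun t ht => ?_
  rw [uIcc_of_le hx.1] at ht
  have htI : t ∈ Icc (-L) L := ⟨ht.1, ht.2.trans hx.2⟩
  rw [extendIcc_of_mem _ _ htI, hVI t htI]

/-- Multiplication by the cutoff function on `ℋ`. -/
abbrev cutoff : WeightedL2 β →L[ℂ] WeightedL2 β :=
  mulCutoff (weightMeasure β) χ S.contDiff.continuous S.hasCompactSupport

/-- The first component `χ u` of the cut off solution. -/
def liftFst : ℂ × ℂ × WeightedL2 β →L[ℂ] WeightedL2 β :=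
  S.mulExtend χ S.continuous ∘L S.positionMap

/-- The second component `H (χ u) = χ h - χ'' u - 2 χ' v` of the cut off solution. -/
def liftSnd : ℂ × ℂ × WeightedL2 β →L[ℂ] WeightedL2 β :=
  S.cutoff ∘L ContinuousLinearMap.snd ℂ ℂ (WeightedL2 β) ∘L ContinuousLinearMap.snd ℂ ℂ _
    - (S.mulExtend (deriv (deriv χ)) S.continuous_deriv_deriv ∘L S.positionMap
      + (2 : ℂ) • S.mulExtend (deriv χ) S.contDiff_deriv.continuous ∘L S.fluxMap)

/-- For $u'=\alpha^{-1}v$ and $v'=-\beta h$, the flux of $\chi u$ is $\chi'u+\chi v$, with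
derivative $\chi''u+\chi'\alpha^{-1}v+\chi'v-\chi\beta h$. As $\alpha=\beta=1$ where $\chi'$ or
$\chi''$ is nonzero, applying $-\beta^{-1}$ gives `liftSnd`. Compact support of $\chi$ supplies all
the integrability conditions. Having both components as bounded maps is what makes the continuation
take values in the domain with its graph norm. -/
theorem lift_mem_graph (z : ℂ × ℂ × WeightedL2 β) :
    (S.liftFst z, S.liftSnd z) ∈ (divFormOp α β).graph := by
  have hm := S.pos
  have hβ0 : ∀ x, 0 < β x := fun x => hm.trans_le (S.le_right x)
  have hα0 : ∀ x, 0 < α x := fun x => hm.trans_le (S.le_left x)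
  rw [divFormOp_graph hβ0 S.measurable_right]
  obtain ⟨U, V, hV, hU, -, -, hUI, hVI⟩ := S.exists_global z
  have c0 : Continuous fun x => (χ x : ℂ) := Complex.continuous_ofReal.comp S.continuous
  have c1 : Continuous fun x => ((deriv χ x : ℝ) : ℂ) :=
    Complex.continuous_ofReal.comp S.contDiff_deriv.continuous
  have c2 : Continuous fun x => ((deriv (deriv χ) x : ℝ) : ℂ) :=
    Complex.continuous_ofReal.comp S.continuous_deriv_deriv
  have hp0 := (S.contDiff.of_le (by simp) : ContDiff ℝ 1 χ).isPrimitive_ofReal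
  have hp1 := (S.contDiff_deriv.of_le (by simp) : ContDiff ℝ 1 (deriv χ)).isPrimitive_ofReal
  have hu := hp0.mul hU
  have hw := (hp1.mul hU).add (hp0.mul hV)
  have meas : AEStronglyMeasurable (fun x => (α x : ℂ)⁻¹) volume :=
    (Complex.measurable_ofReal.comp S.measurable_left).inv.aestronglyMeasurable
  have hαb : ∀ x, ‖(α x : ℂ)⁻¹‖ ≤ m⁻¹ := fun x => by
    rw [norm_inv, Complex.norm_real, Real.norm_of_nonneg (hα0 x).le]
    exact inv_anti₀ hm (S.le_left x)
  have hbdd : ∀ {θ f : ℝ → ℂ} (p : ℝ≥0∞), Continuous θ → Continuous f →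
      (∀ x ∉ Icc (-L) L, θ x = 0) → MemLp (fun x => θ x * ((α x : ℂ)⁻¹ * f x)) p volume := by
    intro θ f p hθ hf h0
    refine (memLp_of_continuous_of_eq_zero (f := fun x => θ x * f x) (hθ.mul hf)
      (fun x hx => by rw [h0 x hx, zero_mul]) p).of_le_mul
      (c := m⁻¹) (hθ.aestronglyMeasurable.mul (meas.mul hf.aestronglyMeasurable))
      (Eventually.of_forall fun x => ?_)
    simp only [norm_mul]
    have := hαb x
    calc ‖θ x‖ * (‖(α x : ℂ)⁻¹‖ * ‖f x‖) ≤ ‖θ x‖ * (m⁻¹ * ‖f x‖) := by gcongr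
      _ = _ := by ring
  have z0 : ∀ x ∉ Icc (-L) L, (χ x : ℂ) = 0 := fun x hx => by simp [S.eq_zero_of_notMem hx]
  have z1 : ∀ x ∉ Icc (-L) L, ((deriv χ x : ℝ) : ℂ) = 0 := fun x hx => by
    simp [S.deriv_eq_zero_of_notMem hx]
  have z2 : ∀ x ∉ Icc (-L) L, ((deriv (deriv χ) x : ℝ) : ℂ) = 0 := fun x hx => by
    simp [S.deriv_deriv_eq_zero_of_notMem hx]
  have mul_mem : ∀ {θ f : ℝ → ℂ} (p : ℝ≥0∞), Continuous θ → Continuous f →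
      (∀ x ∉ Icc (-L) L, θ x = 0) → MemLp (fun x => θ x * f x) p volume :=
    fun {θ f} p hθ hf h0 => memLp_of_continuous_of_eq_zero (f := fun x => θ x * f x) (hθ.mul hf)
      (fun x hx => by rw [h0 x hx, zero_mul]) p
  have hv_mem : ∀ p : ℝ≥0∞, MemLp (fun x => ((deriv χ x : ℝ) : ℂ) * U x
      + (χ x : ℂ) * ((α x : ℂ)⁻¹ * V x)) p volume := fun p =>
    (mul_mem p c1 hU.continuous z1).add (hbdd p c0 hV.continuous z0)
  obtain ⟨C, hC⟩ := S.continuous.bounded_above_of_compact_support S.hasCompactSupport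
  have hh_mem : MemLp (fun x => (χ x : ℂ) * -((β x : ℂ) * z.2.2 x)) 2 volume := by
    refine (S.memLp_coeFn z.2.2).of_le_mul (c := C * M) ?_ (Eventually.of_forall fun x => ?_)
    · exact c0.aestronglyMeasurable.mul hV.locallyIntegrable.aestronglyMeasurable
    · simp only [norm_mul, norm_neg, Complex.norm_real]
      rw [Real.norm_of_nonneg (hβ0 x).le, ← mul_assoc]
      have h1 := hC x
      have h2 := S.right_le x
      have h3 : 0 ≤ C := (norm_nonneg _).trans h1
      have h4 := (hβ0 x).le
      gcongr
  have hac : weightMeasure β ≪ volume := weightMeasure_absolutelyContinuous β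
  refine ⟨fun x => (χ x : ℂ) * U x,
    fun x => ((deriv χ x : ℝ) : ℂ) * U x + (χ x : ℂ) * ((α x : ℂ)⁻¹ * V x),
    fun x => (((deriv (deriv χ) x : ℝ) : ℂ) * U x
      + ((deriv χ x : ℝ) : ℂ) * ((α x : ℂ)⁻¹ * V x))
      + (((deriv χ x : ℝ) : ℂ) * V x + (χ x : ℂ) * -((β x : ℂ) * z.2.2 x)), ?_, ?_,
    mul_mem 2 c0 hU.continuous z0, mul_mem ∞ c0 hU.continuous z0,
    hv_mem 2, hv_mem ∞, ((mul_mem 2 c2 hU.continuous z2).add (hbdd 2 c1 hV.continuous z1)).add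
      ((mul_mem 2 c1 hV.continuous z1).add hh_mem), hu.hasWeakDeriv, ?_⟩
  · refine hac.ae_le ?_
    filter_upwards [S.coeFn_mulExtend S.continuous (fun x hx => S.eq_zero_of_notMem hx)
      (S.positionMap z)] with x hx
    refine hx.trans ?_
    by_cases hxI : x ∈ Icc (-L) L
    · rw [extendIcc_of_mem _ _ hxI, hUI x hxI]
    · simp [S.eq_zero_of_notMem hxI]
  · have e := Lp.coeFn_sub (S.cutoff z.2.2) ((S.mulExtend (deriv (deriv χ))
      S.continuous_deriv_deriv (S.positionMap z)
      + (2 : ℂ) • S.mulExtend (deriv χ) S.contDiff_deriv.continuous (S.fluxMap z)))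
    filter_upwards [e, Lp.coeFn_add (S.mulExtend (deriv (deriv χ))
      S.continuous_deriv_deriv (S.positionMap z))
      ((2 : ℂ) • S.mulExtend (deriv χ) S.contDiff_deriv.continuous (S.fluxMap z)),
      Lp.coeFn_smul (2 : ℂ) (S.mulExtend (deriv χ) S.contDiff_deriv.continuous (S.fluxMap z)),
      hac.ae_le (S.coeFn_mulExtend S.continuous_deriv_deriv
        (fun x hx => S.deriv_deriv_eq_zero_of_notMem hx) (S.positionMap z)),
      hac.ae_le (S.coeFn_mulExtend S.contDiff_deriv.continuous
        (fun x hx => S.deriv_eq_zero_of_notMem hx) (S.fluxMap z)),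
      coeFn_mulCutoff (weightMeasure β) χ S.contDiff.continuous S.hasCompactSupport z.2.2]
      with x h1 h2 h3 h4 h5 h6
    refine h1.trans ?_
    rw [Pi.sub_apply, h2, Pi.add_apply, h3, Pi.smul_apply, h4, h5, h6, smul_eq_mul]
    have hβx : (β x : ℂ) ≠ 0 := by exact_mod_cast (hβ0 x).ne'
    by_cases hxI : x ∈ Icc (-L) L
    · rw [extendIcc_of_mem _ _ hxI, extendIcc_of_mem _ _ hxI, hUI x hxI, hVI x hxI]
      rcases S.deriv_eq_zero_or x with ⟨h7, h8⟩ | ⟨h7, h8⟩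
      · rw [h7, h8]; field_simp; simp
      · rw [h7, h8]; simp; ring
    · simp [S.eq_zero_of_notMem hxI, S.deriv_eq_zero_of_notMem hxI,
        S.deriv_deriv_eq_zero_of_notMem hxI]
  · convert hw.hasWeakDeriv using 1
    ext x
    rcases S.deriv_eq_zero_or x with ⟨h1, h2⟩ | ⟨h1, h2⟩
    · have : (α x : ℂ) ≠ 0 := by exact_mod_cast (hα0 x).ne'
      rw [h1]; field_simp; simp [h1]
    · simp [h1]

/-- The cut off solution `(χ u, H (χ u))` as an element of the domain of `H`. -/
def lift : ℂ × ℂ × WeightedL2 β →L[ℂ] GraphDomain (divFormOp α β) :=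
  ((WithLp.prodContinuousLinearEquiv 2 ℂ (WeightedL2 β) (WeightedL2 β)).symm.toContinuousLinearMap
    ∘L (S.liftFst.prod S.liftSnd)).codRestrict (GraphDomain (divFormOp α β)) S.lift_mem_graph

theorem graphDomainIncl_lift (z : ℂ × ℂ × WeightedL2 β) :
    graphDomainIncl (divFormOp α β) (S.lift z) = S.liftFst z := rfl

end ScatteringSetting

/-! ### Analytic operator families -/

section Analytic

variable {𝕜 E F G H : Type*} [NontriviallyNormedField 𝕜] [NormedAddCommGroup E] [NormedSpace 𝕜 E]
  [NormedAddCommGroup F] [NormedSpace 𝕜 F] [NormedAddCommGroup G] [NormedSpace 𝕜 G]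
  [NormedAddCommGroup H] [NormedSpace 𝕜 H] {x : H}

/-- Composition, evaluation and the rank one construction are continuous bilinear operations, so one
lemma covers the analyticity of all the operator families built from them. -/
theorem ContinuousLinearMap.analyticAt_bilinear_comp (B : E →L[𝕜] F →L[𝕜] G) {f : H → E} {g : H → F}
    (hf : AnalyticAt 𝕜 f x) (hg : AnalyticAt 𝕜 g x) : AnalyticAt 𝕜 (fun y => B (f y) (g y)) x :=
  (B.analyticAt_bilinear (f x, g x)).comp₂ hf hg

theorem AnalyticAt.clm_comp' {f : H → F →L[𝕜] G} {g : H → E →L[𝕜] F} (hf : AnalyticAt 𝕜 f x)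
    (hg : AnalyticAt 𝕜 g x) : AnalyticAt 𝕜 (fun y => f y ∘L g y) x :=
  (ContinuousLinearMap.compL 𝕜 E F G).analyticAt_bilinear_comp hf hg

theorem AnalyticAt.clm_apply' {f : H → F →L[𝕜] G} {g : H → F} (hf : AnalyticAt 𝕜 f x)
    (hg : AnalyticAt 𝕜 g x) : AnalyticAt 𝕜 (fun y => f y (g y)) x :=
  (ContinuousLinearMap.id 𝕜 (F →L[𝕜] G)).analyticAt_bilinear_comp hf hg

theorem AnalyticAt.clm_smulRight {f : H → E →L[𝕜] 𝕜} {g : H → F} (hf : AnalyticAt 𝕜 f x)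
    (hg : AnalyticAt 𝕜 g x) : AnalyticAt 𝕜 (fun y => (f y).smulRight (g y)) x :=
  (ContinuousLinearMap.smulRightL 𝕜 E F).analyticAt_bilinear_comp hf hg

theorem AnalyticAt.scalar_smul {f : H → 𝕜} {g : H → F} (hf : AnalyticAt 𝕜 f x)
    (hg : AnalyticAt 𝕜 g x) : AnalyticAt 𝕜 (fun y => f y • g y) x := hf.fun_smul hg

theorem MeromorphicAt.scalar_smul {f : 𝕜 → 𝕜} {g : 𝕜 → F} {z : 𝕜} (hf : MeromorphicAt f z)
    (hg : MeromorphicAt g z) : MeromorphicAt (fun y => f y • g y) z := hf.fun_smul hg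

end Analytic

/-! ### The Wronskian and the formula for the cutoff resolvent -/

/-- The inclusion `g ↦ (0, 0, g)`. -/
def sourceIncl (β : ℝ → ℝ) : WeightedL2 β →L[ℂ] ℂ × ℂ × WeightedL2 β :=
  ContinuousLinearMap.inr ℂ ℂ (ℂ × WeightedL2 β) ∘L ContinuousLinearMap.inr ℂ ℂ (WeightedL2 β)

/-- The initial data of the solution `e^{-iλx}` to the left of `-L`, up to normalization. -/
def homData (β : ℝ → ℝ) (lam : ℂ) : ℂ × ℂ × WeightedL2 β := (1, -(Complex.I * lam), 0)

theorem analyticAt_homData (β : ℝ → ℝ) (lam : ℂ) : AnalyticAt ℂ (homData β) lam :=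
  analyticAt_const.prod ((analyticAt_const.mul analyticAt_id).neg.prod analyticAt_const)

namespace ScatteringSetting

variable {α β χ : ℝ → ℝ} {m M R₀ L : ℝ} (S : ScatteringSetting α β χ m M R₀ L)
include S

/-- The Volterra operator `1 + λ² V_{1/α} V_β`. -/
def volterraOp (lam : ℂ) : C(Icc (-L) L, ℂ) →L[ℂ] C(Icc (-L) L, ℂ) :=
  1 + lam ^ 2 • (volterra S.neg_le_self S.intervalIntegrable_inv
      * volterra S.neg_le_self S.intervalIntegrable_weight)

theorem isUnit_volterraOp (lam : ℂ) : IsUnit (S.volterraOp lam) :=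
  S.isUnit_one_add S.neg_le_self (lam ^ 2)

/-- The solution of the initial value problem with data `u(-L) = u₀`, `(αu')(-L) = v₀` and
source `g`, for `z = (u₀, v₀, g)`. -/
def solMap (lam : ℂ) : ℂ × ℂ × WeightedL2 β →L[ℂ] C(Icc (-L) L, ℂ) :=
  Ring.inverse (S.volterraOp lam) ∘L S.positionMap

/-- The map `(u₀, v₀, g) ↦ (u₀, v₀, λ² u + g)`. -/
def dataMap (lam : ℂ) : ℂ × ℂ × WeightedL2 β →L[ℂ] ℂ × ℂ × WeightedL2 β :=
  ContinuousLinearMap.id ℂ _ + lam ^ 2 •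
    (sourceIncl β ∘L extendZero S.toAdmissibleCoeffs S.neg_le_self ∘L S.solMap lam)

theorem dataMap_apply (lam : ℂ) (z : ℂ × ℂ × WeightedL2 β) : S.dataMap lam z
    = (z.1, z.2.1, z.2.2 + lam ^ 2 • extendZero S.toAdmissibleCoeffs S.neg_le_self
      (S.solMap lam z)) := by
  simp [dataMap, sourceIncl, Prod.ext_iff]

/-- The solution $u$ is defined by $(1+\lambda^2V_{1/\alpha}V_\beta)u$ being the position map of the
original data. Moving the Volterra term to the other side says that $u$ is the position map for the
source $\lambda^2u+g$, which is the differential equation in integrated form. -/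
theorem positionMap_dataMap (lam : ℂ) (z : ℂ × ℂ × WeightedL2 β) :
    S.positionMap (S.dataMap lam z) = S.solMap lam z := by
  have h1 : S.volterraOp lam (S.solMap lam z) = S.positionMap z := by
    change (S.volterraOp lam * Ring.inverse (S.volterraOp lam)) (S.positionMap z) = _
    rw [Ring.mul_inverse_cancel _ (S.isUnit_volterraOp lam)]
    rfl
  have h2 : ∀ h : WeightedL2 β, S.positionMap (sourceIncl β h)
      = -volterra S.neg_le_self S.intervalIntegrable_inv
        (weightedPrimitive S.toAdmissibleCoeffs S.neg_le_self h) := by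
    intro h
    simp [positionMap, sourceIncl, fluxMap]
  have h3 := congrArg (fun T => T (S.solMap lam z))
    (weightedPrimitive_comp_extendZero S.toAdmissibleCoeffs S.neg_le_self)
  simp only [ContinuousLinearMap.comp_apply] at h3
  have h4 : S.dataMap lam z = z + lam ^ 2 • sourceIncl β
      (extendZero S.toAdmissibleCoeffs S.neg_le_self (S.solMap lam z)) := rfl
  rw [h4, map_add, map_smul, h2, h3, ← h1]
  simp [volterraOp]

/-- The right end point of `[-L, L]`. -/
def rightEnd : Icc (-L) L := ⟨L, S.neg_le_self, le_rfl⟩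

/-- Evaluation at the right end point. -/
def evalRight : C(Icc (-L) L, ℂ) →L[ℂ] ℂ := ContinuousMap.evalCLM ℂ S.rightEnd

/-- The defect `(αu')(L) - iλ u(L)` in the outgoing condition at `L`. -/
def defect (lam : ℂ) : ℂ × ℂ × WeightedL2 β →L[ℂ] ℂ :=
  S.evalRight ∘L S.fluxMap ∘L S.dataMap lam - (Complex.I * lam) • (S.evalRight ∘L S.solMap lam)

/-- The condition at $-L$ is imposed through the initial data, the equation holds by construction,
and the defect is exactly what is missing at $L$. -/
theorem isOutgoing_of_defect_eq_zero {lam : ℂ} {z : ℂ × ℂ × WeightedL2 β}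
    (hz : z.2.1 = -(Complex.I * lam * z.1)) (hd : S.defect lam z = 0) :
    IsOutgoing α β L lam z.2.2 (extendIcc S.neg_le_self (S.solMap lam z))
      (extendIcc S.neg_le_self (S.fluxMap (S.dataMap lam z))) ∧
    extendIcc S.neg_le_self (S.solMap lam z) (-L) = z.1 := by
  have hLL := S.neg_le_self
  obtain ⟨U, V, hV, hU, hU0, hV0, hUI, hVI⟩ := S.exists_global (S.dataMap lam z)
  have eu : ∀ x ∈ Icc (-L) L, extendIcc S.neg_le_self (S.solMap lam z) x = U x := fun x hx => by
    rw [extendIcc_of_mem _ _ hx, ← hUI x hx, S.positionMap_dataMap]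
  have ev : ∀ x ∈ Icc (-L) L, extendIcc S.neg_le_self (S.fluxMap (S.dataMap lam z)) x = V x :=
    fun x hx => by rw [extendIcc_of_mem _ _ hx, ← hVI x hx]
  have h0 : -L ∈ Icc (-L) L := left_mem_Icc.2 hLL
  have h1 : L ∈ Icc (-L) L := right_mem_Icc.2 hLL
  rw [dataMap_apply] at hU0 hV0 hV
  refine ⟨⟨⟨?_, ?_⟩, ?_, ?_⟩, by rw [eu _ h0, hU0]⟩
  · refine ((hU.isPrimitiveOn _ _).congr_left eu).congr_right hLL
      (Eventually.of_forall fun x hx => ?_)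
    rw [ev x hx]
  · refine ((hV.isPrimitiveOn _ _).congr_left ev).congr_right hLL ?_
    filter_upwards [coeFn_extendZero S.toAdmissibleCoeffs S.neg_le_self (S.solMap lam z),
      S.ae_weight_iff.1 (Lp.coeFn_add z.2.2 (lam ^ 2 • extendZero S.toAdmissibleCoeffs
        S.neg_le_self (S.solMap lam z))),
      S.ae_weight_iff.1 (Lp.coeFn_smul (lam ^ 2) (extendZero S.toAdmissibleCoeffs
        S.neg_le_self (S.solMap lam z)))] with x e1 e2 e3 hx
    rw [e2, Pi.add_apply, e3, Pi.smul_apply, e1, indicator_of_mem hx, smul_eq_mul,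
      add_comm (z.2.2 x)]
  · rw [ev _ h0, eu _ h0, hV0, hU0]
    exact hz
  · rw [extendIcc_of_mem _ _ h1, extendIcc_of_mem _ _ h1]
    exact sub_eq_zero.1 hd

/-- The Wronskian of the two Jost solutions, up to normalization. -/
def wronskian (lam : ℂ) : ℂ := S.defect lam (homData β lam)

/-- The Wronskian does not vanish where homogeneous outgoing solutions do. -/
theorem wronskian_ne_zero {lam : ℂ} (h : ∀ u v : ℝ → ℂ, IsOutgoing α β L lam 0 u v → u (-L) = 0) :
    S.wronskian lam ≠ 0 := by
  intro hW
  -- If the Wronskian vanishes, the solution outgoing on the left is outgoing on the right as well,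
  -- although its value at $-L$ is $1$.
  obtain ⟨h1, h2⟩ := S.isOutgoing_of_defect_eq_zero (z := homData β lam) (by simp [homData]) hW
  have h3 : IsOutgoing α β L lam 0 (extendIcc S.neg_le_self (S.solMap lam (homData β lam)))
      (extendIcc S.neg_le_self (S.fluxMap (S.dataMap lam (homData β lam)))) := by
    refine ⟨⟨h1.left, h1.right.congr_right S.neg_le_self ?_⟩, h1.at_left, h1.at_right⟩
    filter_upwards [S.ae_weight_iff.1 (Lp.coeFn_zero ℂ 2 (weightMeasure β))] with x hx _
    change -((β x : ℂ) * (_ + (0 : WeightedL2 β) x)) = _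
    rw [hx]
  have := h _ _ h3
  rw [h2] at this
  exact one_ne_zero this

theorem wronskian_ne_zero_of_im_pos {lam : ℂ} (hlam : 0 < lam.im) : S.wronskian lam ≠ 0 :=
  S.wronskian_ne_zero fun _ _ h => h.eq_zero_of_im_pos S.toAdmissibleCoeffs S.length_pos hlam

/-- The data of the outgoing solution with source `g`. -/
def outgoingData (lam : ℂ) (g : WeightedL2 β) : ℂ × ℂ × WeightedL2 β :=
  sourceIncl β g - ((S.wronskian lam)⁻¹ * S.defect lam (sourceIncl β g)) • homData β lam

/-- The solution with zero initial data satisfies the condition at $-L$ trivially; subtracting a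
multiple of the homogeneous left outgoing solution keeps this condition and cancels the defect at
$L$. -/
theorem outgoingData_spec {lam : ℂ} (hW : S.wronskian lam ≠ 0) (g : WeightedL2 β) :
    IsOutgoing α β L lam g (extendIcc S.neg_le_self (S.solMap lam (S.outgoingData lam g)))
      (extendIcc S.neg_le_self (S.fluxMap (S.dataMap lam (S.outgoingData lam g)))) := by
  have h1 : (S.outgoingData lam g).2.2 = g := by
    simp [outgoingData, sourceIncl, homData]
  have h2 : S.defect lam (S.outgoingData lam g) = 0 := by
    rw [outgoingData, map_sub, map_smul]
    change _ - _ • S.wronskian lam = 0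
    rw [smul_eq_mul]
    field_simp
    simp
  have := (S.isOutgoing_of_defect_eq_zero (z := S.outgoingData lam g) (by
    simp [outgoingData, sourceIncl, homData]; ring) h2).1
  rwa [h1] at this

/-- The cut off resolvent, defined away from the zeros of the Wronskian. -/
def resolventFormula (lam : ℂ) : WeightedL2 β →L[ℂ] GraphDomain (divFormOp α β) :=
  S.lift ∘L S.dataMap lam ∘L sourceIncl β ∘L S.cutoff
    - (S.wronskian lam)⁻¹ • (S.defect lam ∘L sourceIncl β ∘L S.cutoff).smulRight
      (S.lift (S.dataMap lam (homData β lam)))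

/-- `resolventFormula` is written as an entire family minus $W^{-1}$ times an entire rank one
family, which displays its analyticity; this identity recovers its meaning as the cut off outgoing
solution. -/
theorem resolventFormula_apply (lam : ℂ) (f : WeightedL2 β) :
    S.resolventFormula lam f = S.lift (S.dataMap lam (S.outgoingData lam (S.cutoff f))) := by
  rw [outgoingData, map_sub, map_sub, map_smul, map_smul, mul_smul]
  rfl

theorem graphDomainIncl_resolventFormula (lam : ℂ) (f : WeightedL2 β) :
    graphDomainIncl (divFormOp α β) (S.resolventFormula lam f)
      = S.mulExtend χ S.continuous (S.solMap lam (S.outgoingData lam (S.cutoff f))) := by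
  rw [resolventFormula_apply, graphDomainIncl_lift]
  change S.mulExtend χ S.continuous (S.positionMap _) = _
  rw [S.positionMap_dataMap]

section Analyticity

/-- Inversion is analytic on units and `volterraOp` is a unit at every $\lambda$, so the solution
map is entire; poles can come only from the Wronskian. -/
theorem analyticAt_solMap (lam : ℂ) : AnalyticAt ℂ S.solMap lam := by
  have h1 : AnalyticAt ℂ S.volterraOp lam :=
    analyticAt_const.add ((analyticAt_id.pow 2).scalar_smul analyticAt_const)
  obtain ⟨u, hu⟩ := S.isUnit_volterraOp lam
  have h2 : AnalyticAt ℂ (Ring.inverse : (C(Icc (-L) L, ℂ) →L[ℂ] C(Icc (-L) L, ℂ)) → _)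
      (S.volterraOp lam) := hu ▸ analyticAt_inverse (𝕜 := ℂ) (A := C(Icc (-L) L, ℂ) →L[ℂ] C(Icc (-L) L, ℂ)) u
  exact (h2.comp h1).clm_comp' analyticAt_const

theorem analyticAt_dataMap (lam : ℂ) : AnalyticAt ℂ S.dataMap lam :=
  analyticAt_const.add ((analyticAt_id.pow 2).scalar_smul
    (analyticAt_const.clm_comp' (analyticAt_const.clm_comp' (S.analyticAt_solMap lam))))

theorem analyticAt_defect (lam : ℂ) : AnalyticAt ℂ S.defect lam :=
  (analyticAt_const.clm_comp' (analyticAt_const.clm_comp' (S.analyticAt_dataMap lam))).sub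
    ((analyticAt_const.mul analyticAt_id).scalar_smul
      (analyticAt_const.clm_comp' (S.analyticAt_solMap lam)))

theorem analyticAt_wronskian (lam : ℂ) : AnalyticAt ℂ S.wronskian lam :=
  (S.analyticAt_defect lam).clm_apply' (analyticAt_homData β lam)

theorem analyticAt_regularPart (lam : ℂ) : AnalyticAt ℂ
    (fun lam => S.lift ∘L S.dataMap lam ∘L sourceIncl β ∘L S.cutoff) lam :=
  analyticAt_const.clm_comp' ((S.analyticAt_dataMap lam).clm_comp' analyticAt_const)

theorem analyticAt_singularPart (lam : ℂ) : AnalyticAt ℂ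
    (fun lam => (S.defect lam ∘L sourceIncl β ∘L S.cutoff).smulRight
      (S.lift (S.dataMap lam (homData β lam)))) lam :=
  ((S.analyticAt_defect lam).clm_comp' analyticAt_const).clm_smulRight
    (analyticAt_const.clm_apply' ((S.analyticAt_dataMap lam).clm_apply' (analyticAt_homData β lam)))

theorem meromorphicAt_resolventFormula (lam : ℂ) : MeromorphicAt S.resolventFormula lam :=
  (S.analyticAt_regularPart lam).meromorphicAt.sub
    ((S.analyticAt_wronskian lam).meromorphicAt.inv.scalar_smul
      (S.analyticAt_singularPart lam).meromorphicAt)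

theorem analyticAt_resolventFormula {lam : ℂ} (hW : S.wronskian lam ≠ 0) :
    AnalyticAt ℂ S.resolventFormula lam :=
  (S.analyticAt_regularPart lam).sub
    (((S.analyticAt_wronskian lam).inv hW).scalar_smul (S.analyticAt_singularPart lam))

end Analyticity

end ScatteringSetting

/-! ### Extension of outgoing solutions to the line by exponentials -/

/-- The extension of a function on `[-L, L]` by multiples of `e^{-iλx}` to the left and of
`e^{iλx}` to the right. -/
def outgoingExt (L : ℝ) (lam : ℂ) (f : ℝ → ℂ) (x : ℝ) : ℂ :=
  f (max (-L) (min x L)) * Complex.exp (Complex.I * lam * (max (|x| - L) 0 : ℝ))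

section OutgoingExt

variable {L : ℝ} {lam : ℂ} {f : ℝ → ℂ}

theorem outgoingExt_of_mem {x : ℝ} (hx : x ∈ Icc (-L) L) : outgoingExt L lam f x = f x := by
  have h1 : |x| - L ≤ 0 := by linarith [abs_le.2 hx]
  rw [outgoingExt, max_eq_right h1, min_eq_left hx.2, max_eq_right hx.1]
  simp

theorem outgoingExt_of_ge (hL : 0 < L) {x : ℝ} (hx : L ≤ x) :
    outgoingExt L lam f x = f L * Complex.exp (Complex.I * lam * (x - L)) := by
  rw [outgoingExt, abs_of_nonneg (hL.le.trans hx), min_eq_right hx,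
    max_eq_right (by linarith : -L ≤ L), max_eq_left (by linarith : (0 : ℝ) ≤ x - L)]
  push_cast
  rfl

theorem outgoingExt_of_le (hL : 0 < L) {x : ℝ} (hx : x ≤ -L) :
    outgoingExt L lam f x = f (-L) * Complex.exp (Complex.I * lam * (-x - L)) := by
  rw [outgoingExt, abs_of_nonpos (by linarith), max_eq_left (by linarith : (0 : ℝ) ≤ -x - L),
    min_eq_left (by linarith), max_eq_left hx]
  push_cast
  rfl

theorem continuous_outgoingExt (hL : 0 < L) (hf : ContinuousOn f (Icc (-L) L)) :
    Continuous (outgoingExt L lam f) := by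
  have h1 : Continuous fun x : ℝ => f (max (-L) (min x L)) :=
    hf.comp_continuous (by fun_prop) fun x =>
      ⟨le_max_left _ _, max_le (by linarith) (min_le_right _ _)⟩
  unfold outgoingExt
  exact h1.mul (by fun_prop)

theorem integrable_exp_neg_mul_abs {c : ℝ} (hc : 0 < c) :
    Integrable (fun x : ℝ => Real.exp (-c * |x|)) := by
  have h1 : IntegrableOn (fun x : ℝ => Real.exp (-c * |x|)) (Ioi 0) := by
    refine (integrableOn_exp_mul_Ioi (neg_lt_zero.2 hc) 0).congr_fun (fun x hx => ?_)
      measurableSet_Ioi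
    simp only
    rw [abs_of_pos hx]
  have h2 : IntegrableOn (fun x : ℝ => Real.exp (-c * |x|)) (Iic 0) := by
    refine (integrableOn_exp_mul_Iic hc 0).congr_fun (fun x hx => ?_) measurableSet_Iic
    simp only
    rw [abs_of_nonpos hx, neg_mul_neg]
  have := h2.union h1
  rwa [Iic_union_Ioi, integrableOn_univ] at this

/-- The exponential factor has modulus $e^{-\operatorname{Im}\lambda\,(|x|-L)}$ outside $[-L,L]$,
while `f` is evaluated only on the compact interval, where it is bounded. -/
theorem memLp_outgoingExt (hL : 0 < L) (hlam : 0 < lam.im) (hf : ContinuousOn f (Icc (-L) L)) :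
    MemLp (outgoingExt L lam f) 2 volume := by
  obtain ⟨C, hC⟩ := isCompact_Icc.exists_bound_of_continuousOn hf
  have hm : AEStronglyMeasurable (fun x : ℝ => Real.exp (-lam.im * |x|)) volume :=
    (by fun_prop : Continuous fun x : ℝ => Real.exp (-lam.im * |x|)).aestronglyMeasurable
  have h1 : MemLp (fun x : ℝ => Real.exp (-lam.im * |x|)) 2 volume := by
    rw [memLp_two_iff_integrable_sq hm]
    refine (integrable_exp_neg_mul_abs (c := 2 * lam.im) (by linarith)).congr
      (Eventually.of_forall fun x => ?_)
    simp only
    rw [← Real.exp_nat_mul]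
    congr 1
    push_cast
    ring
  refine h1.of_le_mul (c := C * Real.exp (lam.im * L))
    (continuous_outgoingExt hL hf).aestronglyMeasurable (Eventually.of_forall fun x => ?_)
  have hmem : max (-L) (min x L) ∈ Icc (-L) L :=
    ⟨le_max_left _ _, max_le (by linarith) (min_le_right _ _)⟩
  have h2 := hC _ hmem
  have h3 : ‖Complex.exp (Complex.I * lam * (max (|x| - L) 0 : ℝ))‖
      ≤ Real.exp (lam.im * L) * Real.exp (-lam.im * |x|) := by
    rw [Complex.norm_exp, ← Real.exp_add]
    refine Real.exp_le_exp.2 ?_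
    have : (Complex.I * lam * (max (|x| - L) 0 : ℝ)).re = -(lam.im * max (|x| - L) 0) := by
      rw [Complex.re_mul_ofReal]; simp
    rw [this]
    nlinarith [le_max_left (|x| - L) 0]
  rw [outgoingExt, norm_mul, Real.norm_of_nonneg (Real.exp_pos _).le]
  exact (mul_le_mul h2 h3 (norm_nonneg _) ((norm_nonneg _).trans h2)).trans_eq
    (mul_assoc _ _ _).symm

/-- The three pieces agree at $\pm L$ and each is a primitive of `k`, so they glue. The integrand is
prescribed only almost everywhere because the lemma is used for $v$ too, whose derivative involves
an $L^2$ source. -/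
theorem IsPrimitiveOn.outgoingExt {f' k : ℝ → ℂ} (h : IsPrimitiveOn f f' (-L) L) (hL : 0 < L)
    (hk : LocallyIntegrable k volume) (hI : ∀ᵐ x, x ∈ Icc (-L) L → f' x = k x)
    (hr : ∀ᵐ x, L < x → k x = Complex.I * lam * outgoingExt L lam f x)
    (hl : ∀ᵐ x, x < -L → k x = -(Complex.I * lam) * outgoingExt L lam f x) :
    IsPrimitive (outgoingExt L lam f) k := by
  have hLL : -L ≤ L := by linarith
  have hexp : ∀ (a b c : ℂ) (x : ℝ), HasDerivAt (fun x : ℝ => c * Complex.exp (a * x + b))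
      (a * (c * Complex.exp (a * x + b))) x := by
    intro a b c x
    have := ((((Complex.ofRealCLM.hasDerivAt (x := x)).const_mul a).add_const b).cexp).const_mul c
    refine this.congr_deriv ?_
    simp only [Complex.ofRealCLM_apply, Complex.ofReal_one]
    ring
  have hftc : ∀ (a b c : ℂ) (x y : ℝ), c * Complex.exp (a * y + b)
      = c * Complex.exp (a * x + b) + ∫ t in x..y, a * (c * Complex.exp (a * t + b)) := by
    intro a b c x y
    rw [intervalIntegral.integral_eq_sub_of_hasDerivAt (fun t _ => hexp a b c t)
      ((by fun_prop : Continuous fun t : ℝ => a * (c * Complex.exp (a * t + b))).intervalIntegrable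
        _ _)]
    ring
  have hend : ∀ x ∈ Icc (-L) L, _root_.outgoingExt L lam f x = f x := fun x hx => outgoingExt_of_mem hx
  have h1 : -L ∈ Icc (-L) L := left_mem_Icc.2 hLL
  have h2 : L ∈ Icc (-L) L := right_mem_Icc.2 hLL
  refine IsPrimitive.of_forall_eq hk (-L) fun x => ?_
  have hmid : ∀ y ∈ Icc (-L) L, f y = f (-L) + ∫ t in (-L)..y, k t := by
    intro y hy
    rw [h.eq_add_integral y hy]
    congr 1
    refine intervalIntegral.integral_congr_ae ?_
    filter_upwards [hI] with t ht htI
    rw [uIoc_of_le hy.1] at htI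
    exact ht ⟨htI.1.le, htI.2.trans hy.2⟩
  rcases le_total x (-L) with hx | hx
  · rw [outgoingExt_of_le hL hx, hend _ h1]
    have := hftc (-(Complex.I * lam)) (-(Complex.I * lam * L)) (f (-L)) (-L) x
    have e : ∀ t : ℝ, -(Complex.I * lam) * (t : ℂ) + -(Complex.I * lam * L)
        = Complex.I * lam * (-t - L) := fun t => by ring
    simp only [e] at this
    rw [this]
    congr 1
    · simp
    · refine intervalIntegral.integral_congr_ae ?_
      -- The half-open interval of integration contains its right end $-L$, where `hl` says nothing;
      -- this point is negligible.
      have hne : ∀ᵐ t : ℝ, t ≠ -L := by simp [ae_iff, measure_singleton]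
      filter_upwards [hl, hne] with t ht htne htI
      rw [uIoc_of_ge hx] at htI
      rw [ht (lt_of_le_of_ne htI.2 htne), outgoingExt_of_le hL htI.2]
  rcases le_total x L with hx' | hx'
  · rw [hend x ⟨hx, hx'⟩, hend _ h1]
    exact hmid x ⟨hx, hx'⟩
  · rw [outgoingExt_of_ge hL hx', hend _ h1,
      ← intervalIntegral.integral_add_adjacent_intervals (hk.intervalIntegrable' (-L) L)
        (hk.intervalIntegrable' L x), ← add_assoc, ← hmid L h2]
    have := hftc (Complex.I * lam) (-(Complex.I * lam * L)) (f L) L x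
    have e : ∀ t : ℝ, Complex.I * lam * (t : ℂ) + -(Complex.I * lam * L)
        = Complex.I * lam * (t - L) := fun t => by ring
    simp only [e] at this
    rw [this]
    congr 1
    · simp
    · refine intervalIntegral.integral_congr_ae ?_
      filter_upwards [hr] with t ht htI
      rw [uIoc_of_le hx'] at htI
      rw [ht htI.1, outgoingExt_of_ge hL htI.1.le]

end OutgoingExt

/-! ### The graph of $H$ as a closed space of triples -/

theorem HasWeakDeriv.conj {g g' : ℝ → ℂ} (h : HasWeakDeriv g g') :
    HasWeakDeriv (fun x => starRingEnd ℂ (g x)) (fun x => starRingEnd ℂ (g' x)) := by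
  obtain ⟨F, hF, hFp⟩ := h.exists_isPrimitive
  refine hFp.conj.hasWeakDeriv.congr_ae ?_ EventuallyEq.rfl
  filter_upwards [hF] with x hx
  rw [hx]

section Domain

variable {α β : ℝ → ℝ} {m M : ℝ}

/-- The triples `(u, ∂ₓu, Hu)` as functions in `ℋ`. -/
def domainTriples (hc : AdmissibleCoeffs α β m M) :
    Submodule ℂ (WeightedL2 β × WeightedL2 β × WeightedL2 β) where
  carrier := {p | HasWeakDeriv p.1 p.2.1 ∧
    HasWeakDeriv (fun x => (α x : ℂ) * p.2.1 x) (fun x => -((β x : ℂ) * p.2.2 x))}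
  zero_mem' := by
    have h0 : ((0 : WeightedL2 β) : ℝ → ℂ) =ᵐ[volume] 0 :=
      hc.ae_weight_iff.1 (Lp.coeFn_zero ℂ 2 (weightMeasure β))
    refine ⟨HasWeakDeriv.zero.congr_ae h0.symm h0.symm, HasWeakDeriv.zero.congr_ae ?_ ?_⟩
    · filter_upwards [h0] with x hx
      change (0 : ℂ) = (α x : ℂ) * (0 : WeightedL2 β) x
      rw [hx]; simp
    · filter_upwards [h0] with x hx
      change (0 : ℂ) = -((β x : ℂ) * (0 : WeightedL2 β) x)
      rw [hx]; simp
  add_mem' := by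
    rintro ⟨u, v, h⟩ ⟨u', v', h'⟩ ⟨h1, h2⟩ ⟨h1', h2'⟩
    have eu := hc.ae_weight_iff.1 (Lp.coeFn_add u u')
    have ev := hc.ae_weight_iff.1 (Lp.coeFn_add v v')
    have eh := hc.ae_weight_iff.1 (Lp.coeFn_add h h')
    refine ⟨(h1.add h1').congr_ae ?_ ?_, (h2.add h2').congr_ae ?_ ?_⟩
    · filter_upwards [eu] with x hx
      exact hx.symm
    · filter_upwards [ev] with x hx
      exact hx.symm
    · filter_upwards [ev] with x hx
      simp only [Prod.mk_add_mk, Pi.add_apply] at hx ⊢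
      rw [hx]; ring
    · filter_upwards [eh] with x hx
      simp only [Prod.mk_add_mk, Pi.add_apply] at hx ⊢
      rw [hx]; ring
  smul_mem' := by
    rintro c ⟨u, v, h⟩ ⟨h1, h2⟩
    have eu := hc.ae_weight_iff.1 (Lp.coeFn_smul c u)
    have ev := hc.ae_weight_iff.1 (Lp.coeFn_smul c v)
    have eh := hc.ae_weight_iff.1 (Lp.coeFn_smul c h)
    refine ⟨(h1.const_smul c).congr_ae ?_ ?_, (h2.const_smul c).congr_ae ?_ ?_⟩
    · filter_upwards [eu] with x hx
      exact hx.symm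
    · filter_upwards [ev] with x hx
      exact hx.symm
    · filter_upwards [ev] with x hx
      simp only [Prod.smul_mk, Pi.smul_apply, smul_eq_mul] at hx ⊢
      rw [hx]; ring
    · filter_upwards [eh] with x hx
      simp only [Prod.smul_mk, Pi.smul_apply, smul_eq_mul] at hx ⊢
      rw [hx]; ring

theorem mem_domainTriples (hc : AdmissibleCoeffs α β m M)
    {p : WeightedL2 β × WeightedL2 β × WeightedL2 β} : p ∈ domainTriples hc ↔
    HasWeakDeriv p.1 p.2.1 ∧
      HasWeakDeriv (fun x => (α x : ℂ) * p.2.1 x) (fun x => -((β x : ℂ) * p.2.2 x)) := Iff.rfl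

variable (hc : AdmissibleCoeffs α β m M)
include hc

namespace AdmissibleCoeffs

theorem memLp_left_mul {f : ℝ → ℂ} {p : ℝ≥0∞} (hf : MemLp f p volume) :
    MemLp (fun x => (α x : ℂ) * f x) p volume := by
  refine hf.of_le_mul (c := M) ((Complex.measurable_ofReal.comp
    hc.measurable_left).aestronglyMeasurable.mul hf.1) (Eventually.of_forall fun x => ?_)
  rw [norm_mul, Complex.norm_real, Real.norm_of_nonneg (hc.pos.le.trans (hc.le_left x))]
  gcongr
  exact hc.left_le x

theorem memLp_right_mul {f : ℝ → ℂ} {p : ℝ≥0∞} (hf : MemLp f p volume) :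
    MemLp (fun x => (β x : ℂ) * f x) p volume := by
  refine hf.of_le_mul (c := M) ((Complex.measurable_ofReal.comp
    hc.measurable_right).aestronglyMeasurable.mul hf.1) (Eventually.of_forall fun x => ?_)
  rw [norm_mul, Complex.norm_real, Real.norm_of_nonneg (hc.pos.le.trans (hc.le_right x))]
  gcongr
  exact hc.right_le x

theorem memLp_left_inv_mul {f : ℝ → ℂ} {p : ℝ≥0∞} (hf : MemLp f p volume) :
    MemLp (fun x => (α x : ℂ)⁻¹ * f x) p volume := by
  refine hf.of_le_mul (c := m⁻¹) ((Complex.measurable_ofReal.comp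
    hc.measurable_left).inv.aestronglyMeasurable.mul hf.1) (Eventually.of_forall fun x => ?_)
  have := hc.pos
  rw [norm_mul, norm_inv, Complex.norm_real, Real.norm_of_nonneg (hc.pos.le.trans (hc.le_left x))]
  gcongr
  exact hc.le_left x

theorem memLp_right_inv_mul {f : ℝ → ℂ} {p : ℝ≥0∞} (hf : MemLp f p volume) :
    MemLp (fun x => (β x : ℂ)⁻¹ * f x) p volume := by
  refine hf.of_le_mul (c := m⁻¹) ((Complex.measurable_ofReal.comp
    hc.measurable_right).inv.aestronglyMeasurable.mul hf.1) (Eventually.of_forall fun x => ?_)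
  have := hc.pos
  rw [norm_mul, norm_inv, Complex.norm_real, Real.norm_of_nonneg (hc.pos.le.trans (hc.le_right x))]
  gcongr
  exact hc.le_right x

theorem inner_eq (f g : WeightedL2 β) :
    inner ℂ f g = ∫ x, (β x : ℂ) * (g x * starRingEnd ℂ (f x)) := by
  have h := hc.integral_weight (fun x => inner ℂ (f x) (g x)) univ MeasurableSet.univ
  rw [setIntegral_univ, setIntegral_univ] at h
  rw [L2.inner_def, h]
  refine integral_congr_ae (Eventually.of_forall fun x => ?_)
  simp only [RCLike.inner_apply, Complex.real_smul]

/-- The integral is the inner product in $\mathcal H$ with the conjugate of $\beta^{-1}\theta$. -/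
theorem continuous_integral_mul {θ : ℝ → ℂ} (hθ : MemLp θ 2 volume) :
    Continuous fun k : WeightedL2 β => ∫ x, θ x * k x := by
  have h1 : MemLp (fun x => starRingEnd ℂ ((β x : ℂ)⁻¹ * θ x)) 2 (weightMeasure β) :=
    hc.memLp_weight_iff.2 (hc.memLp_right_inv_mul hθ).star
  have h2 : (fun k : WeightedL2 β => ∫ x, θ x * k x) = fun k => inner ℂ h1.toLp k := by
    ext k
    rw [hc.inner_eq]
    refine integral_congr_ae ?_
    filter_upwards [hc.ae_weight_iff.1 h1.coeFn_toLp] with x hx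
    have : (β x : ℂ) ≠ 0 := by exact_mod_cast (hc.pos.trans_le (hc.le_right x)).ne'
    rw [hx, Complex.conj_conj]
    field_simp
  rw [h2]
  exact continuous_const.inner continuous_id

/-- Each test function imposes two equations between continuous functionals, and the set is their
common solution set. Recording the derivative as a separate component is what makes the conditions
closed. -/
theorem isClosed_domainTriples :
    IsClosed (domainTriples hc : Set (WeightedL2 β × WeightedL2 β × WeightedL2 β)) := by
  have key : (domainTriples hc : Set (WeightedL2 β × WeightedL2 β × WeightedL2 β)) =
      ⋂ φ : {φ : ℝ → ℝ // ContDiff ℝ ∞ φ ∧ HasCompactSupport φ},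
        ({p | ∫ x, ((deriv φ.1 x : ℝ) : ℂ) * p.1 x = -∫ x, (φ.1 x : ℂ) * p.2.1 x} ∩
        {p | ∫ x, ((α x : ℂ) * ((deriv φ.1 x : ℝ) : ℂ)) * p.2.1 x
          = ∫ x, ((β x : ℂ) * (φ.1 x : ℂ)) * p.2.2 x}) := by
    ext p
    simp only [SetLike.mem_coe, mem_domainTriples, mem_iInter, mem_inter_iff, mem_ofPred_eq,
      Subtype.forall]
    have l1 := hc.locallyIntegrable_coeFn p.1
    have l2 := hc.locallyIntegrable_coeFn p.2.1
    have l3 := (hc.memLp_left_mul (hc.memLp_coeFn p.2.1)).locallyIntegrable (by norm_num)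
    have l4 := (hc.locallyIntegrable_weight_mul (hc.locallyIntegrable_coeFn p.2.2)).neg
    have e1 : ∀ φ : ℝ → ℝ, (∫ x, deriv φ x • ((α x : ℂ) * p.2.1 x))
        = ∫ x, ((α x : ℂ) * ((deriv φ x : ℝ) : ℂ)) * p.2.1 x := fun φ => by
      refine integral_congr_ae (Eventually.of_forall fun x => ?_)
      simp only [Complex.real_smul]; ring
    have e2 : ∀ φ : ℝ → ℝ, (-∫ x, φ x • -((β x : ℂ) * p.2.2 x))
        = ∫ x, ((β x : ℂ) * (φ x : ℂ)) * p.2.2 x := fun φ => by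
      rw [← integral_neg]
      refine integral_congr_ae (Eventually.of_forall fun x => ?_)
      simp only [Complex.real_smul]; ring
    constructor
    · rintro ⟨h1, h2⟩ φ ⟨hφ, hφc⟩
      have h3 := h1.3 φ hφ hφc
      have h4 := h2.3 φ hφ hφc
      rw [e1, e2] at h4
      exact ⟨by simpa only [Complex.real_smul] using h3, h4⟩
    · intro h
      refine ⟨⟨l1, l2, fun φ hφ hφc => ?_⟩, ⟨l3, l4, fun φ hφ hφc => ?_⟩⟩
      · simpa only [Complex.real_smul] using (h φ ⟨hφ, hφc⟩).1
      · rw [e1, e2]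
        exact (h φ ⟨hφ, hφc⟩).2
  rw [key]
  refine isClosed_iInter fun φ => ?_
  obtain ⟨φ, hφ, hφc⟩ := φ
  have m1 : MemLp (fun x => (φ x : ℂ)) 2 volume :=
    (Complex.continuous_ofReal.comp hφ.continuous).memLp_of_hasCompactSupport
      (hφc.comp_left Complex.ofReal_zero)
  have m2 : MemLp (fun x => ((deriv φ x : ℝ) : ℂ)) 2 volume :=
    (Complex.continuous_ofReal.comp (hφ.continuous_deriv (by simp))).memLp_of_hasCompactSupport
      (hφc.deriv.comp_left Complex.ofReal_zero)
  refine (isClosed_eq ((hc.continuous_integral_mul m2).comp continuous_fst)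
    ((hc.continuous_integral_mul m1).comp (continuous_fst.comp continuous_snd)).neg).inter
    (isClosed_eq ((hc.continuous_integral_mul (hc.memLp_left_mul m2)).comp
      (continuous_fst.comp continuous_snd))
    ((hc.continuous_integral_mul (hc.memLp_right_mul m1)).comp
      (continuous_snd.comp continuous_snd)))

end AdmissibleCoeffs

end Domain

/-! ### Lower bound for $H-\lambda^2$ in the upper half plane -/

section LowerBound

variable {α β : ℝ → ℝ} {m M : ℝ} (hc : AdmissibleCoeffs α β m M)
include hc

namespace AdmissibleCoeffs

theorem norm_sq_eq (f : WeightedL2 β) : ‖f‖ ^ 2 = ∫ x, β x * ‖f x‖ ^ 2 := by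
  have h := inner_self_eq_norm_sq_to_K (𝕜 := ℂ) f
  rw [hc.inner_eq] at h
  have h2 : ∫ x, (β x : ℂ) * (f x * starRingEnd ℂ (f x))
      = ((∫ x, β x * ‖f x‖ ^ 2 : ℝ) : ℂ) := by
    rw [← integral_complex_ofReal]
    refine integral_congr_ae (Eventually.of_forall fun x => ?_)
    simp only [Complex.mul_conj, Complex.normSq_eq_norm_sq]
    push_cast
    rfl
  rw [h2] at h
  exact Complex.ofReal_injective (by rw [h]; push_cast; rfl)

/-- Integration by parts gives $\langle u,Hu\rangle=\int\alpha|u'|^2$, which is real and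
nonnegative. The factor $m/M$ converts the weight: $(m/M)\beta\le m\le\alpha$. -/
theorem exists_inner_eq {p : WeightedL2 β × WeightedL2 β × WeightedL2 β}
    (hp : p ∈ domainTriples hc) :
    ∃ a : ℝ, inner ℂ p.1 p.2.2 = (a : ℂ) ∧ m / M * ‖p.2.1‖ ^ 2 ≤ a := by
  obtain ⟨h1, h2⟩ := hp
  have m1 := hc.memLp_coeFn p.1
  have m2 := hc.memLp_coeFn p.2.1
  have m3 := hc.memLp_coeFn p.2.2
  have key := h2.integral_mul_eq_neg h1.conj (hc.memLp_left_mul m2) (hc.memLp_right_mul m3).neg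
    m1.star m2.star
  have hM := hc.upper_pos
  refine ⟨∫ x, α x * ‖p.2.1 x‖ ^ 2, ?_, ?_⟩
  · rw [hc.inner_eq, ← integral_complex_ofReal]
    have e1 : ∫ x, (β x : ℂ) * (p.2.2 x * starRingEnd ℂ (p.1 x))
        = -∫ x, -((β x : ℂ) * p.2.2 x) * starRingEnd ℂ (p.1 x) := by
      rw [← integral_neg]
      refine integral_congr_ae (Eventually.of_forall fun x => ?_)
      simp only
      ring
    rw [e1, key, neg_neg]
    refine integral_congr_ae (Eventually.of_forall fun x => ?_)
    simp only [mul_assoc, Complex.mul_conj, Complex.normSq_eq_norm_sq]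
    push_cast
    rfl
  · rw [hc.norm_sq_eq, ← integral_const_mul]
    have i2 : Integrable fun x => ‖p.2.1 x‖ ^ 2 := m2.integrable_norm_pow (by norm_num)
    have bdd : ∀ {f : ℝ → ℝ}, Measurable f → (∀ x, m ≤ f x) → (∀ x, f x ≤ M) →
        Integrable fun x => f x * ‖p.2.1 x‖ ^ 2 := fun hf h h' =>
      i2.bdd_mul hf.aestronglyMeasurable (c := M) (Eventually.of_forall fun x => by
        rw [Real.norm_of_nonneg (hc.pos.le.trans (h x))]; exact h' x)
    refine integral_mono ((bdd hc.measurable_right hc.le_right hc.right_le).const_mul _)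
      (bdd hc.measurable_left hc.le_left hc.left_le) fun x => ?_
    simp only
    have hb : m / M * β x ≤ α x := by
      rw [div_mul_eq_mul_div, div_le_iff₀ hM]
      nlinarith [hc.right_le x, hc.le_left x, hc.pos, hc.le_right x]
    rw [← mul_assoc]
    gcongr

/-- Pairing with $u$ gives $a-\lambda^2\|u\|^2$, where $a=\langle u,Hu\rangle\ge0$. Multiplied by
$\bar\lambda$, its imaginary part is $-\operatorname{Im}\lambda\,(a+|\lambda|^2\|u\|^2)$, which
controls both $u$ and $u'$. Without $\bar\lambda$ the imaginary part would degenerate on the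
imaginary axis. -/
theorem exists_norm_le {lam : ℂ} (hlam : 0 < lam.im) : ∃ K : ℝ, 0 < K ∧
    ∀ p ∈ domainTriples hc, ‖p‖ ≤ K * ‖p.2.2 - lam ^ 2 • p.1‖ := by
  have hl : 0 < ‖lam‖ := norm_pos_iff.2 fun h => by simp [h] at hlam
  have hm := hc.pos
  have hM := hc.upper_pos
  set K₁ := (lam.im * ‖lam‖)⁻¹ with hK₁
  have hK₁0 : 0 < K₁ := by positivity
  set K₂ := M / m * (‖lam‖ * K₁ / lam.im) with hK₂
  have hK₂0 : 0 < K₂ := by positivity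
  set K := max K₁ (max (√K₂) (1 + ‖lam‖ ^ 2 * K₁)) with hK
  refine ⟨K, lt_max_of_lt_left hK₁0, fun p hp => ?_⟩
  obtain ⟨a, ha, hav⟩ := hc.exists_inner_eq hp
  have ha0 : 0 ≤ a := le_trans (by positivity) hav
  set φ := p.2.2 - lam ^ 2 • p.1 with hφ
  have h1 : inner ℂ p.1 φ = (a : ℂ) - lam ^ 2 * (‖p.1‖ ^ 2 : ℝ) := by
    rw [hφ, inner_sub_right, inner_smul_right, ha, inner_self_eq_norm_sq_to_K]
    push_cast
    rfl
  have h2 : lam.im * (a + ‖lam‖ ^ 2 * ‖p.1‖ ^ 2) ≤ ‖lam‖ * (‖p.1‖ * ‖φ‖) := by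
    have h3 : (starRingEnd ℂ lam * inner ℂ p.1 φ).im
        = -(lam.im * (a + ‖lam‖ ^ 2 * ‖p.1‖ ^ 2)) := by
      rw [h1, ← Complex.normSq_eq_norm_sq, Complex.normSq_apply]
      simp [pow_two]
      ring
    have h4 := Complex.abs_im_le_norm (starRingEnd ℂ lam * inner ℂ p.1 φ)
    rw [h3, abs_neg, norm_mul, RCLike.norm_conj] at h4
    exact (le_abs_self _).trans (h4.trans (by gcongr; exact norm_inner_le_norm _ _))
  have b1 : ‖p.1‖ ≤ K₁ * ‖φ‖ := by
    rcases (norm_nonneg p.1).eq_or_lt with h | h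
    · rw [← h]; positivity
    rw [hK₁, inv_mul_eq_div, le_div_iff₀ (by positivity)]
    have h5 : lam.im * (‖lam‖ ^ 2 * ‖p.1‖ ^ 2) ≤ ‖lam‖ * (‖p.1‖ * ‖φ‖) := by
      nlinarith [mul_nonneg hlam.le ha0]
    have h6 : (‖lam‖ * ‖p.1‖) * (‖p.1‖ * (lam.im * ‖lam‖)) ≤ (‖lam‖ * ‖p.1‖) * ‖φ‖ := by
      linarith
    exact le_of_mul_le_mul_left h6 (by positivity)
  have b2 : ‖p.2.1‖ ≤ √K₂ * ‖φ‖ := by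
    rw [← Real.sqrt_sq (norm_nonneg φ), ← Real.sqrt_mul hK₂0.le]
    refine Real.le_sqrt_of_sq_le ?_
    have h5 : lam.im * a ≤ ‖lam‖ * (K₁ * ‖φ‖ * ‖φ‖) := by
      have : 0 ≤ lam.im * (‖lam‖ ^ 2 * ‖p.1‖ ^ 2) := by positivity
      have h6 : ‖lam‖ * (‖p.1‖ * ‖φ‖) ≤ ‖lam‖ * (K₁ * ‖φ‖ * ‖φ‖) := by gcongr
      linarith
    have h6 : a ≤ ‖lam‖ * K₁ / lam.im * ‖φ‖ ^ 2 := by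
      rw [div_mul_eq_mul_div, le_div_iff₀ hlam]
      linarith
    have h7 : ‖p.2.1‖ ^ 2 ≤ M / m * a := by
      rw [div_mul_eq_mul_div, div_le_iff₀ hM] at hav
      rw [div_mul_eq_mul_div, le_div_iff₀ hm]
      linarith
    calc ‖p.2.1‖ ^ 2 ≤ M / m * a := h7
      _ ≤ M / m * (‖lam‖ * K₁ / lam.im * ‖φ‖ ^ 2) := by gcongr
      _ = _ := by rw [hK₂]; ring
  have b3 : ‖p.2.2‖ ≤ (1 + ‖lam‖ ^ 2 * K₁) * ‖φ‖ := by
    have : p.2.2 = φ + lam ^ 2 • p.1 := by rw [hφ]; abel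
    rw [this]
    refine (norm_add_le _ _).trans ?_
    rw [norm_smul, norm_pow]
    calc ‖φ‖ + ‖lam‖ ^ 2 * ‖p.1‖ ≤ ‖φ‖ + ‖lam‖ ^ 2 * (K₁ * ‖φ‖) := by gcongr
      _ = _ := by ring
  rw [Prod.norm_def, Prod.norm_def]
  refine max_le (b1.trans ?_) (max_le (b2.trans ?_) (b3.trans ?_))
  · gcongr; exact le_max_left _ _
  · gcongr; exact (le_max_left _ _).trans (le_max_right _ _)
  · gcongr; exact (le_max_right _ _).trans (le_max_right _ _)

/-- The map `(u, ∂ₓu, Hu) ↦ Hu - zu`. -/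
def shiftMap (z : ℂ) : domainTriples hc →L[ℂ] WeightedL2 β :=
  (ContinuousLinearMap.snd ℂ (WeightedL2 β) (WeightedL2 β) ∘L ContinuousLinearMap.snd ℂ _ _
    - z • ContinuousLinearMap.fst ℂ (WeightedL2 β) _) ∘L (domainTriples hc).subtypeL

theorem exists_antilipschitz {lam : ℂ} (hlam : 0 < lam.im) :
    ∃ K, AntilipschitzWith K (hc.shiftMap (lam ^ 2)) := by
  obtain ⟨K, hK, h⟩ := hc.exists_norm_le hlam
  exact ⟨⟨K, hK.le⟩, AddMonoidHomClass.antilipschitz_of_bound _ fun p => h p.1 p.2⟩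

/-- The boundedness conditions in the domain are automatic: $u$ and $\alpha u'$ are square
integrable with square integrable weak derivatives, hence bounded, and $\alpha$ is bounded below. -/
theorem mem_divFormGraph_iff {a b : WeightedL2 β} :
    (a, b) ∈ divFormGraph α β ↔ ∃ v, (a, v, b) ∈ domainTriples hc := by
  have hβ : ∀ x, (β x : ℂ) ≠ 0 := fun x => by exact_mod_cast (hc.pos.trans_le (hc.le_right x)).ne'
  have hα : ∀ x, (α x : ℂ) ≠ 0 := fun x => by exact_mod_cast (hc.pos.trans_le (hc.le_left x)).ne'
  constructor
  · rintro ⟨u, v, w, h1, h2, h3, -, h5, -, -, h8, h9⟩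
    have hv := hc.memLp_weight_iff.2 h5
    have e1 := hc.ae_weight_iff.1 h1
    have e2 := hc.ae_weight_iff.1 h2
    have e3 := hc.ae_weight_iff.1 hv.coeFn_toLp
    refine ⟨hv.toLp, ?_, ?_⟩
    · refine h8.congr_ae ?_ ?_
      · filter_upwards [e1] with x hx using hx.symm
      · filter_upwards [e3] with x hx using hx.symm
    · refine h9.congr_ae ?_ ?_
      · filter_upwards [e3] with x hx
        rw [hx]
      · filter_upwards [e2] with x hx
        have := hβ x
        rw [hx]
        field_simp
  · rintro ⟨v, h1, h2⟩
    have ma := hc.memLp_coeFn a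
    have mv := hc.memLp_coeFn v
    have mb := hc.memLp_coeFn b
    have mα := hc.memLp_left_mul mv
    have mβ := (hc.memLp_right_mul mb).neg
    refine ⟨a, v, fun x => -((β x : ℂ) * b x), EventuallyEq.rfl, ?_, ma, h1.memLp_top ma mv, mv, ?_,
      mβ, h1, h2⟩
    · refine Eventually.of_forall fun x => ?_
      simp only
      have := hβ x
      field_simp
    · have := hc.memLp_left_inv_mul (h2.memLp_top mα mβ)
      refine this.ae_eq (Eventually.of_forall fun x => ?_)
      simp only
      have := hα x
      field_simp

theorem divFormOp_graph_iff {a b : WeightedL2 β} :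
    (a, b) ∈ (divFormOp α β).graph ↔ ∃ v, (a, v, b) ∈ domainTriples hc := by
  rw [divFormOp_graph (fun x => hc.pos.trans_le (hc.le_right x)) hc.measurable_right,
    hc.mem_divFormGraph_iff]

end AdmissibleCoeffs

end LowerBound

/-! ### Existence of the resolvent for $\operatorname{Im}\lambda>0$ -/

namespace ScatteringSetting

variable {α β χ : ℝ → ℝ} {m M R₀ L : ℝ} (S : ScatteringSetting α β χ m M R₀ L)
include S

/-- Only the coefficients and cutoff near $\pm L$ matter, so every source of compact support can be
reached by increasing $L$. -/
theorem enlarge {L' : ℝ} (h : L ≤ L') : ScatteringSetting α β χ m M R₀ L' :=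
  { S with
    radius_le := S.radius_le.trans h
    eventually_zero := fun x hx => S.eventually_zero x (h.trans hx) }

theorem eq_one_of_lt {x : ℝ} (hx : L < |x|) : α x = 1 ∧ β x = 1 :=
  ⟨S.left_eq_one x (S.radius_le.trans hx.le), S.right_eq_one x (S.radius_le.trans hx.le)⟩

/-- The outgoing solution with compactly supported source is square integrable and lies in the
domain of the operator when `Im λ > 0`. -/
theorem exists_mem_domainTriples {lam : ℂ} (hlam : 0 < lam.im) (g : WeightedL2 β)
    (hg : ∀ᵐ x, x ∉ Icc (-L) L → g x = 0) :
    ∃ p ∈ domainTriples S.toAdmissibleCoeffs, p.2.2 - lam ^ 2 • p.1 = g ∧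
      ∀ᵐ x, x ∈ Icc (-L) L →
        p.1 x = extendIcc S.neg_le_self (S.solMap lam (S.outgoingData lam g)) x := by
  have hL := S.length_pos
  have hα : ∀ x, (α x : ℂ) ≠ 0 := fun x => by exact_mod_cast (S.pos.trans_le (S.le_left x)).ne'
  have hout := S.outgoingData_spec (S.wronskian_ne_zero_of_im_pos hlam) g
  set u := extendIcc S.neg_le_self (S.solMap lam (S.outgoingData lam g))
  set v := extendIcc S.neg_le_self (S.fluxMap (S.dataMap lam (S.outgoingData lam g)))
  set U := outgoingExt L lam u with hU
  set V := outgoingExt L lam v with hV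
  have cu := hout.left.continuousOn
  have cv := hout.right.continuousOn
  have cU : Continuous U := continuous_outgoingExt hL cu
  have cV : Continuous V := continuous_outgoingExt hL cv
  have mU : MemLp U 2 volume := memLp_outgoingExt hL hlam cu
  have mV : MemLp V 2 volume := memLp_outgoingExt hL hlam cv
  have hVr : ∀ x, L < x → V x = Complex.I * lam * U x := fun x hx => by
    rw [hV, hU, outgoingExt_of_ge hL hx.le, outgoingExt_of_ge hL hx.le, hout.at_right]
    ring
  have hVl : ∀ x, x < -L → V x = -(Complex.I * lam) * U x := fun x hx => by
    rw [hV, hU, outgoingExt_of_le hL hx.le, outgoingExt_of_le hL hx.le, hout.at_left]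
    ring
  have out_r : ∀ x, L < x → L < |x| := fun x hx => hx.trans_le (le_abs_self x)
  have out_l : ∀ x, x < -L → L < |x| := fun x hx => lt_abs.2 (Or.inr (by linarith))
  have pU : IsPrimitive U (fun x => (α x : ℂ)⁻¹ * V x) := by
    refine hout.left.outgoingExt hL (S.locallyIntegrable_inv_mul cV.locallyIntegrable)
      (Eventually.of_forall fun x hx => ?_) (Eventually.of_forall fun x hx => ?_)
      (Eventually.of_forall fun x hx => ?_)
    · rw [hV, outgoingExt_of_mem hx]
    · rw [(S.eq_one_of_lt (out_r x hx)).1, hVr x hx]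
      simp [hU]
    · rw [(S.eq_one_of_lt (out_l x hx)).1, hVl x hx]
      simp [hU]
  have pV : IsPrimitive V (fun x => -((β x : ℂ) * (lam ^ 2 * U x + g x))) := by
    refine hout.right.outgoingExt hL (S.locallyIntegrable_weight_mul
      ((cU.locallyIntegrable.smul (lam ^ 2)).add (S.locallyIntegrable_coeFn g))).neg
      (Eventually.of_forall fun x hx => ?_) ?_ ?_
    · rw [hU, outgoingExt_of_mem hx]
    · filter_upwards [hg] with x hgx hx
      rw [← hV, hVr x hx, (S.eq_one_of_lt (out_r x hx)).2, hgx fun h => h.2.not_gt hx, Complex.ofReal_one]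
      linear_combination -(lam ^ 2 * U x) * Complex.I_sq
    · filter_upwards [hg] with x hgx hx
      rw [← hV, hVl x hx, (S.eq_one_of_lt (out_l x hx)).2, hgx fun h => h.1.not_gt hx, Complex.ofReal_one]
      linear_combination -(lam ^ 2 * U x) * Complex.I_sq
  have nU := S.memLp_weight_iff.2 mU
  have nV := S.memLp_weight_iff.2 (S.memLp_left_inv_mul mV)
  have eU := S.ae_weight_iff.1 nU.coeFn_toLp
  have eV := S.ae_weight_iff.1 nV.coeFn_toLp
  refine ⟨(nU.toLp, nV.toLp, lam ^ 2 • nU.toLp + g), ⟨?_, ?_⟩, ?_, ?_⟩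
  · refine pU.hasWeakDeriv.congr_ae ?_ ?_
    · filter_upwards [eU] with x hx using hx.symm
    · filter_upwards [eV] with x hx using hx.symm
  · refine pV.hasWeakDeriv.congr_ae ?_ ?_
    · filter_upwards [eV] with x hx
      have := hα x
      rw [hx]
      field_simp
    · filter_upwards [eU, S.ae_weight_iff.1 (Lp.coeFn_add (lam ^ 2 • nU.toLp) g),
        S.ae_weight_iff.1 (Lp.coeFn_smul (lam ^ 2) nU.toLp)] with x h1 h2 h3
      rw [h2, Pi.add_apply, h3, Pi.smul_apply, h1, smul_eq_mul]
  · simp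
  · filter_upwards [eU] with x hx hxI
    rw [hx, hU, outgoingExt_of_mem hxI]

/-- The lower bound and completeness make the range closed. It contains every compactly supported
source, by the outgoing construction on a large interval, so its orthogonal complement is zero. -/
theorem surjective_shiftMap {lam : ℂ} (hlam : 0 < lam.im) :
    Function.Surjective (S.toAdmissibleCoeffs.shiftMap (lam ^ 2)) := by
  obtain ⟨K, hK⟩ := S.exists_antilipschitz hlam
  have := S.isClosed_domainTriples.completeSpace_coe
  have hcl : IsClosed (range (S.toAdmissibleCoeffs.shiftMap (lam ^ 2))) :=
    hK.isClosed_range (S.toAdmissibleCoeffs.shiftMap (lam ^ 2)).uniformContinuous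
  set W := LinearMap.range (S.toAdmissibleCoeffs.shiftMap (lam ^ 2)).toLinearMap with hW
  have hWcl : IsClosed (W : Set (WeightedL2 β)) := hcl
  have hperp : Wᗮ = ⊥ := by
    rw [Submodule.eq_bot_iff]
    intro g hg
    have hzero : ∀ n : ℕ, L ≤ n → ∀ᵐ x, x ∈ Icc (-(n : ℝ)) n → g x = 0 := by
      intro n hn
      have mg := (Lp.memLp g).indicator (measurableSet_Icc : MeasurableSet (Icc (-(n : ℝ)) n))
      have eg := S.ae_weight_iff.1 mg.coeFn_toLp
      have hmem : mg.toLp ∈ W := by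
        obtain ⟨p, hp, hpg, -⟩ := (S.enlarge hn).exists_mem_domainTriples hlam mg.toLp (by
          filter_upwards [eg] with x hx hxI
          rw [hx, indicator_of_notMem hxI])
        exact ⟨⟨p, hp⟩, hpg⟩
      -- The truncation of $g$ to $[-n,n]$ lies in the range, to which $g$ is orthogonal; and the
      -- pairing of the truncation with $g$ is its own squared norm.
      have h0 : inner ℂ mg.toLp mg.toLp = (0 : ℂ) := by
        rw [← (Submodule.mem_orthogonal W g).1 hg _ hmem, S.inner_eq, S.inner_eq]
        refine integral_congr_ae ?_
        filter_upwards [eg] with x hx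
        rw [hx]
        by_cases hxI : x ∈ Icc (-(n : ℝ)) n
        · rw [indicator_of_mem hxI]
        · simp [indicator_of_notMem hxI]
      rw [inner_self_eq_zero] at h0
      have h1 : ((0 : WeightedL2 β) : ℝ → ℂ) =ᵐ[volume] 0 :=
        S.ae_weight_iff.1 (Lp.coeFn_zero ℂ 2 (weightMeasure β))
      rw [h0] at eg
      filter_upwards [eg, h1] with x hx hx0 hxI
      rw [indicator_of_mem hxI] at hx
      rw [← hx, hx0, Pi.zero_apply]
    refine Lp.eq_zero_iff_ae_eq_zero.2 (S.ae_weight_iff.2 ?_)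
    have := ae_all_iff.2 fun n : ℕ => (ae_all_iff.2 fun hn : L ≤ n => hzero n hn)
    filter_upwards [this] with x hx
    obtain ⟨n, hn⟩ := exists_nat_ge (max L |x|)
    exact hx n ((le_max_left _ _).trans hn) (abs_le.1 ((le_max_right _ _).trans hn))
  have htop : W = ⊤ := by
    rw [← hWcl.submodule_topologicalClosure_eq, Submodule.topologicalClosure_eq_top_iff, hperp]
  exact LinearMap.range_eq_top.1 htop

/-- The resolvent of `divFormOp` exists in the upper half plane, and the cut off resolvent is given
by `resolventFormula`. -/
theorem exists_isResolventAt {lam : ℂ} (hlam : 0 < lam.im) : ∃ R : WeightedL2 β →L[ℂ] WeightedL2 β,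
    IsResolventAt (divFormOp α β) (lam ^ 2) R ∧
    ∀ f, graphDomainIncl (divFormOp α β) (S.resolventFormula lam f) = S.cutoff (R (S.cutoff f)) := by
  obtain ⟨K, hK⟩ := S.exists_antilipschitz hlam
  have := S.isClosed_domainTriples.completeSpace_coe
  set e := ContinuousLinearEquiv.ofBijective (S.toAdmissibleCoeffs.shiftMap (lam ^ 2))
    (LinearMap.ker_eq_bot.2 hK.injective) (LinearMap.range_eq_top.2 (S.surjective_shiftMap hlam))
    with he
  have hes : ∀ f, (e.symm f).1.2.2 - lam ^ 2 • (e.symm f).1.1 = f := fun f =>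
    e.apply_symm_apply f
  have hse : ∀ p : domainTriples S.toAdmissibleCoeffs, e.symm (p.1.2.2 - lam ^ 2 • p.1.1) = p :=
    fun p => e.symm_apply_apply p
  set R := ContinuousLinearMap.fst ℂ (WeightedL2 β) _ ∘L
    (domainTriples S.toAdmissibleCoeffs).subtypeL ∘L e.symm.toContinuousLinearMap with hR
  have hRf : ∀ f, R f = (e.symm f).1.1 := fun f => rfl
  have hgraph : ∀ f, (R f, (e.symm f).1.2.2) ∈ (divFormOp α β).graph := fun f =>
    S.divFormOp_graph_iff.2 ⟨(e.symm f).1.2.1, (e.symm f).2⟩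
  refine ⟨R, ⟨fun f => LinearPMap.mem_domain_of_mem_graph (hgraph f), fun f => ?_, fun u => ?_⟩,
    fun f => ?_⟩
  · have : divFormOp α β ⟨R f, LinearPMap.mem_domain_of_mem_graph (hgraph f)⟩
        = (e.symm f).1.2.2 := by
      obtain ⟨y, hy1, hy2⟩ := (LinearPMap.mem_graph_iff _).1 (hgraph f)
      exact (congrArg _ (Subtype.ext hy1.symm)).trans hy2
    rw [this]
    exact hes f
  · obtain ⟨v, hv⟩ := S.divFormOp_graph_iff.1 ((divFormOp α β).mem_graph u)
    exact congrArg (fun p => p.1.1) (hse ⟨_, hv⟩)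
  · rw [S.graphDomainIncl_resolventFormula]
    have hcut : ∀ h, S.cutoff h =ᵐ[volume] fun x => (χ x : ℂ) * h x := fun h =>
      S.ae_weight_iff.1 (coeFn_mulCutoff (weightMeasure β) χ S.contDiff.continuous
        S.hasCompactSupport h)
    obtain ⟨p, hp, hpg, hpu⟩ := S.exists_mem_domainTriples hlam (S.cutoff f) (by
      filter_upwards [hcut f] with x hx hxI
      rw [hx, S.eq_zero_of_notMem hxI]
      simp)
    -- The outgoing solution with source $\chi f$ lies in the domain, so injectivity of
    -- $H-\lambda^2$ identifies it with $R(\chi f)$.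
    have hRp : R (S.cutoff f) = p.1 := by
      rw [hRf, ← hpg]
      exact congrArg (fun p => p.1.1) (hse ⟨p, hp⟩)
    rw [hRp]
    refine Lp.ext (S.ae_weight_iff.2 ?_)
    filter_upwards [hcut p.1, hpu, S.coeFn_mulExtend S.continuous
      (fun x hx => S.eq_zero_of_notMem hx)
      (S.solMap lam (S.outgoingData lam (S.cutoff f)))] with x h1 h2 h3
    rw [h1, h3]
    by_cases hxI : x ∈ Icc (-L) L
    · rw [h2 hxI]
    · simp [S.eq_zero_of_notMem hxI]

end ScatteringSetting

/-! ### Uniqueness of the continuation -/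

section Uniqueness

variable {E : Type*} [NormedAddCommGroup E] [NormedSpace ℂ E] {A : E →ₗ.[ℂ] E}

theorem graphDomainIncl_injective : Function.Injective (graphDomainIncl A) := by
  rintro ⟨x, hx⟩ ⟨y, hy⟩ h
  refine Subtype.ext ((WithLp.linearEquiv 2 ℂ (E × E)).injective (Prod.ext h ?_))
  exact A.mem_graph_snd_inj hx hy h

theorem IsResolventAt.eq {z : ℂ} {R R' : E →L[ℂ] E} (h : IsResolventAt A z R)
    (h' : IsResolventAt A z R') : R = R' := by
  ext f
  have := h'.left_inv ⟨R f, h.mem_domain f⟩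
  rwa [h.right_inv, eq_comm] at this

/-- Functions that are meromorphic in normal form on `ℂ` and agree on a nonempty open set
coincide. -/
theorem MeromorphicNFOn.eq_of_eventuallyEq {F : Type*} [NormedAddCommGroup F] [NormedSpace ℂ F]
    {f g : ℂ → F} (hf : MeromorphicNFOn f univ) (hg : MeromorphicNFOn g univ) {z : ℂ}
    (h : f =ᶠ[𝓝 z] g) : f = g := by
  ext1 w
  have hd : Meromorphic (f - g) := fun x =>
    (hf (mem_univ x)).meromorphicAt.sub (hg (mem_univ x)).meromorphicAt
  have hz : meromorphicOrderAt (f - g) z = ⊤ := by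
    rw [meromorphicOrderAt_eq_top_iff]
    filter_upwards [h.filter_mono nhdsWithin_le_nhds] with x hx
    rw [Pi.sub_apply, hx, sub_self]
  -- Infinite order of the difference propagates from one point to the whole connected plane; normal
  -- form then upgrades equality on punctured neighbourhoods to equality at the points themselves.
  have hw : meromorphicOrderAt (f - g) w = ⊤ := by
    by_contra hne
    exact hd.exists_meromorphicOrderAt_ne_top_iff_forall.1 ⟨w, hne⟩ z hz
  rw [meromorphicOrderAt_eq_top_iff] at hw
  refine (((hf (mem_univ w)).eventuallyEq_nhdsNE_iff_eventuallyEq_nhds (hg (mem_univ w))).1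
    ?_).self_of_nhds
  filter_upwards [hw] with x hx
  exact sub_eq_zero.1 hx

/-- In the upper half plane the value is determined, because a resolvent is unique and an element of
the domain is determined by its first component. The identity theorem, applied near $i$, does the
rest. -/
theorem IsContinuedCutoffResolvent.eq {B : E →L[ℂ] E} {T T' : ℂ → (E →L[ℂ] GraphDomain A)}
    (h : IsContinuedCutoffResolvent A B T) (h' : IsContinuedCutoffResolvent A B T') : T = T' := by
  refine h.meromorphic.eq_of_eventuallyEq h'.meromorphic (z := Complex.I) ?_
  have hopen : IsOpen {z : ℂ | 0 < z.im} := isOpen_lt continuous_const Complex.continuous_im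
  filter_upwards [hopen.mem_nhds (by simp : Complex.I ∈ {z : ℂ | 0 < z.im})] with z hz
  obtain ⟨R, hR, hT⟩ := h.eq_of_im_pos z hz
  obtain ⟨R', hR', hT'⟩ := h'.eq_of_im_pos z hz
  ext1 f
  exact graphDomainIncl_injective (by rw [hT, hT', hR.eq hR'])

end Uniqueness

/-! ### The continued resolvent and its bound in a strip -/

namespace ScatteringSetting

variable {α β χ : ℝ → ℝ} {m M R₀ L : ℝ} (S : ScatteringSetting α β χ m M R₀ L)
include S

/-- The meromorphic continuation of the cut off resolvent. -/
def continuedResolvent : ℂ → (WeightedL2 β →L[ℂ] GraphDomain (divFormOp α β)) :=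
  toMeromorphicNFOn S.resolventFormula univ

theorem meromorphicOn_resolventFormula : MeromorphicOn S.resolventFormula univ :=
  fun z _ => S.meromorphicAt_resolventFormula z

/-- Passing to normal form preserves the values on punctured neighbourhoods, and an analytic
function is already in normal form, so nothing changes where the Wronskian is nonzero. -/
theorem continuedResolvent_eventuallyEq {lam : ℂ} (hW : S.wronskian lam ≠ 0) :
    S.continuedResolvent =ᶠ[𝓝 lam] S.resolventFormula :=
  ((meromorphicNFOn_toMeromorphicNFOn S.resolventFormula univ
    (mem_univ lam)).eventuallyEq_nhdsNE_iff_eventuallyEq_nhds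
    (S.analyticAt_resolventFormula hW).meromorphicNFAt).1
    (S.meromorphicOn_resolventFormula.toMeromorphicNFOn_eq_self_on_nhdsNE (mem_univ lam))

theorem isContinuedCutoffResolvent :
    IsContinuedCutoffResolvent (divFormOp α β) S.cutoff S.continuedResolvent where
  meromorphic := meromorphicNFOn_toMeromorphicNFOn _ _
  eq_of_im_pos lam hlam := by
    obtain ⟨R, hR, h⟩ := S.exists_isResolventAt hlam
    refine ⟨R, hR, fun f => ?_⟩
    rw [(S.continuedResolvent_eventuallyEq
      (S.wronskian_ne_zero_of_im_pos hlam)).self_of_nhds, h]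

/-- `exists_strip_bound` is used twice: with zero source, to exclude zeros of the Wronskian, and
with source $\chi f$, to bound $|\lambda|\sup|u|$ on $[-L,L]$. Multiplication by $\chi$ turns the
supremum bound into one in $\mathcal H$. -/
theorem exists_strip {V : ℝ → ℝ} (hV : Monotone V)
    (hVρ : ∀ x y, x ≤ y → |α x * β x - α y * β y| ≤ V y - V x) :
    ∃ C lam₀ ε₀ : ℝ, 0 < C ∧ 0 < lam₀ ∧ 0 < ε₀ ∧
      ∀ lam : ℂ, lam₀ ≤ |lam.re| → |lam.im| ≤ ε₀ → AnalyticAt ℂ S.continuedResolvent lam ∧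
        ‖graphDomainIncl (divFormOp α β) ∘L S.continuedResolvent lam‖ ≤ C * |lam.re|⁻¹ := by
  have hL := S.length_pos
  have habs : R₀ ≤ |-L| := by rw [abs_neg, abs_of_pos hL]; exact S.radius_le
  obtain ⟨C, ε, hC, hε, hbound⟩ := exists_strip_bound S.toAdmissibleCoeffs hL
    (S.left_eq_one _ habs) (S.right_eq_one _ habs) hV hVρ
  obtain ⟨K, hK, hint⟩ := S.exists_integral_norm_le (-L) L
  have hm := S.pos
  obtain ⟨κ, hκ, hmul⟩ := (S.mulExtend χ S.continuous).bound
  obtain ⟨μ, hμ, hcut⟩ := S.cutoff.bound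
  refine ⟨κ * (C * (m⁻¹ * (K * μ))), 1, ε, by positivity, one_pos, hε,
    fun lam hre him => ?_⟩
  have hre0 : 0 < |lam.re| := one_pos.trans_le hre
  have hl : |lam.re| ≤ ‖lam‖ := Complex.abs_re_le_norm lam
  have hl0 : 0 < ‖lam‖ := hre0.trans_le hl
  have hW : S.wronskian lam ≠ 0 := by
    refine S.wronskian_ne_zero fun u v h => ?_
    by_contra hne
    have hpos : 0 < ‖lam‖ * ‖u (-L)‖ := mul_pos hl0 (norm_pos_iff.2 hne)
    -- For zero source any positive `s` is allowed; this value makes the bound read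
    -- $|\lambda||u(-L)|\le\frac12|\lambda||u(-L)|$, a contradiction.
    have := hbound lam 0 u v (‖lam‖ * ‖u (-L)‖ / (2 * C)) hre him
      (continuous_zero.intervalIntegrable _ _) (by positivity)
      (by simp; positivity) h (-L) (left_mem_Icc.2 S.neg_le_self)
    rw [show C * (‖lam‖ * ‖u (-L)‖ / (2 * C)) = ‖lam‖ * ‖u (-L)‖ / 2 by field_simp] at this
    linarith
  have heq := S.continuedResolvent_eventuallyEq hW
  refine ⟨(S.analyticAt_resolventFormula hW).congr heq.symm, ?_⟩
  rw [heq.self_of_nhds]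
  refine ContinuousLinearMap.opNorm_le_bound _ (by positivity) fun f => ?_
  rw [ContinuousLinearMap.comp_apply, S.graphDomainIncl_resolventFormula]
  -- The case $f=0$ is separated because the source bound `s` in `exists_strip_bound` has to be
  -- positive.
  rcases (norm_nonneg f).eq_or_lt with hf | hf
  · rw [norm_eq_zero.1 hf.symm, map_zero]
    simp [outgoingData]
  set g := S.cutoff f
  have hg : ‖g‖ ≤ μ * ‖f‖ := hcut f
  have hgi : IntervalIntegrable g volume (-L) L :=
    (S.locallyIntegrable_coeFn g).intervalIntegrable' _ _
  have hgs : ∫ t in (-L)..L, ‖g t‖ ≤ m⁻¹ * (K * (μ * ‖f‖)) := by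
    have h1 : ∫ t in (-L)..L, ‖g t‖ ≤ ∫ t in (-L)..L, m⁻¹ * (β t * ‖g t‖) := by
      have hβg : IntervalIntegrable (fun t => β t * ‖g t‖) volume (-L) L := by
        refine (S.intervalIntegrable_weight_mul g (-L) L).norm.congr fun t _ => ?_
        simp only [norm_mul, Complex.norm_real]
        rw [Real.norm_of_nonneg (hm.le.trans (S.le_right t))]
      refine intervalIntegral.integral_mono_on S.neg_le_self hgi.norm
        (hβg.const_mul _) fun t _ => ?_
      rw [← mul_assoc]
      refine le_mul_of_one_le_left (norm_nonneg _) ?_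
      rw [inv_mul_eq_div, one_le_div hm]
      exact S.le_right t
    refine h1.trans ?_
    rw [intervalIntegral.integral_const_mul, intervalIntegral.integral_of_le S.neg_le_self]
    gcongr
    exact (hint g).trans (by gcongr)
  have hsol := hbound lam g _ _ _ hre him hgi (by positivity) hgs (S.outgoingData_spec hW g)
  set p := S.solMap lam (S.outgoingData lam g)
  have hp : ‖p‖ ≤ C * (m⁻¹ * (K * (μ * ‖f‖))) * |lam.re|⁻¹ := by
    refine (ContinuousMap.norm_le _ (by positivity)).2 fun x => ?_
    have := hsol x.1 x.2
    rw [extendIcc_of_mem _ _ x.2] at this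
    rw [← div_eq_mul_inv, le_div_iff₀ hre0, mul_comm]
    exact (mul_le_mul_of_nonneg_right hl (norm_nonneg _)).trans this
  calc ‖S.mulExtend χ S.continuous p‖ ≤ κ * ‖p‖ := hmul p
    _ ≤ κ * (C * (m⁻¹ * (K * (μ * ‖f‖))) * |lam.re|⁻¹) := by gcongr
    _ = _ := by ring

end ScatteringSetting

/-! ### Monotone majorants for functions of bounded variation -/

section BoundedVariation

/-- With the Jordan decomposition $f=p-q$, take $V=p+q$. -/
theorem BoundedVariationOn.exists_monotone_abs_sub_le {f : ℝ → ℝ}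
    (hf : BoundedVariationOn f univ) :
    ∃ V : ℝ → ℝ, Monotone V ∧ ∀ x y, x ≤ y → |f x - f y| ≤ V y - V x := by
  obtain ⟨p, q, hp, hq, rfl⟩ :=
    hf.locallyBoundedVariationOn.exists_monotoneOn_sub_monotoneOn
  rw [monotoneOn_univ] at hp hq
  refine ⟨p + q, hp.add hq, fun x y hxy => ?_⟩
  have h1 := hp hxy
  have h2 := hq hxy
  simp only [Pi.sub_apply, Pi.add_apply]
  rw [abs_le]
  constructor <;> linarith

/-- Used for the product $\alpha\beta$, the only combination of the coefficients whose variation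
enters the energy estimate. -/
theorem exists_monotone_abs_mul_sub_le {f g : ℝ → ℝ} {M : ℝ} (hf : BoundedVariationOn f univ)
    (hg : BoundedVariationOn g univ) (hfM : ∀ x, |f x| ≤ M) (hgM : ∀ x, |g x| ≤ M) :
    ∃ V : ℝ → ℝ, Monotone V ∧ ∀ x y, x ≤ y → |f x * g x - f y * g y| ≤ V y - V x := by
  obtain ⟨V, hV, hVf⟩ := hf.exists_monotone_abs_sub_le
  obtain ⟨W, hW, hWg⟩ := hg.exists_monotone_abs_sub_le
  have hM : 0 ≤ M := (abs_nonneg _).trans (hfM 0)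
  refine ⟨fun x => M * (V x + W x), (hV.add hW).const_mul hM, fun x y hxy => ?_⟩
  calc |f x * g x - f y * g y| = |f x * (g x - g y) + (f x - f y) * g y| := by congr 1; ring
    _ ≤ |f x| * |g x - g y| + |f x - f y| * |g y| := by
      rw [← abs_mul, ← abs_mul]; exact abs_add_le _ _
    _ ≤ M * (W y - W x) + (V y - V x) * M := by
      have := hVf x y hxy
      have := (abs_nonneg _).trans this
      gcongr
      exacts [hfM x, hWg x y hxy, hgM y]
    _ = _ := by ring

theorem BoundedVariationOn.exists_abs_le {f : ℝ → ℝ} (hf : BoundedVariationOn f univ) :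
    ∃ M : ℝ, ∀ x, |f x| ≤ M := by
  refine ⟨|f 0| + (eVariationOn f univ).toReal, fun x => ?_⟩
  have := hf.dist_le (mem_univ x) (mem_univ 0)
  rw [Real.dist_eq] at this
  have h2 := abs_sub_abs_le_abs_sub (f x) (f 0)
  linarith

end BoundedVariation

end

theorem theorem2 (α β : ℝ → ℝ)
    (hα_pos : ∀ x, 0 < α x) (hβ_pos : ∀ x, 0 < β x)
    (hα_bv : BoundedVariationOn α univ) (hβ_bv : BoundedVariationOn β univ)
    (hα_inf : 0 < ⨅ x, α x) (hβ_inf : 0 < ⨅ x, β x)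
    (R₀ : ℝ) (hR₀ : 0 < R₀) (h_one : ∀ x, R₀ ≤ |x| → α x = 1 ∧ β x = 1)
    (χ : ℝ → ℝ) (hχ : ContDiff ℝ ∞ χ) (hχ_supp : HasCompactSupport χ)
    (hχ_range : ∀ x, χ x ∈ Icc (0 : ℝ) 1)
    (hχ_one : ∀ᶠ x in 𝓝ˢ (Icc (-R₀) R₀), χ x = 1) :
    ∃ T : ℂ → (WeightedL2 β →L[ℂ] GraphDomain (divFormOp α β)),
      IsContinuedCutoffResolvent (divFormOp α β)
        (mulCutoff (weightMeasure β) χ hχ.continuous hχ_supp) T ∧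
      (∀ T' : ℂ → (WeightedL2 β →L[ℂ] GraphDomain (divFormOp α β)),
        IsContinuedCutoffResolvent (divFormOp α β)
          (mulCutoff (weightMeasure β) χ hχ.continuous hχ_supp) T' → T' = T) ∧
      ∃ C lam₀ ε₀ : ℝ, 0 < C ∧ 0 < lam₀ ∧ 0 < ε₀ ∧
        ∀ lam : ℂ, lam₀ ≤ |lam.re| → |lam.im| ≤ ε₀ →
          AnalyticAt ℂ T lam ∧
          ‖graphDomainIncl (divFormOp α β) ∘L T lam‖ ≤ C * |lam.re|⁻¹ := by
  obtain ⟨Mα, hMα⟩ := hα_bv.exists_abs_le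
  obtain ⟨Mβ, hMβ⟩ := hβ_bv.exists_abs_le
  obtain ⟨r, hr, hχr⟩ := hχ_supp.exists_Icc
  have hbα : BddBelow (range α) := ⟨0, by rintro _ ⟨x, rfl⟩; exact (hα_pos x).le⟩
  have hbβ : BddBelow (range β) := ⟨0, by rintro _ ⟨x, rfl⟩; exact (hβ_pos x).le⟩
  -- The cutoff vanishes for $|x|\ge r$; the extra $1$ in $L$ makes it vanish in a neighbourhood of
  -- every point with $|x|\ge L$, so its derivatives vanish there as well.
  have S : ScatteringSetting α β χ (min (⨅ x, α x) (⨅ x, β x)) (max Mα Mβ) R₀ (max R₀ (r + 1)) :=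
    { pos := lt_min hα_inf hβ_inf
      measurable_left := hα_bv.measurable_of_univ
      measurable_right := hβ_bv.measurable_of_univ
      le_left := fun x => (min_le_left _ _).trans (ciInf_le hbα x)
      left_le := fun x => (le_abs_self _).trans ((hMα x).trans (le_max_left _ _))
      le_right := fun x => (min_le_right _ _).trans (ciInf_le hbβ x)
      right_le := fun x => (le_abs_self _).trans ((hMβ x).trans (le_max_right _ _))
      radius_pos := hR₀
      radius_le := le_max_left _ _
      left_eq_one := fun x hx => (h_one x hx).1
      right_eq_one := fun x hx => (h_one x hx).2
      contDiff := hχ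
      hasCompactSupport := hχ_supp
      eventually_one := fun x hx => eventually_nhdsSet_iff_forall.1 hχ_one x (abs_le.1 hx)
      eventually_zero := fun x hx => by
        have hlt : r < |x| := by linarith [le_max_right R₀ (r + 1)]
        filter_upwards [(isOpen_lt continuous_const continuous_abs).mem_nhds hlt] with y hy
        exact hχr y (le_of_lt hy) }
  obtain ⟨V, hV, hVρ⟩ := exists_monotone_abs_mul_sub_le hα_bv hβ_bv
    (fun x => (hMα x).trans (le_max_left Mα Mβ)) (fun x => (hMβ x).trans (le_max_right Mα Mβ))
  exact ⟨S.continuedResolvent, S.isContinuedCutoffResolvent,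
    fun T' hT' => hT'.eq S.isContinuedCutoffResolvent, S.exists_strip hV hVρ⟩
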